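/- Let $\mathcal M$ be a supermanifold of dimension $p|q$ (real smooth, complex analytic, or algebraic over a field of characteristic zero; $k$ denotes the ground field), i.e. a space with a sheaf $\mathcal O=\mathcal O_{\mathcal M}$ of supercommutative $k$-superalgebras which is locally isomorphic to $(Z,\mathcal O_Z\otimes_k\Lambda[\theta_1,\dots,\theta_q])$, where $Z$ is an open subset of $\mathbb R^p$ with its smooth functions, an open subset of $\mathbb C^p$ with its holomorphic functions, or a smooth $k$-scheme of dimension $p$. Let $\mathcal T$ be the sheaf of superderivations of $\mathcal O$, and let $\mathcal D\subseteq \mathcal End_k(\mathcal O)$ be the sheaf of differential operators, i.e. the sheaf of subalgebras generated by $\mathcal O$ and $\mathcal T$. For $n\ge 0$ let $(\Omega^n_{odd})^*=S^n\,\Pi\mathcal T$ be the $n$-th supersymmetric power over $\mathcal O$ of the parity-shifted tangent sheaf $\Pi\mathcal T$, where $|\pi X|=|X|+1$. On $S^\bullet\Pi\mathcal T$ let $\langle dg,\cdot\rangle$ be the superderivation of parity $|g|+1$ with $\langle dg,f\rangle=0$ and $\langle dg,\pi X\rangle=(-1)^{(|X|+1)(|g|+1)}X(g)$, and let $\mathfrak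 L_Y$ be the Lie derivative, i.e. the superderivation of parity $|Y|$ with $\mathfrak L_Y f=Y(f)$ and $\mathfrak L_Y(\pi X)=\pi[Y,X]$. Form the sheaf tensor products $\mathcal D\otimes_{\mathcal O}S^n\,\Pi\mathcal T$ with respect to right multiplication of differential operators by functions. There is a unique family of morphisms of sheaves of $k$-modules $$\delta:\ \mathcal D\otimes_{\mathcal O}S^{n+1}\,\Pi\mathcal T\longrightarrow \mathcal D\otimes_{\mathcal O}S^{n}\,\Pi\mathcal T\qquad(n\ge 0)$$ such that in every system of local coordinates $x=(z_1,\dots,z_p\,|\,\theta_1,\dots,\theta_q)$, with coordinate vector fields $\partial_a$, and for every homogeneous $\tau$, $$\delta(F\otimes\tau)=(-1)^{|\tau|}\sum_a F\,\partial_a\otimes\langle dx_a,\tau\rangle-(-1)^{|\tau|}\,F\otimes\sum_a\langle dx_a,\mathfrak L_{\partial_a}\tau\rangle .$$ It satisfies $\delta^2=0$. The resulting complex of sheaves $(\mathcal D\otimes_{\mathcal O}(\Omega^\bullet_{odd})^*,\delta)$, the universal Spencer complex of $\mathcal M$, has homology canonically isomorphic to $\mathcal O$: $$H_n\big(\mathcal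 D\otimes_{\mathcal O}(\Omega^\bullet_{odd})^*,\delta\big)=0\quad(n\ge 1),\qquad H_0\big(\mathcal D\otimes_{\mathcal O}(\Omega^\bullet_{odd})^*,\delta\big)\ \cong\ \mathcal O ,$$ the isomorphism being the one induced by the augmentation $\mathcal D\otimes_{\mathcal O}S^0\,\Pi\mathcal T\to\mathcal O$, $F\otimes f\mapsto F(f)$. -/

import Mathlib

open CategoryTheory TopologicalSpace Opposite
open scoped TensorProduct Manifold ContDiff

universe u

/-- The Koszul sign `(-1) ^ i` of a parity `i`. -/
def koszulSign (i : ZMod 2) : ℤ := (-1) ^ i.val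

/-- A superspace over `k`: a topological space with a sheaf of supercommutative `k`-superalgebras. -/
structure Superspace (k : Type u) [Field k] where
  space : TopCat.{u}
  sheaf : TopCat.Sheaf (AlgCat.{u} k) space
  /-- The homogeneous sections of a given parity. -/
  parity : (U : Opens space) → ZMod 2 → Submodule k (sheaf.presheaf.obj (op U))
  isCompl : ∀ U, IsCompl (parity U 0) (parity U 1)
  parity_one : ∀ U, 1 ∈ parity U 0
  parity_mul : ∀ {U i j f g}, f ∈ parity U i → g ∈ parity U j → f * g ∈ parity U (i + j)
  parity_res : ∀ {U V : Opens space} (h : V ≤ U) {i f}, f ∈ parity U i →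
    (sheaf.presheaf.map (homOfLE h).op).hom f ∈ parity V i
  supercomm : ∀ {U i j f g}, f ∈ parity U i → g ∈ parity U j →
    g * f = koszulSign (i * j) • (f * g)

namespace Superspace

variable {k : Type u} [Field k] (M : Superspace k)

/-- The sections of the structure sheaf. -/
abbrev Fn (U : Opens M.space) : Type u := M.sheaf.presheaf.obj (op U)

/-- Restriction of sections of the structure sheaf. -/
def res {U V : Opens M.space} (h : V ≤ U) : M.Fn U →ₐ[k] M.Fn V :=
  (M.sheaf.presheaf.map (homOfLE h).op).hom

theorem res_res {U V W : Opens M.space} (h : V ≤ U) (h' : W ≤ V) (f : M.Fn U) :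
    M.res h' (M.res h f) = M.res (h'.trans h) f := by
  have : M.sheaf.presheaf.map (homOfLE (h'.trans h)).op =
      M.sheaf.presheaf.map (homOfLE h).op ≫ M.sheaf.presheaf.map (homOfLE h').op := by
    rw [← Functor.map_comp]; rfl
  simp [res, this]

theorem res_self {U : Opens M.space} (f : M.Fn U) : M.res le_rfl f = f := by
  have : M.sheaf.presheaf.map (homOfLE (le_refl U)).op = 𝟙 _ := by
    rw [← M.sheaf.presheaf.map_id]; rfl
  unfold res
  rw [this]
  rfl

/-! ### Differential operators -/

/-- The families of `k`-linear endomorphisms of `O(V)`, for `V ⊆ U`, which commute with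
restrictions. -/
def localEndSubalgebra (U : Opens M.space) :
    Subalgebra k (∀ V : {V : Opens M.space // V ≤ U}, Module.End k (M.Fn V.1)) where
  carrier := {P | ∀ (V W : {V : Opens M.space // V ≤ U}) (h : W.1 ≤ V.1) (f : M.Fn V.1),
    M.res h (P V f) = P W (M.res h f)}
  mul_mem' {P Q} hP hQ V W h f := by
    change M.res h (P V (Q V f)) = P W (Q W _)
    rw [hP, hQ]
  add_mem' {P Q} hP hQ V W h f := by
    change M.res h (P V f + Q V f) = P W _ + Q W _
    rw [map_add, hP, hQ]
  algebraMap_mem' c V W h f := by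
    simp [Algebra.algebraMap_eq_smul_one]

/-- The algebra of sections over `U` of the sheaf `End_k(O)` of local `k`-linear endomorphisms of
the structure sheaf. -/
def LocalEnd (U : Opens M.space) : Type u := M.localEndSubalgebra U

instance (U : Opens M.space) : Ring (M.LocalEnd U) :=
  inferInstanceAs (Ring (M.localEndSubalgebra U))

instance (U : Opens M.space) : Algebra k (M.LocalEnd U) :=
  inferInstanceAs (Algebra k (M.localEndSubalgebra U))

/-- The action of a local endomorphism over `U` on the sections over `V ⊆ U`. -/
def app {U : Opens M.space} (P : M.LocalEnd U) (V : {V : Opens M.space // V ≤ U}) :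
    M.Fn V.1 →ₗ[k] M.Fn V.1 := Subtype.val P V

theorem app_ext {U : Opens M.space} {P Q : M.LocalEnd U} (h : ∀ V f, M.app P V f = M.app Q V f) :
    P = Q :=
  Subtype.ext (funext fun V => LinearMap.ext (h V))

/-- Restriction of local endomorphisms. -/
def endRes {U V : Opens M.space} (h : V ≤ U) : M.LocalEnd U →ₐ[k] M.LocalEnd V where
  toFun P := ⟨fun W => M.app P ⟨W.1, W.2.trans h⟩, fun _ _ hW f => P.2 ⟨_, _⟩ ⟨_, _⟩ hW f⟩
  map_one' := rfl
  map_mul' _ _ := rfl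
  map_zero' := rfl
  map_add' _ _ := rfl
  commutes' _ := rfl

/-- The value of a local endomorphism on a section over the whole of `U`. -/
def ev {U : Opens M.space} (P : M.LocalEnd U) : M.Fn U →ₗ[k] M.Fn U := M.app P ⟨U, le_rfl⟩

theorem ev_mul {U : Opens M.space} (P Q : M.LocalEnd U) (f : M.Fn U) :
    M.ev (P * Q) f = M.ev P (M.ev Q f) := rfl

theorem res_ev {U V : Opens M.space} (h : V ≤ U) (P : M.LocalEnd U) (f : M.Fn U) :
    M.res h (M.ev P f) = M.ev (M.endRes h P) (M.res h f) :=
  P.2 ⟨U, le_rfl⟩ ⟨V, h⟩ h f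

/-- A function, as the operator of multiplication by it. -/
def multOp (U : Opens M.space) : M.Fn U →ₐ[k] M.LocalEnd U where
  toFun f := ⟨fun V => LinearMap.mulLeft k (M.res V.2 f), fun V W h g => by
    simp [res_res]⟩
  map_one' := by
    refine M.app_ext fun V g => ?_
    change M.res V.2 1 * g = g
    rw [map_one, one_mul]
  map_mul' f f' := by
    refine M.app_ext fun V g => ?_
    change M.res V.2 (f * f') * g = M.res V.2 f * (M.res V.2 f' * g)
    rw [map_mul, mul_assoc]
  map_zero' := by
    refine M.app_ext fun V g => ?_
    change M.res V.2 0 * g = 0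
    rw [map_zero, zero_mul]
  map_add' f f' := by
    refine M.app_ext fun V g => ?_
    change M.res V.2 (f + f') * g = M.res V.2 f * g + M.res V.2 f' * g
    rw [map_add, add_mul]
  commutes' c := by
    refine M.app_ext fun V g => ?_
    change M.res V.2 (algebraMap k _ c) * g = c • g
    rw [AlgHom.commutes, Algebra.smul_def]

theorem ev_multOp {U : Opens M.space} (f g : M.Fn U) : M.ev (M.multOp U f) g = f * g := by
  change M.res _ f * g = _
  rw [res_self]

theorem endRes_multOp {U V : Opens M.space} (h : V ≤ U) (f : M.Fn U) :
    M.endRes h (M.multOp U f) = M.multOp V (M.res h f) := by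
  refine M.app_ext fun W g => ?_
  change M.res _ f * g = M.res _ (M.res h f) * g
  rw [res_res]

/-- The vector fields of parity `i` on `U`: the superderivations of parity `i` of the structure
sheaf restricted to `U`. The tangent sheaf is the direct sum of its two homogeneous parts. -/
def vecField (U : Opens M.space) (i : ZMod 2) : Submodule k (M.LocalEnd U) where
  carrier := {X | ∀ (V : {V : Opens M.space // V ≤ U}) (j : ZMod 2) (f : M.Fn V.1), f ∈ M.parity V.1 j →
    M.app X V f ∈ M.parity V.1 (i + j) ∧
    ∀ g, M.app X V (f * g) = M.app X V f * g + koszulSign (i * j) • (f * M.app X V g)}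
  zero_mem' V j f _ := by
    have h : ∀ g, M.app (0 : M.LocalEnd U) V g = 0 := fun _ => rfl
    exact ⟨by rw [h]; exact zero_mem _, fun g => by rw [h, h, h]; simp⟩
  add_mem' {X Y} hX hY V j f hf := by
    refine ⟨add_mem (hX V j f hf).1 (hY V j f hf).1, fun g => ?_⟩
    change M.app X V (f * g) + M.app Y V (f * g) = (M.app X V f + M.app Y V f) * g +
      koszulSign (i * j) • (f * (M.app X V g + M.app Y V g))
    rw [(hX V j f hf).2, (hY V j f hf).2, add_mul, mul_add, smul_add]
    abel
  smul_mem' c X hX V j f hf := by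
    refine ⟨Submodule.smul_mem _ c (hX V j f hf).1, fun g => ?_⟩
    change c • M.app X V (f * g) = (c • M.app X V f) * g + koszulSign (i * j) • (f * (c • M.app X V g))
    rw [(hX V j f hf).2, smul_add, smul_mul_assoc, mul_smul_comm, smul_comm c]

theorem ev_mem {U : Opens M.space} {i j : ZMod 2} {X : M.LocalEnd U} (hX : X ∈ M.vecField U i)
    {f : M.Fn U} (hf : f ∈ M.parity U j) : M.ev X f ∈ M.parity U (i + j) :=
  (hX ⟨U, le_rfl⟩ j f hf).1

theorem ev_leibniz {U : Opens M.space} {i j : ZMod 2} {X : M.LocalEnd U}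
    (hX : X ∈ M.vecField U i) {f : M.Fn U} (hf : f ∈ M.parity U j) (g : M.Fn U) :
    M.ev X (f * g) = M.ev X f * g + koszulSign (i * j) • (f * M.ev X g) :=
  (hX ⟨U, le_rfl⟩ j f hf).2 g

theorem ev_one {U : Opens M.space} {i : ZMod 2} {X : M.LocalEnd U}
    (hX : X ∈ M.vecField U i) : M.ev X 1 = 0 := by
  have := M.ev_leibniz hX (M.parity_one U) 1
  simpa [koszulSign] using this

theorem endRes_mem {U V : Opens M.space} (h : V ≤ U) {i : ZMod 2} {X : M.LocalEnd U}
    (hX : X ∈ M.vecField U i) : M.endRes h X ∈ M.vecField V i :=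
  fun W j f hf => hX ⟨W.1, W.2.trans h⟩ j f hf

theorem koszulSign_mul (i j : ZMod 2) : koszulSign i * koszulSign j = koszulSign (i + j) := by
  revert i j; decide

/-- Left multiplication of a vector field by a function. -/
theorem multOp_mul_mem {U : Opens M.space} {i j : ZMod 2} {f : M.Fn U} (hf : f ∈ M.parity U j)
    {X : M.LocalEnd U} (hX : X ∈ M.vecField U i) :
    M.multOp U f * X ∈ M.vecField U (j + i) := by
  intro V l g hg
  have hf' : M.res V.2 f ∈ M.parity V.1 j := M.parity_res V.2 hf
  refine ⟨by rw [add_assoc]; exact M.parity_mul hf' (hX V l g hg).1, fun x => ?_⟩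
  change M.res V.2 f * M.app X V (g * x) = M.res V.2 f * M.app X V g * x +
    koszulSign ((j + i) * l) • (g * (M.res V.2 f * M.app X V x))
  rw [(hX V l g hg).2, mul_add, ← mul_assoc, ← mul_assoc g, M.supercomm hf' hg]
  simp only [mul_smul_comm, smul_mul_assoc, smul_smul, mul_assoc, koszulSign_mul]
  have e : ∀ a b c : ZMod 2, a * c = (b + a) * c + b * c := by decide
  rw [← e]

/-- The supercommutator `[X, Y] = X Y - (-1) ^ (|X| |Y|) Y X` of homogeneous vector fields. -/
def bracket {U : Opens M.space} (i j : ZMod 2) (X Y : M.LocalEnd U) : M.LocalEnd U :=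
  X * Y - koszulSign (i * j) • (Y * X)

theorem bracket_mem {U : Opens M.space} {i j : ZMod 2} {X Y : M.LocalEnd U}
    (hX : X ∈ M.vecField U i) (hY : Y ∈ M.vecField U j) :
    M.bracket i j X Y ∈ M.vecField U (i + j) := by
  intro V l f hf
  have key : ∀ g, M.app (M.bracket i j X Y) V g =
      M.app X V (M.app Y V g) - koszulSign (i * j) • M.app Y V (M.app X V g) := fun g => rfl
  have h1 := hX V _ _ (hY V l f hf).1
  have h2 := hY V _ _ (hX V l f hf).1
  refine ⟨?_, fun g => ?_⟩
  · rw [key]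
    refine sub_mem ?_ (zsmul_mem ?_ _)
    · rw [add_assoc]; exact h1.1
    · rw [add_comm i j, add_assoc]; exact h2.1
  · rw [key, key, key, (hY V l f hf).2, (hX V l f hf).2, map_add, map_add, map_zsmul, map_zsmul,
      h1.2, h2.2, (hX V l f hf).2, (hY V l f hf).2]
    simp only [smul_add, smul_smul, koszulSign_mul, sub_mul, mul_sub, smul_sub, mul_smul_comm,
      smul_mul_assoc]
    have e1 : ∀ i j l : ZMod 2, i * j + j * (i + l) = j * l := by decide
    have e2 : ∀ i j l : ZMod 2, i * (j + l) = i * j + i * l := by decide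
    have e3 : ∀ i j l : ZMod 2, j * l + i * l = (i + j) * l := by decide
    have e4 : ∀ i j l : ZMod 2, i * j + (i * l + j * l) = (i + j) * l + i * j := by decide
    rw [e1, e2, e3, e4]
    abel

/-- The algebra of endomorphisms over `U` generated by the functions and vector fields on `U`. -/
def diffOpGen (U : Opens M.space) : Subalgebra k (M.LocalEnd U) :=
  Algebra.adjoin k (Set.range (M.multOp U) ∪ M.vecField U 0 ∪ M.vecField U 1)

theorem multOp_mem_gen {U : Opens M.space} (f : M.Fn U) : M.multOp U f ∈ M.diffOpGen U :=
  Algebra.subset_adjoin (Or.inl (Or.inl ⟨f, rfl⟩))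

theorem vecField_mem_gen {U : Opens M.space} {i : ZMod 2} {X : M.LocalEnd U}
    (hX : X ∈ M.vecField U i) : X ∈ M.diffOpGen U := by
  have : ∀ a : ZMod 2, a = 0 ∨ a = 1 := by decide
  rcases this i with rfl | rfl
  · exact Algebra.subset_adjoin (Or.inl (Or.inr hX))
  · exact Algebra.subset_adjoin (Or.inr hX)

theorem endRes_mem_gen {U V : Opens M.space} (h : V ≤ U) {P : M.LocalEnd U}
    (hP : P ∈ M.diffOpGen U) : M.endRes h P ∈ M.diffOpGen V := by
  have : M.diffOpGen U ≤ (M.diffOpGen V).comap (M.endRes h) := by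
    refine Algebra.adjoin_le ?_
    rintro _ ((⟨f, rfl⟩ | hX) | hX)
    · change M.endRes h _ ∈ M.diffOpGen V
      rw [endRes_multOp]
      exact M.multOp_mem_gen _
    · exact M.vecField_mem_gen (M.endRes_mem h hX)
    · exact M.vecField_mem_gen (M.endRes_mem h hX)
  exact this hP

/-- The sections over `U` of the sheaf of differential operators: the subsheaf of algebras of
`End_k(O)` generated by functions and vector fields. -/
def diffOp (U : Opens M.space) : Subalgebra k (M.LocalEnd U) where
  carrier := {P | ∀ x ∈ U, ∃ (V : Opens M.space) (h : V ≤ U), x ∈ V ∧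
    M.endRes h P ∈ M.diffOpGen V}
  mul_mem' {P Q} hP hQ x hx := by
    obtain ⟨V, hV, hxV, hP⟩ := hP x hx
    obtain ⟨W, hW, hxW, hQ⟩ := hQ x hx
    refine ⟨V ⊓ W, inf_le_left.trans hV, ⟨hxV, hxW⟩, ?_⟩
    rw [map_mul]
    exact mul_mem (M.endRes_mem_gen inf_le_left hP) (M.endRes_mem_gen inf_le_right hQ)
  add_mem' {P Q} hP hQ x hx := by
    obtain ⟨V, hV, hxV, hP⟩ := hP x hx
    obtain ⟨W, hW, hxW, hQ⟩ := hQ x hx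
    refine ⟨V ⊓ W, inf_le_left.trans hV, ⟨hxV, hxW⟩, ?_⟩
    rw [map_add]
    exact add_mem (M.endRes_mem_gen inf_le_left hP) (M.endRes_mem_gen inf_le_right hQ)
  algebraMap_mem' c x hx := ⟨U, le_rfl, hx, by
    rw [AlgHom.commutes]; exact Subalgebra.algebraMap_mem _ c⟩

theorem gen_le_diffOp (U : Opens M.space) : M.diffOpGen U ≤ M.diffOp U :=
  fun _ hP _ hx => ⟨U, le_rfl, hx, hP⟩

/-- Restriction of differential operators. -/
def diffOpRes {U V : Opens M.space} (h : V ≤ U) : M.diffOp U →ₐ[k] M.diffOp V :=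
  ((M.endRes h).comp (M.diffOp U).val).codRestrict (M.diffOp V) fun P x hx => by
    obtain ⟨W, hW, hxW, hP⟩ := P.2 x (h hx)
    exact ⟨V ⊓ W, inf_le_left, ⟨hx, hxW⟩, M.endRes_mem_gen inf_le_right hP⟩

/-- A function as a differential operator. -/
def fnOp {U : Opens M.space} (f : M.Fn U) : M.diffOp U :=
  ⟨M.multOp U f, M.gen_le_diffOp U (M.multOp_mem_gen f)⟩

/-- A homogeneous vector field as a differential operator. -/
def vecOp {U : Opens M.space} {i : ZMod 2} (X : M.vecField U i) : M.diffOp U :=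
  ⟨X, M.gen_le_diffOp U (M.vecField_mem_gen X.2)⟩

/-! ### Polyvector fields -/

/-- Generators of the superalgebra of polyvector fields: homogeneous functions `f`, and the
`Π`-vector fields `πX` of homogeneous vector fields `X`. -/
inductive PolyGen (U : Opens M.space) : Type u
  | fn (i : ZMod 2) (f : M.Fn U) (hf : f ∈ M.parity U i) : PolyGen U
  | vf (i : ZMod 2) (X : M.LocalEnd U) (hX : X ∈ M.vecField U i) : PolyGen U

/-- The parity of a generator: `|πX| = |X| + 1`. -/
def PolyGen.deg {M : Superspace k} {U : Opens M.space} : M.PolyGen U → ZMod 2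
  | .fn i _ _ => i
  | .vf i _ _ => i + 1

/-- The free algebra generator of a homogeneous function. -/
def preFn {U : Opens M.space} {i : ZMod 2} {f : M.Fn U} (hf : f ∈ M.parity U i) :
    FreeAlgebra k (M.PolyGen U) := FreeAlgebra.ι k (.fn i f hf)

/-- The free algebra generator `πX` of a homogeneous vector field `X`. -/
def preVf {U : Opens M.space} {i : ZMod 2} {X : M.LocalEnd U} (hX : X ∈ M.vecField U i) :
    FreeAlgebra k (M.PolyGen U) := FreeAlgebra.ι k (.vf i X hX)

/-- The relations of the supersymmetric algebra `S_O(ΠT)`, where `|πX| = |X| + 1`. -/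
inductive PolyRel (U : Opens M.space) :
    FreeAlgebra k (M.PolyGen U) → FreeAlgebra k (M.PolyGen U) → Prop
  | fn_add {i f g} (hf : f ∈ M.parity U i) (hg : g ∈ M.parity U i) :
      PolyRel U (M.preFn (add_mem hf hg)) (M.preFn hf + M.preFn hg)
  | fn_smul {i f} (c : k) (hf : f ∈ M.parity U i) :
      PolyRel U (M.preFn (Submodule.smul_mem _ c hf)) (c • M.preFn hf)
  | fn_one : PolyRel U (M.preFn (M.parity_one U)) 1
  | fn_mul {i j f g} (hf : f ∈ M.parity U i) (hg : g ∈ M.parity U j) :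
      PolyRel U (M.preFn (M.parity_mul hf hg)) (M.preFn hf * M.preFn hg)
  | vf_add {i X Y} (hX : X ∈ M.vecField U i) (hY : Y ∈ M.vecField U i) :
      PolyRel U (M.preVf (add_mem hX hY)) (M.preVf hX + M.preVf hY)
  | vf_smul {i X} (c : k) (hX : X ∈ M.vecField U i) :
      PolyRel U (M.preVf (Submodule.smul_mem _ c hX)) (c • M.preVf hX)
  | fn_vf {i j f X} (hf : f ∈ M.parity U j) (hX : X ∈ M.vecField U i) :
      PolyRel U (M.preVf (M.multOp_mul_mem hf hX)) (M.preFn hf * M.preVf hX)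
  | vf_fn {i j f X} (hf : f ∈ M.parity U j) (hX : X ∈ M.vecField U i) :
      PolyRel U (M.preVf hX * M.preFn hf) (koszulSign ((i + 1) * j) • (M.preFn hf * M.preVf hX))
  | vf_vf {i j X Y} (hX : X ∈ M.vecField U i) (hY : Y ∈ M.vecField U j) :
      PolyRel U (M.preVf hX * M.preVf hY)
        (koszulSign ((i + 1) * (j + 1)) • (M.preVf hY * M.preVf hX))

/-- The superalgebra `S_O(ΠT)` of polyvector fields on `U`: generated by functions and
`Π`-vector fields. -/
def Poly (U : Opens M.space) : Type u := RingQuot (M.PolyRel U)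

instance (U : Opens M.space) : Ring (M.Poly U) := inferInstanceAs (Ring (RingQuot _))

instance (U : Opens M.space) : Algebra k (M.Poly U) :=
  inferInstanceAs (Algebra k (RingQuot (M.PolyRel U)))

/-- The quotient map onto the polyvector fields. -/
def polyMk (U : Opens M.space) : FreeAlgebra k (M.PolyGen U) →ₐ[k] M.Poly U :=
  RingQuot.mkAlgHom k (M.PolyRel U)

/-- The class of a generator. -/
def gen {U : Opens M.space} (x : M.PolyGen U) : M.Poly U := M.polyMk U (FreeAlgebra.ι k x)

/-- A homogeneous function as a polyvector field. -/
def pFn {U : Opens M.space} {i : ZMod 2} {f : M.Fn U} (hf : f ∈ M.parity U i) : M.Poly U :=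
  M.gen (.fn i f hf)

/-- The `Π`-vector field `πX`. -/
def pVf {U : Opens M.space} {i : ZMod 2} {X : M.LocalEnd U} (hX : X ∈ M.vecField U i) :
    M.Poly U := M.gen (.vf i X hX)

theorem poly_rel {U : Opens M.space} {x y} (h : M.PolyRel U x y) :
    M.polyMk U x = M.polyMk U y := RingQuot.mkAlgHom_rel k h

theorem mk_preFn {U : Opens M.space} {i : ZMod 2} {f : M.Fn U} (hf : f ∈ M.parity U i) :
    M.polyMk U (M.preFn hf) = M.pFn hf := rfl

theorem mk_preVf {U : Opens M.space} {i : ZMod 2} {X : M.LocalEnd U}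
    (hX : X ∈ M.vecField U i) : M.polyMk U (M.preVf hX) = M.pVf hX := rfl

/-- Algebra maps out of the polyvector fields. -/
def polyLift {U : Opens M.space} {A : Type u} [Ring A] [Algebra k A] (φ : M.PolyGen U → A)
    (h : ∀ x y, M.PolyRel U x y → FreeAlgebra.lift k φ x = FreeAlgebra.lift k φ y) :
    M.Poly U →ₐ[k] A :=
  RingQuot.liftAlgHom k ⟨FreeAlgebra.lift k φ, fun x y hxy => h x y hxy⟩

theorem polyLift_gen {U : Opens M.space} {A : Type u} [Ring A] [Algebra k A]
    (φ : M.PolyGen U → A) (h) (x : M.PolyGen U) : M.polyLift φ h (M.gen x) = φ x := by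
  unfold polyLift gen polyMk
  erw [RingQuot.liftAlgHom_mkAlgHom_apply]
  simp

theorem poly_hom_ext {U : Opens M.space} {A : Type u} [Ring A] [Algebra k A]
    {φ ψ : M.Poly U →ₐ[k] A} (h : ∀ x, φ (M.gen x) = ψ (M.gen x)) : φ = ψ := by
  refine RingQuot.ringQuot_ext' k φ ψ ?_
  ext x
  exact h x

/-- Restriction of generators. -/
def genRes {U V : Opens M.space} (h : V ≤ U) : M.PolyGen U → M.PolyGen V
  | .fn i f hf => .fn i (M.res h f) (M.parity_res h hf)
  | .vf i X hX => .vf i (M.endRes h X) (M.endRes_mem h hX)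

/-- Restriction of polyvector fields. -/
def polyRes {U V : Opens M.space} (h : V ≤ U) : M.Poly U →ₐ[k] M.Poly V :=
  M.polyLift (fun x => M.gen (M.genRes h x)) (by
    intro x y hxy
    have hF {i f} (hf : f ∈ M.parity U i) : FreeAlgebra.lift k (fun x => M.gen (M.genRes h x))
        (M.preFn hf) = M.polyMk V (M.preFn (M.parity_res h hf)) := by
      simp [preFn]; rfl
    have hV {i X} (hX : X ∈ M.vecField U i) : FreeAlgebra.lift k (fun x => M.gen (M.genRes h x))
        (M.preVf hX) = M.polyMk V (M.preVf (M.endRes_mem h hX)) := by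
      simp [preVf]; rfl
    induction hxy with
    | fn_add hf hg =>
      rw [map_add, hF, hF, hF, ← map_add, ← M.poly_rel (.fn_add _ _)]
      congr 2; exact map_add (M.res h) _ _
    | fn_smul c hf =>
      rw [map_smul, hF, hF, ← map_smul, ← M.poly_rel (.fn_smul _ _)]
      congr 2; exact map_smul (M.res h) _ _
    | fn_one =>
      rw [map_one, hF, ← map_one (M.polyMk V), ← M.poly_rel .fn_one]
      congr 2; exact map_one (M.res h)
    | fn_mul hf hg =>
      rw [map_mul, hF, hF, hF, ← map_mul, ← M.poly_rel (.fn_mul _ _)]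
      congr 2; exact map_mul (M.res h) _ _
    | vf_add hX hY =>
      rw [map_add, hV, hV, hV, ← map_add, ← M.poly_rel (.vf_add _ _)]; rfl
    | vf_smul c hX =>
      rw [map_smul, hV, hV, ← map_smul, ← M.poly_rel (.vf_smul _ _)]; rfl
    | fn_vf hf hX =>
      rw [map_mul, hV, hF, hV, ← map_mul, ← M.poly_rel (.fn_vf _ _)]
      congr 2
      rw [map_mul, endRes_multOp]; rfl
    | vf_fn hf hX =>
      rw [map_zsmul, map_mul, map_mul, hV, hF, ← map_mul, ← map_mul, ← map_zsmul,
        ← M.poly_rel (.vf_fn _ _)]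
    | vf_vf hX hY =>
      rw [map_zsmul, map_mul, map_mul, hV, hV, ← map_mul, ← map_mul, ← map_zsmul,
        ← M.poly_rel (.vf_vf _ _)])

/-- The homogeneous polyvector `n`-fields of parity `t`. -/
def polyDeg (U : Opens M.space) : ℕ → ZMod 2 → Submodule k (M.Poly U)
  | 0, t => Submodule.span k {y | ∃ (f : M.Fn U) (hf : f ∈ M.parity U t), y = M.pFn hf}
  | n + 1, t => Submodule.span k {y | ∃ (i t' : ZMod 2) (X : M.LocalEnd U)
      (hX : X ∈ M.vecField U i) (τ : M.Poly U),
      t = (i + 1) + t' ∧ τ ∈ polyDeg U n t' ∧ y = M.pVf hX * τ}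

/-- The sections of `S^n(ΠT)`: the `Π`-vector `n`-fields. -/
def polyPow (U : Opens M.space) (n : ℕ) : Submodule k (M.Poly U) :=
  M.polyDeg U n 0 ⊔ M.polyDeg U n 1

theorem polyDeg_le (U : Opens M.space) (n : ℕ) (t : ZMod 2) : M.polyDeg U n t ≤ M.polyPow U n := by
  have : ∀ a : ZMod 2, a = 0 ∨ a = 1 := by decide
  rcases this t with rfl | rfl
  · exact le_sup_left
  · exact le_sup_right

/-! ### Superderivations of polyvector fields: contraction and Lie derivative -/

/-- The upper triangular matrix `(a b; 0 c)`. -/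
def tri {A : Type u} [Ring A] (a b c : A) : Matrix (Fin 2) (Fin 2) A := !![a, b; 0, c]

theorem tri_mul {A : Type u} [Ring A] (a b c a' b' c' : A) :
    tri a b c * tri a' b' c' = tri (a * a') (a * b' + b * c') (c * c') := by
  simp [tri]

theorem tri_add {A : Type u} [Ring A] (a b c a' b' c' : A) :
    tri a b c + tri a' b' c' = tri (a + a') (b + b') (c + c') := by
  ext i j; fin_cases i <;> fin_cases j <;> simp [tri]

theorem tri_smul {R A : Type u} [Ring A] [CommRing R] [Algebra R A] (r : R) (a b c : A) :
    r • tri a b c = tri (r • a) (r • b) (r • c) := by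
  ext i j; fin_cases i <;> fin_cases j <;> simp [tri]

theorem tri_zsmul {A : Type u} [Ring A] (r : ℤ) (a b c : A) :
    r • tri a b c = tri (r • a) (r • b) (r • c) := by
  ext i j; fin_cases i <;> fin_cases j <;> simp [tri]

theorem tri_one {A : Type u} [Ring A] : (1 : Matrix (Fin 2) (Fin 2) A) = tri 1 0 1 := by
  ext i j; fin_cases i <;> fin_cases j <;> simp [tri]

/-- The matrix `(± x, d x; 0, x)`, with the sign `(-1) ^ (ε |x|)`: such matrices multiply according
to the Leibniz rule of a superderivation of parity `ε`. -/
def superMat {U : Opens M.space} (ε : ZMod 2) (d : M.PolyGen U → M.Poly U) (x : M.PolyGen U) :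
    Matrix (Fin 2) (Fin 2) (M.Poly U) :=
  tri (koszulSign (ε * x.deg) • M.gen x) (d x) (M.gen x)

/-- The values `d` on generators are compatible with the relations of the polyvector fields. -/
abbrev SuperCompatible {U : Opens M.space} (ε : ZMod 2) (d : M.PolyGen U → M.Poly U) : Prop :=
  ∀ x y, M.PolyRel U x y →
    FreeAlgebra.lift k (M.superMat ε d) x = FreeAlgebra.lift k (M.superMat ε d) y

/-- The superderivation of parity `ε` of the polyvector fields with the values `d` on generators. -/
def superDer {U : Opens M.space} (ε : ZMod 2) (d : M.PolyGen U → M.Poly U)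
    (h : M.SuperCompatible ε d) : M.Poly U →ₗ[k] M.Poly U where
  toFun s := M.polyLift (M.superMat ε d) h s 0 1
  map_add' _ _ := by rw [map_add]; rfl
  map_smul' _ _ := by rw [map_smul]; rfl

theorem superDer_gen {U : Opens M.space} {ε : ZMod 2} {d : M.PolyGen U → M.Poly U}
    (h : M.SuperCompatible ε d) (x : M.PolyGen U) : M.superDer ε d h (M.gen x) = d x := by
  change M.polyLift (M.superMat ε d) h (M.gen x) 0 1 = _
  rw [polyLift_gen]; rfl

theorem superDer_aux {U : Opens M.space} {ε : ZMod 2} {d : M.PolyGen U → M.Poly U}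
    (h : M.SuperCompatible ε d) (s : M.Poly U) :
    ∃ a b, M.polyLift (M.superMat ε d) h s = tri a b s := by
  obtain ⟨s, rfl⟩ := RingQuot.mkAlgHom_surjective k (M.PolyRel U) s
  change ∃ a b, M.polyLift (M.superMat ε d) h (M.polyMk U s) = tri a b (M.polyMk U s)
  induction s using FreeAlgebra.induction with
  | grade0 r =>
    refine ⟨r • 1, r • 0, ?_⟩
    rw [AlgHom.commutes, AlgHom.commutes, Algebra.algebraMap_eq_smul_one,
      Algebra.algebraMap_eq_smul_one, tri_one, tri_smul]
  | grade1 x => exact ⟨_, _, M.polyLift_gen _ h x⟩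
  | mul s t hs ht =>
    obtain ⟨a, b, hs⟩ := hs
    obtain ⟨a', b', ht⟩ := ht
    exact ⟨_, _, by rw [map_mul, map_mul, hs, ht, tri_mul]⟩
  | add s t hs ht =>
    obtain ⟨a, b, hs⟩ := hs
    obtain ⟨a', b', ht⟩ := ht
    exact ⟨_, _, by rw [map_add, map_add, hs, ht, tri_add]⟩

theorem superDer_gen_mul {U : Opens M.space} {ε : ZMod 2} {d : M.PolyGen U → M.Poly U}
    (h : M.SuperCompatible ε d) (x : M.PolyGen U) (s : M.Poly U) :
    M.superDer ε d h (M.gen x * s) =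
      d x * s + koszulSign (ε * x.deg) • (M.gen x * M.superDer ε d h s) := by
  obtain ⟨a, b, hs⟩ := M.superDer_aux h s
  have hb : M.superDer ε d h s = b := by
    change M.polyLift (M.superMat ε d) h s 0 1 = b
    rw [hs]; rfl
  rw [hb]
  change M.polyLift (M.superMat ε d) h (M.gen x * s) 0 1 = _
  rw [map_mul, hs, polyLift_gen, superMat, tri_mul]
  change (koszulSign (ε * x.deg) • M.gen x) * b + d x * s = _
  rw [smul_mul_assoc, add_comm]

section Relations

variable {U : Opens M.space}

theorem pFn_congr {i j : ZMod 2} {f g : M.Fn U} (hf : f ∈ M.parity U i) (hg : g ∈ M.parity U j)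
    (hij : i = j) (h : f = g) : M.pFn hf = M.pFn hg := by
  subst hij; subst h; rfl

theorem pVf_congr {i j : ZMod 2} {X Y : M.LocalEnd U} (hX : X ∈ M.vecField U i)
    (hY : Y ∈ M.vecField U j) (hij : i = j) (h : X = Y) : M.pVf hX = M.pVf hY := by
  subst hij; subst h; rfl

theorem pFn_add {i : ZMod 2} {f g : M.Fn U} (hf : f ∈ M.parity U i) (hg : g ∈ M.parity U i) :
    M.pFn (add_mem hf hg) = M.pFn hf + M.pFn hg := by
  have := M.poly_rel (.fn_add hf hg)
  rwa [map_add] at this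

theorem pFn_smul {i : ZMod 2} {f : M.Fn U} (c : k) (hf : f ∈ M.parity U i) :
    M.pFn (Submodule.smul_mem _ c hf) = c • M.pFn hf := by
  have := M.poly_rel (.fn_smul c hf)
  rwa [map_smul] at this

theorem pFn_eq_zero {i : ZMod 2} {f : M.Fn U} (hf : f ∈ M.parity U i) (h : f = 0) :
    M.pFn hf = 0 := by
  subst h
  have := M.pFn_add hf hf
  rw [M.pFn_congr (add_mem hf hf) hf rfl (add_zero _)] at this
  simpa using this

theorem pFn_one : M.pFn (M.parity_one U) = 1 := by
  have := M.poly_rel (.fn_one (U := U))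
  rwa [map_one] at this

theorem pFn_mul {i j : ZMod 2} {f g : M.Fn U} (hf : f ∈ M.parity U i) (hg : g ∈ M.parity U j) :
    M.pFn (M.parity_mul hf hg) = M.pFn hf * M.pFn hg := by
  have := M.poly_rel (.fn_mul hf hg)
  rwa [map_mul] at this

theorem pVf_add {i : ZMod 2} {X Y : M.LocalEnd U} (hX : X ∈ M.vecField U i)
    (hY : Y ∈ M.vecField U i) : M.pVf (add_mem hX hY) = M.pVf hX + M.pVf hY := by
  have := M.poly_rel (.vf_add hX hY)
  rwa [map_add] at this

theorem pVf_smul {i : ZMod 2} {X : M.LocalEnd U} (c : k) (hX : X ∈ M.vecField U i) :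
    M.pVf (Submodule.smul_mem _ c hX) = c • M.pVf hX := by
  have := M.poly_rel (.vf_smul c hX)
  rwa [map_smul] at this

theorem pFn_mul_pVf {i j : ZMod 2} {f : M.Fn U} {X : M.LocalEnd U} (hf : f ∈ M.parity U j)
    (hX : X ∈ M.vecField U i) : M.pVf (M.multOp_mul_mem hf hX) = M.pFn hf * M.pVf hX := by
  have := M.poly_rel (.fn_vf hf hX)
  rwa [map_mul] at this

theorem pVf_mul_pFn {i j : ZMod 2} {f : M.Fn U} {X : M.LocalEnd U} (hf : f ∈ M.parity U j)
    (hX : X ∈ M.vecField U i) :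
    M.pVf hX * M.pFn hf = koszulSign ((i + 1) * j) • (M.pFn hf * M.pVf hX) := by
  have := M.poly_rel (.vf_fn hf hX)
  rwa [map_zsmul, map_mul, map_mul] at this

theorem pVf_mul_pVf {i j : ZMod 2} {X Y : M.LocalEnd U} (hX : X ∈ M.vecField U i)
    (hY : Y ∈ M.vecField U j) :
    M.pVf hX * M.pVf hY = koszulSign ((i + 1) * (j + 1)) • (M.pVf hY * M.pVf hX) := by
  have := M.poly_rel (.vf_vf hX hY)
  rwa [map_zsmul, map_mul, map_mul] at this

theorem pFn_zsmul {i : ZMod 2} {f : M.Fn U} (n : ℤ) (hf : f ∈ M.parity U i) :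
    M.pFn (zsmul_mem hf n) = n • M.pFn hf := by
  rw [← Int.cast_smul_eq_zsmul k n (M.pFn hf), ← pFn_smul]
  exact M.pFn_congr _ _ rfl (Int.cast_smul_eq_zsmul k n f).symm

theorem pVf_zsmul {i : ZMod 2} {X : M.LocalEnd U} (n : ℤ) (hX : X ∈ M.vecField U i) :
    M.pVf (zsmul_mem hX n) = n • M.pVf hX := by
  rw [← Int.cast_smul_eq_zsmul k n (M.pVf hX), ← pVf_smul]
  exact M.pVf_congr _ _ rfl (Int.cast_smul_eq_zsmul k n X).symm

theorem pFn_supercomm {i j : ZMod 2} {f g : M.Fn U} (hf : f ∈ M.parity U i)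
    (hg : g ∈ M.parity U j) :
    M.pFn hg * M.pFn hf = koszulSign (i * j) • (M.pFn hf * M.pFn hg) := by
  rw [← pFn_mul, ← pFn_mul, ← pFn_zsmul]
  exact M.pFn_congr _ _ (add_comm _ _) (M.supercomm hf hg)

theorem pFn_eq_add {i j l : ZMod 2} {f a b : M.Fn U} {n : ℤ} (hf : f ∈ M.parity U i)
    (ha : a ∈ M.parity U j) (hb : b ∈ M.parity U l) (hj : j = i) (hl : l = i)
    (h : f = a + n • b) : M.pFn hf = M.pFn ha + n • M.pFn hb := by
  subst hj; subst hl
  rw [← pFn_zsmul, ← pFn_add]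
  exact M.pFn_congr _ _ rfl h

theorem pVf_eq_add {i j l : ZMod 2} {X A B : M.LocalEnd U} {n : ℤ} (hX : X ∈ M.vecField U i)
    (hA : A ∈ M.vecField U j) (hB : B ∈ M.vecField U l) (hj : j = i) (hl : l = i)
    (h : X = A + n • B) : M.pVf hX = M.pVf hA + n • M.pVf hB := by
  subst hj; subst hl
  rw [← pVf_zsmul, ← pVf_add]
  exact M.pVf_congr _ _ rfl h

theorem vecField_mul_multOp {l j : ZMod 2} {Y : M.LocalEnd U} {f : M.Fn U}
    (hY : Y ∈ M.vecField U l) (hf : f ∈ M.parity U j) : Y * M.multOp U f =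
      M.multOp U (M.ev Y f) + koszulSign (l * j) • (M.multOp U f * Y) := by
  refine M.app_ext fun V g => ?_
  change M.app Y V (M.res V.2 f * g) =
    M.res V.2 (M.ev Y f) * g + koszulSign (l * j) • (M.res V.2 f * M.app Y V g)
  have h : M.res V.2 f ∈ M.parity V.1 j := M.parity_res V.2 hf
  rw [(hY V j _ h).2 g, res_ev]
  rfl

theorem bracket_multOp {l i j : ZMod 2} {X Y : M.LocalEnd U} {f : M.Fn U}
    (hY : Y ∈ M.vecField U l) (hf : f ∈ M.parity U j) :
    M.bracket l (j + i) Y (M.multOp U f * X) = M.multOp U (M.ev Y f) * X +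
      koszulSign (l * j) • (M.multOp U f * M.bracket l i Y X) := by
  unfold bracket
  rw [← mul_assoc, M.vecField_mul_multOp hY hf]
  simp only [add_mul, mul_sub, smul_sub, smul_mul_assoc, mul_smul_comm, smul_smul,
    koszulSign_mul, mul_assoc, mul_add]
  abel

theorem lift_preFn (ε : ZMod 2) (d : M.PolyGen U → M.Poly U) {i : ZMod 2} {f : M.Fn U}
    (hf : f ∈ M.parity U i) : FreeAlgebra.lift k (M.superMat ε d) (M.preFn hf) =
      tri (koszulSign (ε * i) • M.pFn hf) (d (.fn i f hf)) (M.pFn hf) := by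
  simp [preFn]; rfl

theorem lift_preVf (ε : ZMod 2) (d : M.PolyGen U → M.Poly U) {i : ZMod 2} {X : M.LocalEnd U}
    (hX : X ∈ M.vecField U i) : FreeAlgebra.lift k (M.superMat ε d) (M.preVf hX) =
      tri (koszulSign (ε * (i + 1)) • M.pVf hX) (d (.vf i X hX)) (M.pVf hX) := by
  simp [preVf]; rfl

end Relations

/-- The conditions on values on generators under which they extend to a superderivation. -/
theorem superCompatible_of {U : Opens M.space} (ε : ZMod 2) (d : M.PolyGen U → M.Poly U)
    (fn_add : ∀ {i f g} (hf : f ∈ M.parity U i) (hg : g ∈ M.parity U i),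
      d (.fn i (f + g) (add_mem hf hg)) = d (.fn i f hf) + d (.fn i g hg))
    (fn_smul : ∀ {i f} (c : k) (hf : f ∈ M.parity U i),
      d (.fn i (c • f) (Submodule.smul_mem _ c hf)) = c • d (.fn i f hf))
    (fn_one : d (.fn 0 1 (M.parity_one U)) = 0)
    (fn_mul : ∀ {i j f g} (hf : f ∈ M.parity U i) (hg : g ∈ M.parity U j),
      d (.fn (i + j) (f * g) (M.parity_mul hf hg)) =
        koszulSign (ε * i) • (M.pFn hf * d (.fn j g hg)) + d (.fn i f hf) * M.pFn hg)
    (vf_add : ∀ {i X Y} (hX : X ∈ M.vecField U i) (hY : Y ∈ M.vecField U i),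
      d (.vf i (X + Y) (add_mem hX hY)) = d (.vf i X hX) + d (.vf i Y hY))
    (vf_smul : ∀ {i X} (c : k) (hX : X ∈ M.vecField U i),
      d (.vf i (c • X) (Submodule.smul_mem _ c hX)) = c • d (.vf i X hX))
    (fn_vf : ∀ {i j f X} (hf : f ∈ M.parity U j) (hX : X ∈ M.vecField U i),
      d (.vf (j + i) (M.multOp U f * X) (M.multOp_mul_mem hf hX)) =
        koszulSign (ε * j) • (M.pFn hf * d (.vf i X hX)) + d (.fn j f hf) * M.pVf hX)
    (vf_fn : ∀ {i j f X} (hf : f ∈ M.parity U j) (hX : X ∈ M.vecField U i),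
      koszulSign (ε * (i + 1)) • (M.pVf hX * d (.fn j f hf)) + d (.vf i X hX) * M.pFn hf =
        koszulSign ((i + 1) * j) •
          (koszulSign (ε * j) • (M.pFn hf * d (.vf i X hX)) + d (.fn j f hf) * M.pVf hX))
    (vf_vf : ∀ {i j X Y} (hX : X ∈ M.vecField U i) (hY : Y ∈ M.vecField U j),
      koszulSign (ε * (i + 1)) • (M.pVf hX * d (.vf j Y hY)) + d (.vf i X hX) * M.pVf hY =
        koszulSign ((i + 1) * (j + 1)) •
          (koszulSign (ε * (j + 1)) • (M.pVf hY * d (.vf i X hX)) + d (.vf j Y hY) * M.pVf hX)) :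
    M.SuperCompatible ε d := by
  intro x y h
  cases h with
  | fn_add hf hg =>
    rw [map_add, lift_preFn, lift_preFn, lift_preFn, tri_add, pFn_add, fn_add hf hg, smul_add]
  | fn_smul c hf =>
    rw [map_smul, lift_preFn, lift_preFn, tri_smul, pFn_smul, fn_smul c hf, smul_comm]
  | fn_one =>
    rw [map_one, lift_preFn, tri_one, pFn_one, fn_one]
    simp [koszulSign]
  | fn_mul hf hg =>
    rw [map_mul, lift_preFn, lift_preFn, lift_preFn, tri_mul, M.pFn_mul hf hg, fn_mul hf hg]
    simp only [smul_mul_assoc, mul_smul_comm, smul_smul, koszulSign_mul]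
    congr 3
    ring
  | vf_add hX hY =>
    rw [map_add, lift_preVf, lift_preVf, lift_preVf, tri_add, pVf_add, vf_add hX hY, smul_add]
  | vf_smul c hX =>
    rw [map_smul, lift_preVf, lift_preVf, tri_smul, pVf_smul, vf_smul c hX, smul_comm]
  | fn_vf hf hX =>
    rw [map_mul, lift_preVf, lift_preVf, lift_preFn, tri_mul, M.pFn_mul_pVf hf hX, fn_vf hf hX]
    simp only [smul_mul_assoc, mul_smul_comm, smul_smul, koszulSign_mul]
    congr 3
    ring
  | vf_fn hf hX =>
    rw [map_zsmul, map_mul, map_mul, lift_preVf, lift_preFn, tri_mul, tri_mul, tri_zsmul]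
    simp only [smul_mul_assoc, mul_smul_comm]
    rw [vf_fn hf hX, pVf_mul_pFn]
    congr 1
    simp only [smul_smul, koszulSign_mul]
    congr 2
    ring
  | vf_vf hX hY =>
    rw [map_zsmul, map_mul, map_mul, lift_preVf, lift_preVf, tri_mul, tri_mul, tri_zsmul]
    simp only [smul_mul_assoc, mul_smul_comm]
    rw [vf_vf hX hY, pVf_mul_pVf]
    congr 1
    simp only [smul_smul, koszulSign_mul]
    congr 2
    ring

/-- The values on generators of the contraction with `dg`:
`⟨dg, f⟩ = 0` and `⟨dg, πX⟩ = (-1) ^ ((|X| + 1) (|g| + 1)) X(g)`. -/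
def contractGen {U : Opens M.space} {l : ZMod 2} {g : M.Fn U} (hg : g ∈ M.parity U l) :
    M.PolyGen U → M.Poly U
  | .fn _ _ _ => 0
  | .vf i _ hX => koszulSign ((i + 1) * (l + 1)) • M.pFn (M.ev_mem hX hg)

theorem contractGen_compatible {U : Opens M.space} {l : ZMod 2} {g : M.Fn U}
    (hg : g ∈ M.parity U l) : M.SuperCompatible (l + 1) (M.contractGen hg) := by
  apply superCompatible_of
  · intros; simp [contractGen]
  · intros; simp [contractGen]
  · rfl
  · intros; simp [contractGen]
  · intro i X Y hX hY
    simp only [contractGen]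
    rw [← smul_add, ← pFn_add]; rfl
  · intro i X c hX
    simp only [contractGen]
    rw [smul_comm, ← pFn_smul]; rfl
  · intro i j f X hf hX
    simp only [contractGen, zero_mul, add_zero]
    rw [mul_smul_comm, smul_smul, ← pFn_mul, koszulSign_mul]
    have e : ∀ i j l : ZMod 2, (j + i + 1) * (l + 1) = (l + 1) * j + (i + 1) * (l + 1) := by decide
    rw [e]
    congr 1
    exact M.pFn_congr _ _ (add_assoc _ _ _) (M.ev_multOp _ _)
  · intro i j f X hf hX
    simp only [contractGen, zero_mul, add_zero, mul_zero, smul_zero, zero_add]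
    rw [smul_mul_assoc, M.pFn_supercomm hf, mul_smul_comm]
    simp only [smul_smul, koszulSign_mul]
    have e : ∀ i j l : ZMod 2, (i + 1) * (l + 1) + j * (i + l) =
      (i + 1) * j + ((l + 1) * j + (i + 1) * (l + 1)) := by decide
    rw [e]
  · intro i j X Y hX hY
    simp only [contractGen, smul_mul_assoc, mul_smul_comm, smul_add]
    rw [M.pVf_mul_pFn _ hX, M.pVf_mul_pFn _ hY]
    simp only [smul_smul, koszulSign_mul]
    have e1 : ∀ i j l : ZMod 2, (l + 1) * (i + 1) + ((j + 1) * (l + 1) + (i + 1) * (j + l)) =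
      (i + 1) * (j + 1) + (j + 1) * (l + 1) := by decide
    have e2 : ∀ i j l : ZMod 2, (i + 1) * (j + 1) + ((l + 1) * (j + 1) + ((i + 1) * (l + 1) +
      (j + 1) * (i + l))) = (i + 1) * (l + 1) := by decide
    rw [e1, e2, add_comm]

/-- The contraction `⟨dg, ·⟩` with the differential of a function `g` of parity `l`: the
superderivation of parity `l + 1` with `⟨dg, f⟩ = 0` and
`⟨dg, πX⟩ = (-1) ^ ((|X| + 1) (|g| + 1)) X(g)`. -/
def contract {U : Opens M.space} {l : ZMod 2} {g : M.Fn U} (hg : g ∈ M.parity U l) :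
    M.Poly U →ₗ[k] M.Poly U :=
  M.superDer (l + 1) (M.contractGen hg) (M.contractGen_compatible hg)

/-- The values on generators of the Lie derivative: `f ↦ Y(f)` and `πX ↦ π[Y, X]`. -/
def lieGen {U : Opens M.space} {l : ZMod 2} {Y : M.LocalEnd U} (hY : Y ∈ M.vecField U l) :
    M.PolyGen U → M.Poly U
  | .fn _ _ hf => M.pFn (M.ev_mem hY hf)
  | .vf _ _ hX => M.pVf (M.bracket_mem hY hX)

theorem lieGen_compatible {U : Opens M.space} {l : ZMod 2} {Y : M.LocalEnd U}
    (hY : Y ∈ M.vecField U l) : M.SuperCompatible l (M.lieGen hY) := by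
  apply superCompatible_of
  · intro i f g hf hg
    simp only [lieGen]
    rw [← pFn_add]
    exact M.pFn_congr _ _ rfl (map_add _ _ _)
  · intro i f c hf
    simp only [lieGen]
    rw [← pFn_smul]
    exact M.pFn_congr _ _ rfl (map_smul _ _ _)
  · simp only [lieGen]
    exact M.pFn_eq_zero _ (M.ev_one hY)
  · intro i j f g hf hg
    simp only [lieGen]
    rw [← pFn_mul, ← pFn_mul]
    refine Eq.trans ?_ (add_comm _ _)
    exact M.pFn_eq_add _ _ _ (by ring) (by ring) (M.ev_leibniz hY hf g)
  · intro i X X' hX hX'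
    simp only [lieGen]
    rw [← pVf_add]
    refine M.pVf_congr _ _ rfl ?_
    simp only [bracket, mul_add, add_mul, smul_add]
    abel
  · intro i X c hX
    simp only [lieGen]
    rw [← pVf_smul]
    refine M.pVf_congr _ _ rfl ?_
    simp only [bracket, mul_smul_comm, smul_mul_assoc, smul_sub]
    rw [smul_comm]
  · intro i j f X hf hX
    simp only [lieGen]
    rw [← pFn_mul_pVf, ← pFn_mul_pVf]
    refine Eq.trans ?_ (add_comm _ _)
    exact M.pVf_eq_add _ _ _ (by ring) (by ring) (M.bracket_multOp hY hf)
  · intro i j f X hf hX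
    simp only [lieGen]
    rw [pVf_mul_pFn, pVf_mul_pFn]
    simp only [smul_add, smul_smul, koszulSign_mul]
    have e1 : ∀ i j l : ZMod 2, l * (i + 1) + (i + 1) * (l + j) = (i + 1) * j := by decide
    have e2 : ∀ i j l : ZMod 2, (l + i + 1) * j = (i + 1) * j + l * j := by decide
    rw [e1, e2, add_comm]
  · intro i j X X' hX hX'
    simp only [lieGen]
    rw [M.pVf_mul_pVf hX, M.pVf_mul_pVf _ hX']
    simp only [smul_add, smul_smul, koszulSign_mul]
    have e1 : ∀ i j l : ZMod 2, l * (i + 1) + (i + 1) * (l + j + 1) = (i + 1) * (j + 1) := by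
      decide
    have e2 : ∀ i j l : ZMod 2,
      (l + i + 1) * (j + 1) = (i + 1) * (j + 1) + l * (j + 1) := by decide
    rw [e1, e2, add_comm]

/-- The Lie derivative along a homogeneous vector field `Y` on polyvector fields: the
superderivation of parity `|Y|` with `f ↦ Y(f)` and `πX ↦ π[Y, X]`. -/
def lieDeriv {U : Opens M.space} {l : ZMod 2} {Y : M.LocalEnd U} (hY : Y ∈ M.vecField U l) :
    M.Poly U →ₗ[k] M.Poly U :=
  M.superDer l (M.lieGen hY) (M.lieGen_compatible hY)

theorem contract_pFn {U : Opens M.space} {l j : ZMod 2} {g f : M.Fn U} (hg : g ∈ M.parity U l)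
    (hf : f ∈ M.parity U j) : M.contract hg (M.pFn hf) = 0 :=
  M.superDer_gen (M.contractGen_compatible hg) (.fn j f hf)

theorem contract_pVf_mul {U : Opens M.space} {l i : ZMod 2} {g : M.Fn U} {X : M.LocalEnd U}
    (hg : g ∈ M.parity U l) (hX : X ∈ M.vecField U i) (τ : M.Poly U) :
    M.contract hg (M.pVf hX * τ) = koszulSign ((i + 1) * (l + 1)) • (M.pFn (M.ev_mem hX hg) * τ) +
      koszulSign ((l + 1) * (i + 1)) • (M.pVf hX * M.contract hg τ) := by
  rw [← smul_mul_assoc]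
  exact M.superDer_gen_mul (M.contractGen_compatible hg) (.vf i X hX) τ

theorem lieDeriv_pFn {U : Opens M.space} {l j : ZMod 2} {f : M.Fn U} {Y : M.LocalEnd U}
    (hY : Y ∈ M.vecField U l) (hf : f ∈ M.parity U j) :
    M.lieDeriv hY (M.pFn hf) = M.pFn (M.ev_mem hY hf) :=
  M.superDer_gen (M.lieGen_compatible hY) (.fn j f hf)

theorem lieDeriv_pFn_mul {U : Opens M.space} {l j : ZMod 2} {f : M.Fn U} {Y : M.LocalEnd U}
    (hY : Y ∈ M.vecField U l) (hf : f ∈ M.parity U j) (τ : M.Poly U) :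
    M.lieDeriv hY (M.pFn hf * τ) = M.pFn (M.ev_mem hY hf) * τ +
      koszulSign (l * j) • (M.pFn hf * M.lieDeriv hY τ) :=
  M.superDer_gen_mul (M.lieGen_compatible hY) (.fn j f hf) τ

theorem lieDeriv_pVf_mul {U : Opens M.space} {l i : ZMod 2} {X Y : M.LocalEnd U}
    (hY : Y ∈ M.vecField U l) (hX : X ∈ M.vecField U i) (τ : M.Poly U) :
    M.lieDeriv hY (M.pVf hX * τ) = M.pVf (M.bracket_mem hY hX) * τ +
      koszulSign (l * (i + 1)) • (M.pVf hX * M.lieDeriv hY τ) :=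
  M.superDer_gen_mul (M.lieGen_compatible hY) (.vf i X hX) τ

/-- The recursive relation between the Lie derivatives of polyvector fields and of `1`-forms
`ω = dg`: `L_Y ⟨ω, τ⟩ = ⟨L_Y ω, τ⟩ + (-1) ^ (|ω| |Y|) ⟨ω, L_Y τ⟩`, with `L_Y dg = (-1) ^ |Y| d(Yg)`
as `d` is odd. -/
theorem lieDeriv_contract {U : Opens M.space} {l j t : ZMod 2} {g : M.Fn U} {Y : M.LocalEnd U}
    (hY : Y ∈ M.vecField U l) (hg : g ∈ M.parity U j) {n : ℕ} {τ : M.Poly U}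
    (hτ : τ ∈ M.polyDeg U n t) :
    M.lieDeriv hY (M.contract hg τ) = koszulSign l • M.contract (M.ev_mem hY hg) τ +
      koszulSign ((j + 1) * l) • M.contract hg (M.lieDeriv hY τ) := by
  induction n generalizing t τ with
  | zero =>
    induction hτ using Submodule.span_induction with
    | mem y hy =>
      obtain ⟨f, hf, rfl⟩ := hy
      rw [lieDeriv_pFn, contract_pFn, contract_pFn, contract_pFn]
      simp
    | zero => simp
    | add x y _ _ hx hy => simp only [map_add, hx, hy, smul_add]; abel
    | smul c x _ hx => simp only [map_smul, hx, smul_add, smul_comm c]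
  | succ n ih =>
    induction hτ using Submodule.span_induction with
    | mem y hy =>
      obtain ⟨i, t', X, hX, τ, rfl, hτ, rfl⟩ := hy
      have hb : M.pFn (M.ev_mem (M.bracket_mem hY hX) hg) = M.pFn (M.ev_mem hY (M.ev_mem hX hg)) +
          (-koszulSign (l * i)) • M.pFn (M.ev_mem hX (M.ev_mem hY hg)) := by
        refine M.pFn_eq_add _ _ _ (by ring) (by ring) ?_
        rw [neg_smul, ← sub_eq_add_neg]; rfl
      rw [contract_pVf_mul, map_add, map_zsmul, map_zsmul, lieDeriv_pFn_mul, lieDeriv_pVf_mul,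
        contract_pVf_mul, lieDeriv_pVf_mul, map_add, map_zsmul, contract_pVf_mul, contract_pVf_mul,
        ih hτ, hb]
      generalize M.pFn _ = A, M.pFn _ = B, M.pFn _ = C
      simp only [add_mul, mul_add, smul_add, smul_mul_assoc, mul_smul_comm, smul_smul,
        koszulSign_mul, neg_mul, neg_smul]
      have k0 : koszulSign 0 = 1 := rfl
      have k1 : koszulSign 1 = -1 := rfl
      have h2 : (1 : ZMod 2) + 1 = 0 := rfl
      have z : ∀ a : ZMod 2, a = 0 ∨ a = 1 := by decide
      generalize A * τ = A', C * τ = C', B * M.lieDeriv hY τ = B'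
      rcases z i with rfl | rfl <;> rcases z j with rfl | rfl <;> rcases z l with rfl | rfl <;>
        simp only [mul_zero, mul_one, add_zero, zero_add, h2, k0, k1, one_smul,
          neg_smul, neg_neg, smul_neg] <;> abel
    | zero => simp
    | add x y _ _ hx hy => simp only [map_add, hx, hy, smul_add]; abel
    | smul c x _ hx => simp only [map_smul, hx, smul_add, smul_comm c]

theorem pFn_mul_mem {U : Opens M.space} {j t : ZMod 2} {f : M.Fn U} (hf : f ∈ M.parity U j)
    {n : ℕ} {τ : M.Poly U} (hτ : τ ∈ M.polyDeg U n t) :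
    M.pFn hf * τ ∈ M.polyDeg U n (j + t) := by
  cases n with
  | zero =>
    induction hτ using Submodule.span_induction with
    | mem y hy =>
      obtain ⟨g, hg, rfl⟩ := hy
      exact Submodule.subset_span ⟨f * g, M.parity_mul hf hg, (M.pFn_mul hf hg).symm⟩
    | zero => rw [mul_zero]; exact zero_mem _
    | add x y _ _ hx hy => rw [mul_add]; exact add_mem hx hy
    | smul c x _ hx => rw [mul_smul_comm]; exact Submodule.smul_mem _ c hx
  | succ n =>
    induction hτ using Submodule.span_induction with
    | mem y hy =>
      obtain ⟨i, t', X, hX, τ, rfl, hτ, rfl⟩ := hy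
      refine Submodule.subset_span ⟨j + i, t', _, M.multOp_mul_mem hf hX, τ, by ring, hτ, ?_⟩
      rw [pFn_mul_pVf, mul_assoc]
    | zero => rw [mul_zero]; exact zero_mem _
    | add x y _ _ hx hy => rw [mul_add]; exact add_mem hx hy
    | smul c x _ hx => rw [mul_smul_comm]; exact Submodule.smul_mem _ c hx

theorem pVf_mul_mem {U : Opens M.space} {i t : ZMod 2} {X : M.LocalEnd U}
    (hX : X ∈ M.vecField U i) {n : ℕ} {τ : M.Poly U} (hτ : τ ∈ M.polyDeg U n t) :
    M.pVf hX * τ ∈ M.polyDeg U (n + 1) ((i + 1) + t) :=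
  Submodule.subset_span ⟨i, t, X, hX, τ, rfl, hτ, rfl⟩

theorem polyDeg_congr {U : Opens M.space} {n : ℕ} {s t : ZMod 2} {τ : M.Poly U} (h : s = t)
    (hτ : τ ∈ M.polyDeg U n s) : τ ∈ M.polyDeg U n t := h ▸ hτ

theorem contract_mem {U : Opens M.space} {l t : ZMod 2} {g : M.Fn U} (hg : g ∈ M.parity U l)
    {n : ℕ} {τ : M.Poly U} (hτ : τ ∈ M.polyDeg U (n + 1) t) :
    M.contract hg τ ∈ M.polyDeg U n (t + (l + 1)) := by
  have e1 : ∀ i l t' : ZMod 2, (i + l) + t' = i + 1 + t' + (l + 1) := by decide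
  induction n generalizing t τ with
  | zero =>
    induction hτ using Submodule.span_induction with
    | mem y hy =>
      obtain ⟨i, t', X, hX, τ, rfl, hτ, rfl⟩ := hy
      have h0 : M.contract hg τ = 0 := by
        induction hτ using Submodule.span_induction with
        | mem y hy =>
          obtain ⟨f, hf, rfl⟩ := hy
          exact M.superDer_gen (M.contractGen_compatible hg) _
        | zero => exact map_zero _
        | add x y _ _ hx hy => rw [map_add, hx, hy, add_zero]
        | smul c x _ hx => rw [map_smul, hx, smul_zero]
      have h := M.superDer_gen_mul (M.contractGen_compatible hg) (.vf i X hX) τ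
      change M.contract hg (M.pVf hX * τ) = _ + _ • (M.pVf hX * M.contract hg τ) at h
      rw [h, h0, mul_zero, smul_zero, add_zero, contractGen, smul_mul_assoc]
      exact zsmul_mem (M.polyDeg_congr (e1 _ _ _) (M.pFn_mul_mem _ hτ)) _
    | zero => rw [map_zero]; exact zero_mem _
    | add x y _ _ hx hy => rw [map_add]; exact add_mem hx hy
    | smul c x _ hx => rw [map_smul]; exact Submodule.smul_mem _ c hx
  | succ n ih =>
    induction hτ using Submodule.span_induction with
    | mem y hy =>
      obtain ⟨i, t', X, hX, τ, rfl, hτ, rfl⟩ := hy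
      have h := M.superDer_gen_mul (M.contractGen_compatible hg) (.vf i X hX) τ
      change M.contract hg (M.pVf hX * τ) = _ + _ • (M.pVf hX * M.contract hg τ) at h
      rw [h, contractGen, smul_mul_assoc]
      refine add_mem (zsmul_mem (M.polyDeg_congr (e1 _ _ _) (M.pFn_mul_mem _ hτ)) _)
        (zsmul_mem (M.polyDeg_congr (by ring) (M.pVf_mul_mem hX (ih hτ))) _)
    | zero => rw [map_zero]; exact zero_mem _
    | add x y _ _ hx hy => rw [map_add]; exact add_mem hx hy
    | smul c x _ hx => rw [map_smul]; exact Submodule.smul_mem _ c hx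

theorem lieDeriv_mem {U : Opens M.space} {l t : ZMod 2} {Y : M.LocalEnd U}
    (hY : Y ∈ M.vecField U l) {n : ℕ} {τ : M.Poly U} (hτ : τ ∈ M.polyDeg U n t) :
    M.lieDeriv hY τ ∈ M.polyDeg U n (t + l) := by
  induction n generalizing t τ with
  | zero =>
    induction hτ using Submodule.span_induction with
    | mem y hy =>
      obtain ⟨f, hf, rfl⟩ := hy
      refine Submodule.subset_span ⟨M.ev Y f, add_comm l t ▸ M.ev_mem hY hf, ?_⟩
      refine (M.superDer_gen (M.lieGen_compatible hY) _).trans ?_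
      exact M.pFn_congr _ _ (add_comm _ _) rfl
    | zero => rw [map_zero]; exact zero_mem _
    | add x y _ _ hx hy => rw [map_add]; exact add_mem hx hy
    | smul c x _ hx => rw [map_smul]; exact Submodule.smul_mem _ c hx
  | succ n ih =>
    induction hτ using Submodule.span_induction with
    | mem y hy =>
      obtain ⟨i, t', X, hX, τ, rfl, hτ, rfl⟩ := hy
      have h := M.superDer_gen_mul (M.lieGen_compatible hY) (.vf i X hX) τ
      change M.lieDeriv hY (M.pVf hX * τ) = _ + _ • (M.pVf hX * M.lieDeriv hY τ) at h
      rw [h, lieGen]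
      exact add_mem (M.polyDeg_congr (by ring) (M.pVf_mul_mem _ hτ))
        (zsmul_mem (M.polyDeg_congr (by ring) (M.pVf_mul_mem hX (ih hτ))) _)
    | zero => rw [map_zero]; exact zero_mem _
    | add x y _ _ hx hy => rw [map_add]; exact add_mem hx hy
    | smul c x _ hx => rw [map_smul]; exact Submodule.smul_mem _ c hx

theorem polyRes_mem_deg {U V : Opens M.space} (h : V ≤ U) {n : ℕ} {t : ZMod 2} {τ : M.Poly U}
    (hτ : τ ∈ M.polyDeg U n t) : M.polyRes h τ ∈ M.polyDeg V n t := by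
  induction n generalizing t τ with
  | zero =>
    induction hτ using Submodule.span_induction with
    | mem y hy =>
      obtain ⟨f, hf, rfl⟩ := hy
      exact Submodule.subset_span ⟨M.res h f, M.parity_res h hf, M.polyLift_gen _ _ _⟩
    | zero => rw [map_zero]; exact zero_mem _
    | add x y _ _ hx hy => rw [map_add]; exact add_mem hx hy
    | smul c x _ hx => rw [map_smul]; exact Submodule.smul_mem _ c hx
  | succ n ih =>
    induction hτ using Submodule.span_induction with
    | mem y hy =>
      obtain ⟨i, t', X, hX, τ, rfl, hτ, rfl⟩ := hy
      refine Submodule.subset_span ⟨i, t', M.endRes h X, M.endRes_mem h hX, M.polyRes h τ, rfl,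
        ih hτ, ?_⟩
      rw [map_mul]
      congr 1
      exact M.polyLift_gen _ _ _
    | zero => rw [map_zero]; exact zero_mem _
    | add x y _ _ hx hy => rw [map_add]; exact add_mem hx hy
    | smul c x _ hx => rw [map_smul]; exact Submodule.smul_mem _ c hx

theorem polyRes_mem {U V : Opens M.space} (h : V ≤ U) {n : ℕ} {τ : M.Poly U}
    (hτ : τ ∈ M.polyPow U n) : M.polyRes h τ ∈ M.polyPow V n := by
  have : M.polyPow U n ≤ (M.polyPow V n).comap (M.polyRes h).toLinearMap :=
    sup_le (fun _ hx => M.polyDeg_le V n 0 (M.polyRes_mem_deg h hx))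
      (fun _ hx => M.polyDeg_le V n 1 (M.polyRes_mem_deg h hx))
  exact this hτ

theorem polyRes_self {U : Opens M.space} (τ : M.Poly U) : M.polyRes le_rfl τ = τ := by
  have : M.polyRes (le_refl U) = AlgHom.id k _ := by
    refine M.poly_hom_ext fun x => ?_
    refine (M.polyLift_gen _ _ _).trans ?_
    cases x with
    | fn i f hf => exact M.pFn_congr _ _ rfl (M.res_self f)
    | vf i X hX => rfl
  rw [this]; rfl

theorem polyRes_polyRes {U V W : Opens M.space} (h : V ≤ U) (h' : W ≤ V) (τ : M.Poly U) :
    M.polyRes h' (M.polyRes h τ) = M.polyRes (h'.trans h) τ := by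
  have : (M.polyRes h').comp (M.polyRes h) = M.polyRes (h'.trans h) := by
    refine M.poly_hom_ext fun x => ?_
    refine Eq.trans (congrArg (M.polyRes h') (M.polyLift_gen _ _ x)) ?_
    refine (M.polyLift_gen _ _ _).trans (Eq.trans ?_ (M.polyLift_gen _ _ _).symm)
    cases x with
    | fn i f hf => exact M.pFn_congr _ _ rfl (M.res_res h h' f)
    | vf i X hX => rfl
  rw [← this]; rfl

/-- Restriction of `Π`-vector `n`-fields. -/
def polyPowRes {U V : Opens M.space} (h : V ≤ U) (n : ℕ) :
    M.polyPow U n →ₗ[k] M.polyPow V n :=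
  (M.polyRes h).toLinearMap.restrict fun _ hτ => M.polyRes_mem h hτ

/-! ### The universal Spencer sheaf -/

/-- The relations `F f ⊗ τ = F ⊗ f τ` defining the tensor product over the functions. -/
def balanceRel (U : Opens M.space) (n : ℕ) :
    Submodule k (M.diffOp U ⊗[k] M.polyPow U n) :=
  Submodule.span k {z | ∃ (F : M.diffOp U) (j : ZMod 2) (f : M.Fn U) (hf : f ∈ M.parity U j)
    (τ τ' : M.polyPow U n), (τ' : M.Poly U) = M.pFn hf * τ ∧
      z = (F * M.fnOp f) ⊗ₜ[k] τ - F ⊗ₜ[k] τ'}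

/-- The tensor product `D(U) ⊗_{O(U)} S^n(ΠT)(U)`, for the right multiplication of differential
operators by functions. -/
abbrev SpencerSections (U : Opens M.space) (n : ℕ) : Type u :=
  (M.diffOp U ⊗[k] M.polyPow U n) ⧸ M.balanceRel U n

/-- The class of `F ⊗ τ`. -/
def spencerMk {U : Opens M.space} {n : ℕ} (F : M.diffOp U) {τ : M.Poly U}
    (hτ : τ ∈ M.polyPow U n) : M.SpencerSections U n :=
  (M.balanceRel U n).mkQ (F ⊗ₜ[k] (⟨τ, hτ⟩ : M.polyPow U n))

/-- Restriction in the tensor products `D ⊗_O S^n(ΠT)`. -/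
def spencerRes {U V : Opens M.space} (h : V ≤ U) (n : ℕ) :
    M.SpencerSections U n →ₗ[k] M.SpencerSections V n :=
  (M.balanceRel U n).mapQ (M.balanceRel V n)
    (TensorProduct.map (M.diffOpRes h).toLinearMap (M.polyPowRes h n)) (by
      refine Submodule.span_le.2 ?_
      rintro _ ⟨F, j, f, hf, τ, τ', hτ, rfl⟩
      refine Submodule.subset_span ⟨M.diffOpRes h F, j, M.res h f, M.parity_res h hf,
        M.polyPowRes h n τ, M.polyPowRes h n τ', ?_, ?_⟩
      · change M.polyRes h (τ' : M.Poly U) = _ * M.polyRes h (τ : M.Poly U)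
        rw [hτ, map_mul]
        congr 1
        exact M.polyLift_gen _ _ _
      · rw [map_sub, TensorProduct.map_tmul, TensorProduct.map_tmul]
        congr 2
        change M.diffOpRes h (F * M.fnOp f) = M.diffOpRes h F * M.fnOp (M.res h f)
        rw [map_mul]
        congr 1
        exact Subtype.ext (M.endRes_multOp h f))

theorem spencerRes_mk {U V : Opens M.space} (h : V ≤ U) (n : ℕ) (F : M.diffOp U) {τ : M.Poly U}
    (hτ : τ ∈ M.polyPow U n) : M.spencerRes h n (M.spencerMk F hτ) =
      M.spencerMk (M.diffOpRes h F) (M.polyRes_mem h hτ) := rfl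

theorem spencer_hom_ext {U : Opens M.space} {n : ℕ} {A : Type u} [AddCommGroup A] [Module k A]
    {φ ψ : M.SpencerSections U n →ₗ[k] A}
    (h : ∀ (F : M.diffOp U) (τ : M.Poly U) (hτ : τ ∈ M.polyPow U n),
      φ (M.spencerMk F hτ) = ψ (M.spencerMk F hτ)) : φ = ψ := by
  refine Submodule.linearMap_qext _ (TensorProduct.ext' fun F τ => ?_)
  exact h F τ.1 τ.2

theorem spencerMk_congr {U : Opens M.space} {n : ℕ} {F G : M.diffOp U} {σ τ : M.Poly U}
    (hσ : σ ∈ M.polyPow U n) (hτ : τ ∈ M.polyPow U n) (h : F = G) (h' : σ = τ) :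
    M.spencerMk F hσ = M.spencerMk G hτ := by
  subst h; subst h'; rfl

theorem spencerRes_self (U : Opens M.space) (n : ℕ) :
    M.spencerRes (le_refl U) n = LinearMap.id :=
  M.spencer_hom_ext fun F τ hτ => (M.spencerRes_mk _ n F hτ).trans
    (M.spencerMk_congr _ hτ (Subtype.ext rfl) (M.polyRes_self τ))

theorem spencerRes_comp {U V W : Opens M.space} (h : V ≤ U) (h' : W ≤ V) (n : ℕ) :
    M.spencerRes h' n ∘ₗ M.spencerRes h n = M.spencerRes (h'.trans h) n :=
  M.spencer_hom_ext fun F τ hτ => by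
    rw [LinearMap.comp_apply, spencerRes_mk, spencerRes_mk, spencerRes_mk]
    exact M.spencerMk_congr _ _ (Subtype.ext rfl) (M.polyRes_polyRes _ _ τ)

/-- The presheaf `U ↦ D(U) ⊗_{O(U)} S^n(ΠT)(U)`. -/
noncomputable def spencerPresheaf (n : ℕ) : TopCat.Presheaf (ModuleCat.{u} k) M.space where
  obj U := ModuleCat.of k (M.SpencerSections U.unop n)
  map i := ModuleCat.ofHom (M.spencerRes i.unop.le n)
  map_id U := ModuleCat.hom_ext (M.spencerRes_self U.unop n)
  map_comp i j := ModuleCat.hom_ext (M.spencerRes_comp i.unop.le j.unop.le n).symm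

/-- The universal Spencer sheaf `D ⊗_O S^n(ΠT)` in degree `n`: the sheaf tensor product, i.e. the
sheaf associated with the presheaf of tensor products. -/
noncomputable def spencerSheaf (n : ℕ) : TopCat.Sheaf (ModuleCat.{u} k) M.space :=
  (presheafToSheaf (Opens.grothendieckTopology M.space) (ModuleCat.{u} k)).obj
    (M.spencerPresheaf n)

/-- The section of the universal Spencer sheaf defined by `F ⊗ τ`. -/
noncomputable def tens {U : Opens M.space} {n : ℕ} (F : M.diffOp U) {τ : M.Poly U}
    (hτ : τ ∈ M.polyPow U n) : (M.spencerSheaf n).presheaf.obj (op U) :=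
  ((toSheafify (Opens.grothendieckTopology M.space) (M.spencerPresheaf n)).app (op U)).hom
    (M.spencerMk F hτ)

/-! ### The differential of the universal Spencer complex -/

/-- The parity of the coordinates `x = (z_1, …, z_p | θ_1, …, θ_q)`. -/
def coordParity {p q : ℕ} : Fin p ⊕ Fin q → ZMod 2
  | .inl _ => 0
  | .inr _ => 1

/-- Local coordinates `x = (z | θ)` of dimension `p|q` on `U`, with their coordinate vector fields
`∂_a`: these satisfy `∂_a x_b = δ_ab` and form a basis of the vector fields on every smaller open
set, in that `X = ∑ X(x_a) ∂_a`. -/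
structure Coordinates (U : Opens M.space) (p q : ℕ) where
  x : Fin p ⊕ Fin q → M.Fn U
  x_mem : ∀ a, x a ∈ M.parity U (coordParity a)
  partialD : Fin p ⊕ Fin q → M.LocalEnd U
  partial_mem : ∀ a, partialD a ∈ M.vecField U (coordParity a)
  partial_self : ∀ a, M.ev (partialD a) (x a) = 1
  partial_ne : ∀ a b, a ≠ b → M.ev (partialD a) (x b) = 0
  span : ∀ (V : Opens M.space) (h : V ≤ U) (i : ZMod 2), ∀ X ∈ M.vecField V i,
    X = ∑ a, M.multOp V (M.ev X (M.res h (x a))) * M.endRes h (partialD a)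

variable {M} in
/-- `F ∂_a`, for a differential operator `F`. -/
def Coordinates.mulPartial {U : Opens M.space} {p q : ℕ} (x : M.Coordinates U p q)
    (F : M.diffOp U) (a : Fin p ⊕ Fin q) : M.diffOp U :=
  F * M.vecOp ⟨x.partialD a, x.partial_mem a⟩

/-- The family `δ` of sheaf morphisms is the Spencer differential: in all local coordinates, for
homogeneous `τ`,
`δ (F ⊗ τ) = (-1)^|τ| ∑ F ∂_a ⊗ ⟨dx_a, τ⟩ - (-1)^|τ| F ⊗ ∑ ⟨dx_a, L_{∂_a} τ⟩`. -/
def IsSpencerDifferential (p q : ℕ) (δ : ∀ n, M.spencerSheaf (n + 1) ⟶ M.spencerSheaf n) :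
    Prop :=
  ∀ (n : ℕ) (U : Opens M.space) (x : M.Coordinates U p q) (F : M.diffOp U) (t : ZMod 2)
    (τ : M.Poly U) (hτ : τ ∈ M.polyDeg U (n + 1) t),
    ((δ n).hom.app (op U)).hom (M.tens F (M.polyDeg_le U _ _ hτ)) =
      koszulSign t • (∑ a, M.tens (x.mulPartial F a)
          (M.polyDeg_le U n _ (M.contract_mem (x.x_mem a) hτ))) -
      koszulSign t • (∑ a, M.tens F (M.polyDeg_le U n _
          (M.contract_mem (x.x_mem a) (M.lieDeriv_mem (x.partial_mem a) hτ))))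

/-! ### The augmentation -/

/-- The projection of polyvector fields onto functions, killing all `πX`. -/
def polyBody (U : Opens M.space) : M.Poly U →ₐ[k] M.Fn U :=
  M.polyLift (fun | .fn _ f _ => f | .vf _ _ _ => 0) (by
    intro x y h
    cases h <;> simp [preFn, preVf])

theorem polyBody_pFn {U : Opens M.space} {i : ZMod 2} {f : M.Fn U} (hf : f ∈ M.parity U i) :
    M.polyBody U (M.pFn hf) = f := M.polyLift_gen _ _ _

theorem res_polyBody {U V : Opens M.space} (h : V ≤ U) (τ : M.Poly U) :
    M.res h (M.polyBody U τ) = M.polyBody V (M.polyRes h τ) := by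
  have : (M.res h).comp (M.polyBody U) = (M.polyBody V).comp (M.polyRes h) := by
    refine M.poly_hom_ext fun x => ?_
    refine (congrArg (M.res h) (M.polyLift_gen _ _ x)).trans ?_
    refine Eq.trans ?_ (congrArg (M.polyBody V) (M.polyLift_gen _ _ x)).symm
    refine Eq.trans ?_ (M.polyLift_gen _ _ _).symm
    cases x with
    | fn i f hf => rfl
    | vf i X hX => exact map_zero _
  exact congrArg (fun φ => φ τ) this

/-- The augmentation `F ⊗ f ↦ F(f)` on the tensor products `D(U) ⊗_{O(U)} S^0(ΠT)(U)`. -/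
def augSections (U : Opens M.space) : M.SpencerSections U 0 →ₗ[k] M.Fn U :=
  (M.balanceRel U 0).liftQ
    (TensorProduct.lift (LinearMap.mk₂ k
      (fun (F : M.diffOp U) (τ : M.polyPow U 0) => M.ev F.1 (M.polyBody U τ.1))
      (fun _ _ _ => rfl) (fun _ _ _ => rfl)
      (fun F σ τ => by
        change M.ev F.1 (M.polyBody U (σ.1 + τ.1)) = _
        rw [map_add, map_add])
      (fun c F τ => by
        change M.ev F.1 (M.polyBody U (c • τ.1)) = _
        rw [map_smul, map_smul]))) (by
    refine Submodule.span_le.2 ?_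
    rintro _ ⟨F, j, f, hf, τ, τ', hτ, rfl⟩
    change TensorProduct.lift _ (_ - _) = 0
    rw [map_sub, sub_eq_zero, TensorProduct.lift.tmul, TensorProduct.lift.tmul]
    change M.ev F.1 (M.ev (M.multOp U f) (M.polyBody U τ.1)) = M.ev F.1 (M.polyBody U τ'.1)
    rw [hτ, map_mul, polyBody_pFn, ev_multOp])

theorem augSections_mk {U : Opens M.space} (F : M.diffOp U) {τ : M.Poly U}
    (hτ : τ ∈ M.polyPow U 0) :
    M.augSections U (M.spencerMk F hτ) = M.ev F.1 (M.polyBody U τ) := rfl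

theorem augSections_res {U V : Opens M.space} (h : V ≤ U) :
    (M.res h).toLinearMap ∘ₗ M.augSections U = M.augSections V ∘ₗ M.spencerRes h 0 :=
  M.spencer_hom_ext fun F τ hτ => by
    rw [LinearMap.comp_apply, LinearMap.comp_apply, spencerRes_mk, augSections_mk, augSections_mk]
    change M.res h _ = _
    rw [res_ev, res_polyBody]
    rfl

/-- The structure sheaf, as a sheaf of `k`-modules. -/
noncomputable def fnSheaf : TopCat.Sheaf (ModuleCat.{u} k) M.space :=
  (sheafCompose (Opens.grothendieckTopology M.space)
    (forget₂ (AlgCat.{u} k) (ModuleCat.{u} k))).obj M.sheaf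

/-- The augmentation `D ⊗_O S^0(ΠT) → O`, `F ⊗ f ↦ F(f)`. -/
noncomputable def augmentation : M.spencerSheaf 0 ⟶ M.fnSheaf :=
  ⟨sheafifyLift (Opens.grothendieckTopology M.space)
    (P := M.spencerPresheaf 0) (Q := M.fnSheaf.obj)
    { app U := ModuleCat.ofHom (M.augSections U.unop)
      naturality _ _ i := ModuleCat.hom_ext (M.augSections_res i.unop.le).symm }
    M.fnSheaf.property⟩

/-! ### Supermanifolds -/

/-- The exterior algebra on `q` odd generators `θ_1, …, θ_q`. -/
abbrev Grassmann (k : Type u) [Field k] (q : ℕ) : Type u := ExteriorAlgebra k (Fin q → k)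

/-- The part of parity `i` of `A ⊗ Λ[θ_1, …, θ_q]`. -/
def splitParity (A : Type u) [CommRing A] [Algebra k A] (q : ℕ) (i : ZMod 2) :
    Submodule k (A ⊗[k] Grassmann k q) :=
  Submodule.span k {t | ∃ (a : A) (l : Grassmann k q),
    l ∈ CliffordAlgebra.evenOdd (0 : QuadraticForm k (Fin q → k)) i ∧ t = a ⊗ₜ[k] l}

/-- The image of an open set `V ⊆ U` under an open embedding `U → Z`. -/
def imageOpen {U : Opens M.space} {Z : TopCat.{u}} {φ : U → Z}
    (hφ : Topology.IsOpenEmbedding φ) (V : Opens M.space) : Opens Z :=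
  ⟨φ '' (Subtype.val ⁻¹' (V : Set M.space)),
    hφ.isOpenMap _ (V.isOpen.preimage continuous_subtype_val)⟩

theorem imageOpen_mono {U : Opens M.space} {Z : TopCat.{u}} {φ : U → Z}
    (hφ : Topology.IsOpenEmbedding φ) {V W : Opens M.space} (h : W ≤ V) :
    M.imageOpen hφ W ≤ M.imageOpen hφ V :=
  Set.image_mono (Set.preimage_mono h)

/-- An isomorphism of superspaces between `U` and an open subspace of the split superspace
`(Z, A ⊗ Λ[θ_1, …, θ_q])`, where `A` is a (pre)sheaf of commutative algebras on `Z`. -/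
structure SplitChart (U : Opens M.space) (Z : TopCat.{u})
    (A : TopCat.Presheaf (CommAlgCat.{u} k) Z) (q : ℕ) where
  map : U → Z
  isOpenEmbedding : Topology.IsOpenEmbedding map
  iso : ∀ V : Opens M.space, V ≤ U →
    M.Fn V ≃ₐ[k] A.obj (op (M.imageOpen isOpenEmbedding V)) ⊗[k] Grassmann k q
  map_parity : ∀ V hV i, (M.parity V i).map (iso V hV).toLinearMap = splitParity _ q i
  naturality : ∀ V hV W (h : W ≤ V) (f : M.Fn V), iso W (h.trans hV) (M.res h f) =
    Algebra.TensorProduct.map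
      (A.map (homOfLE (M.imageOpen_mono isOpenEmbedding h)).op).hom (AlgHom.id k _) (iso V hV f)

/-- The sheaf of `C^∞` functions on `𝕜^p`. For `𝕜 = ℂ` these are the functions which are smooth
over `ℂ`, i.e. the holomorphic functions. -/
noncomputable def smoothFunctions (𝕜 : Type u) [RCLike 𝕜] (p : ℕ) :
    TopCat.Presheaf (CommAlgCat.{u} 𝕜) (TopCat.of (EuclideanSpace 𝕜 (Fin p))) where
  obj V := CommAlgCat.of 𝕜
    C^∞⟮𝓘(𝕜, EuclideanSpace 𝕜 (Fin p)), (V.unop : Opens (EuclideanSpace 𝕜 (Fin p))); 𝓘(𝕜, 𝕜), 𝕜⟯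
  map i := CommAlgCat.ofHom
    { ContMDiffMap.restrictRingHom 𝓘(𝕜, EuclideanSpace 𝕜 (Fin p)) 𝓘(𝕜, 𝕜) 𝕜 i.unop.le with
      commutes' := fun _ => rfl }

open AlgebraicGeometry in
/-- The regular functions on open subsets of a scheme `Z` over `k`, as `k`-algebras. -/
noncomputable def regularFunctions {Z : Scheme.{u}} (f : Z ⟶ Spec (CommRingCat.of k)) :
    TopCat.Presheaf (CommAlgCat.{u} k) Z.toTopCat where
  obj V :=
    letI := ((Scheme.ΓSpecIso (CommRingCat.of k)).inv ≫ f.appLE ⊤ V.unop le_top).hom.toAlgebra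
    CommAlgCat.of k Γ(Z, V.unop)
  map {V W} i :=
    letI := ((Scheme.ΓSpecIso (CommRingCat.of k)).inv ≫ f.appLE ⊤ V.unop le_top).hom.toAlgebra
    letI := ((Scheme.ΓSpecIso (CommRingCat.of k)).inv ≫ f.appLE ⊤ W.unop le_top).hom.toAlgebra
    CommAlgCat.ofHom
      { (Z.presheaf.map i).hom with
        commutes' := fun r => by
          have h := f.appLE_map (U := ⊤) (V := V.unop) le_top i
          change (((Scheme.ΓSpecIso (CommRingCat.of k)).inv ≫ f.appLE ⊤ V.unop le_top) ≫
            Z.presheaf.map i).hom r = _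
          rw [Category.assoc, h]
          rfl }

/-- Supermanifolds of dimension `p|q`: the superspaces which are locally isomorphic to
`(Z, O_Z ⊗ Λ[θ_1, …, θ_q])`, where `(Z, O_Z)` is an open subset of `ℝ^p` with its smooth functions,
an open subset of `ℂ^p` with its holomorphic functions, or a smooth scheme of dimension `p` over a
field of characteristic zero. -/
inductive IsSupermanifold : ∀ {k : Type u} [Field k], Superspace k → ℕ → ℕ → Prop
  /-- Real smooth (`𝕜 = ℝ`) and complex analytic (`𝕜 = ℂ`) supermanifolds. -/
  | analytic {𝕜 : Type u} [RCLike 𝕜] (M : Superspace 𝕜) (p q : ℕ)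
      (h : ∀ x : M.space, ∃ U : Opens M.space, x ∈ U ∧
        Nonempty (M.SplitChart U _ (smoothFunctions 𝕜 p) q)) : IsSupermanifold M p q
  /-- Algebraic supermanifolds. -/
  | algebraic {k : Type u} [Field k] [CharZero k] (M : Superspace k) (p q : ℕ)
      (h : ∀ x : M.space, ∃ U : Opens M.space, x ∈ U ∧
        ∃ (Z : AlgebraicGeometry.Scheme.{u})
          (f : Z ⟶ AlgebraicGeometry.Spec (CommRingCat.of k)),
          AlgebraicGeometry.SmoothOfRelativeDimension p f ∧
            Nonempty (M.SplitChart U Z.toTopCat (regularFunctions f) q)) : IsSupermanifold M p q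

/-! ### The homology of the universal Spencer complex -/

/-- The complex of sheaves of `k`-modules `(D ⊗_O S^n(ΠT), δ)`. -/
noncomputable def spencerComplex (δ : ∀ n, M.spencerSheaf (n + 1) ⟶ M.spencerSheaf n)
    (h : ∀ n, δ (n + 1) ≫ δ n = 0) : ChainComplex (TopCat.Sheaf (ModuleCat.{u} k) M.space) ℕ :=
  ChainComplex.of M.spencerSheaf δ h

end Superspace

namespace Superspace

variable {k : Type u} [Field k] (M : Superspace k)

/-! ### Signs -/

/-! The statement is local, and in coordinates it is a Koszul computation. A supermanifold has local
coordinates x_a with dual vector fields ∂_a, and X = Σ X(x_a) ∂_a for every vector field X. The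
formula for δ is compatible with the tensor product over functions: when a function f crosses the
tensor sign, the derivative ∂_a(f) appears once from each of the two sums, and the two cancel
(`spencerForm_fnOp`).

Independence of the coordinates follows from a Cartan formula (`spencerForm_vfPow`): up to signs,
δ(F ⊗ πX τ) is FX ⊗ τ − F ⊗ L_X τ plus δ(F ⊗ τ) multiplied by πX. It reduces δ to one degree lower
without mentioning coordinates, so two coordinate systems give the same map. It rests on the
expansion of L_X in the coordinate fields (`lieDeriv_eq_sum`). The local maps then define a morphism
on the basis of coordinate neighbourhoods, hence a unique morphism of the associated sheaves.

For δ² = 0 and exactness, call τ flat if all L_{∂_a} τ vanish. Flat fields generate the polyvector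
fields over the functions, and function coefficients can be absorbed into F, so it suffices to treat
F ⊗ τ with τ flat. There δ is, up to sign, Σ F ∂_a ⊗ ⟨dx_a, τ⟩, and δ² = 0 because the ∂_a
supercommute and the contractions supercommute with shifted parities. The homotopy h(F ⊗ τ) = ± Σ
[F, x_a] ⊗ π∂_a τ satisfies δh + hδ = E + n on F ⊗ τ with τ flat of degree n, where E(F) = Σ [F,
x_a] ∂_a is an Euler operator (`delta_homotopy`). It has eigenvalue r on operators f ∂_{a_1} ⋯
∂_{a_r}, and locally every differential operator is a sum of these. In characteristic zero r + n
vanishes only for r = n = 0. So cycles of positive degree are locally boundaries, and in degree zero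
only the elements 1 ⊗ f remain modulo boundaries; the augmentation sends 1 ⊗ f to f.

Coordinates are built in a split chart A ⊗ Λ from partial derivatives of A and contractions of Λ.
That a derivation of A is determined by its values on coordinates follows from Hadamard's lemma for
smooth and holomorphic functions (`exists_hadamard`), and from étale maps to affine space for smooth
schemes (`exists_evenCoordinates`). -/

theorem parity_cases (a : ZMod 2) : a = 0 ∨ a = 1 := by
  revert a; decide

theorem koszulSign_zero : koszulSign 0 = 1 := rfl

theorem koszulSign_one : koszulSign 1 = -1 := rfl

theorem koszulSign_smul_smul {A : Type*} [AddCommGroup A] (i j : ZMod 2) (v : A) :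
    koszulSign i • koszulSign j • v = koszulSign (i + j) • v := by
  rw [smul_smul, koszulSign_mul]

theorem koszulSign_smul_self {A : Type*} [AddCommGroup A] (i : ZMod 2) (v : A) :
    koszulSign i • koszulSign i • v = v := by
  rw [koszulSign_smul_smul]
  rcases parity_cases i with rfl | rfl <;> exact one_smul ℤ v

/-! ### The parity involution of polyvector fields -/

/-- With zero off-diagonal entry the matrices of `superMat` are diagonal and their upper left entry
is multiplicative. The parity involution is thus read off from the presentation, without a direct
sum decomposition of `Poly` into homogeneous parts. -/
theorem superCompatible_zero {U : Opens M.space} (ε : ZMod 2) :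
    M.SuperCompatible ε (0 : M.PolyGen U → M.Poly U) := by
  apply superCompatible_of <;> intros <;> simp

/-- The parity involution `τ ↦ (-1) ^ |τ| τ` of the polyvector fields. -/
def polyInv (U : Opens M.space) : M.Poly U →ₗ[k] M.Poly U where
  toFun s := M.polyLift (M.superMat 1 0) (M.superCompatible_zero 1) s 0 0
  map_add' _ _ := by rw [map_add]; rfl
  map_smul' _ _ := by rw [map_smul]; rfl

theorem polyInv_gen {U : Opens M.space} (x : M.PolyGen U) :
    M.polyInv U (M.gen x) = koszulSign x.deg • M.gen x := by
  change M.polyLift (M.superMat 1 0) _ (M.gen x) 0 0 = _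
  rw [polyLift_gen]
  change koszulSign (1 * x.deg) • M.gen x = _
  rw [one_mul]

theorem polyInv_gen_mul {U : Opens M.space} (x : M.PolyGen U) (s : M.Poly U) :
    M.polyInv U (M.gen x * s) = koszulSign x.deg • (M.gen x * M.polyInv U s) := by
  obtain ⟨a, b, hs⟩ := M.superDer_aux (M.superCompatible_zero 1) s
  have ha : M.polyInv U s = a := by
    change M.polyLift (M.superMat 1 0) _ s 0 0 = a
    rw [hs]; rfl
  change M.polyLift (M.superMat 1 0) _ (M.gen x * s) 0 0 = _
  rw [map_mul, hs, polyLift_gen, superMat, tri_mul, ha]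
  change (koszulSign (1 * x.deg) • M.gen x) * a = _
  rw [smul_mul_assoc, one_mul]

theorem polyInv_of_mem {U : Opens M.space} {n : ℕ} {t : ZMod 2} {τ : M.Poly U}
    (hτ : τ ∈ M.polyDeg U n t) : M.polyInv U τ = koszulSign t • τ := by
  induction n generalizing t τ with
  | zero =>
    induction hτ using Submodule.span_induction with
    | mem y hy =>
      obtain ⟨f, hf, rfl⟩ := hy
      exact M.polyInv_gen _
    | zero => simp
    | add x y _ _ hx hy => rw [map_add, hx, hy, smul_add]
    | smul c x _ hx => rw [map_smul, hx, smul_comm]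
  | succ n ih =>
    induction hτ using Submodule.span_induction with
    | mem y hy =>
      obtain ⟨i, t', X, hX, τ, rfl, hτ, rfl⟩ := hy
      refine (M.polyInv_gen_mul _ _).trans ?_
      rw [ih hτ, mul_smul_comm, koszulSign_smul_smul]
      rfl
    | zero => simp
    | add x y _ _ hx hy => rw [map_add, hx, hy, smul_add]
    | smul c x _ hx => rw [map_smul, hx, smul_comm]

/-! ### Operators on homogeneous components -/

section Operators

variable {U : Opens M.space}

theorem polyPow_le_comap {n m : ℕ} (T : M.Poly U →ₗ[k] M.Poly U)
    (h : ∀ t, ∀ τ ∈ M.polyDeg U n t, T τ ∈ M.polyPow U m) (τ : M.Poly U)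
    (hτ : τ ∈ M.polyPow U n) : T τ ∈ M.polyPow U m := by
  have : M.polyPow U n ≤ (M.polyPow U m).comap T := sup_le (h 0) (h 1)
  exact this hτ

/-- The polyvector `n`-fields of parity `t`, as a submodule of all polyvector `n`-fields. -/
def homog (U : Opens M.space) (n : ℕ) (t : ZMod 2) : Submodule k (M.polyPow U n) :=
  (M.polyDeg U n t).comap (M.polyPow U n).subtype

/-- Contraction with `dg`, on polyvector fields of a given degree. -/
def contractPow {l : ZMod 2} {g : M.Fn U} (hg : g ∈ M.parity U l) (n : ℕ) :
    M.polyPow U (n + 1) →ₗ[k] M.polyPow U n :=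
  (M.contract hg).restrict
    (M.polyPow_le_comap _ fun _ _ hτ => M.polyDeg_le U _ _ (M.contract_mem hg hτ))

/-- The Lie derivative, on polyvector fields of a given degree. -/
def liePow {l : ZMod 2} {Y : M.LocalEnd U} (hY : Y ∈ M.vecField U l) (n : ℕ) :
    M.polyPow U n →ₗ[k] M.polyPow U n :=
  (M.lieDeriv hY).restrict
    (M.polyPow_le_comap _ fun _ _ hτ => M.polyDeg_le U _ _ (M.lieDeriv_mem hY hτ))

/-- The parity involution, on polyvector fields of a given degree. -/
def invPow (U : Opens M.space) (n : ℕ) : M.polyPow U n →ₗ[k] M.polyPow U n :=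
  (M.polyInv U).restrict
    (M.polyPow_le_comap _ fun t τ hτ => by
      rw [M.polyInv_of_mem hτ]; exact zsmul_mem (M.polyDeg_le U _ _ hτ) _)

/-- Left multiplication by `πX`, on polyvector fields of a given degree. -/
def vfPow {i : ZMod 2} {X : M.LocalEnd U} (hX : X ∈ M.vecField U i) (n : ℕ) :
    M.polyPow U n →ₗ[k] M.polyPow U (n + 1) :=
  (LinearMap.mulLeft k (M.pVf hX)).restrict
    (M.polyPow_le_comap _ fun _ _ hτ => M.polyDeg_le U _ _ (M.pVf_mul_mem hX hτ))

/-- Left multiplication by a function, on polyvector fields of a given degree. -/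
def fnPow {j : ZMod 2} {f : M.Fn U} (hf : f ∈ M.parity U j) (n : ℕ) :
    M.polyPow U n →ₗ[k] M.polyPow U n :=
  (LinearMap.mulLeft k (M.pFn hf)).restrict
    (M.polyPow_le_comap _ fun _ _ hτ => M.polyDeg_le U _ _ (M.pFn_mul_mem hf hτ))

theorem invPow_of_mem {n : ℕ} {t : ZMod 2} {τ : M.polyPow U n} (hτ : τ ∈ M.homog U n t) :
    M.invPow U n τ = koszulSign t • τ := Subtype.ext (M.polyInv_of_mem hτ)

theorem contractPow_mem {l t : ZMod 2} {g : M.Fn U} (hg : g ∈ M.parity U l) {n : ℕ}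
    {τ : M.polyPow U (n + 1)} (hτ : τ ∈ M.homog U (n + 1) t) :
    M.contractPow hg n τ ∈ M.homog U n (t + (l + 1)) := M.contract_mem hg hτ

theorem liePow_mem {l t : ZMod 2} {Y : M.LocalEnd U} (hY : Y ∈ M.vecField U l) {n : ℕ}
    {τ : M.polyPow U n} (hτ : τ ∈ M.homog U n t) :
    M.liePow hY n τ ∈ M.homog U n (t + l) := M.lieDeriv_mem hY hτ

theorem vfPow_mem {i t : ZMod 2} {X : M.LocalEnd U} (hX : X ∈ M.vecField U i) {n : ℕ}
    {τ : M.polyPow U n} (hτ : τ ∈ M.homog U n t) :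
    M.vfPow hX n τ ∈ M.homog U (n + 1) ((i + 1) + t) := M.pVf_mul_mem hX hτ

theorem fnPow_mem {j t : ZMod 2} {f : M.Fn U} (hf : f ∈ M.parity U j) {n : ℕ}
    {τ : M.polyPow U n} (hτ : τ ∈ M.homog U n t) :
    M.fnPow hf n τ ∈ M.homog U n (j + t) := M.pFn_mul_mem hf hτ

theorem contractPow_fnPow {l j : ZMod 2} {g f : M.Fn U} (hg : g ∈ M.parity U l)
    (hf : f ∈ M.parity U j) (n : ℕ) (τ : M.polyPow U (n + 1)) :
    M.contractPow hg n (M.fnPow hf (n + 1) τ) =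
      koszulSign ((l + 1) * j) • M.fnPow hf n (M.contractPow hg n τ) := by
  refine Subtype.ext ?_
  refine (M.superDer_gen_mul (M.contractGen_compatible hg) (.fn j f hf) τ.1).trans ?_
  simp only [contractGen, zero_mul, zero_add]
  rfl

theorem liePow_fnPow {l j : ZMod 2} {f : M.Fn U} {Y : M.LocalEnd U} (hY : Y ∈ M.vecField U l)
    (hf : f ∈ M.parity U j) (n : ℕ) (τ : M.polyPow U n) :
    M.liePow hY n (M.fnPow hf n τ) = M.fnPow (M.ev_mem hY hf) n τ +
      koszulSign (l * j) • M.fnPow hf n (M.liePow hY n τ) :=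
  Subtype.ext (M.lieDeriv_pFn_mul hY hf τ.1)

theorem contractPow_vfPow {l i : ZMod 2} {g : M.Fn U} {X : M.LocalEnd U}
    (hg : g ∈ M.parity U l) (hX : X ∈ M.vecField U i) (n : ℕ) (τ : M.polyPow U (n + 1)) :
    M.contractPow hg (n + 1) (M.vfPow hX (n + 1) τ) =
      koszulSign ((i + 1) * (l + 1)) • M.fnPow (M.ev_mem hX hg) (n + 1) τ +
      koszulSign ((i + 1) * (l + 1)) • M.vfPow hX n (M.contractPow hg n τ) := by
  refine Subtype.ext ((M.contract_pVf_mul hg hX τ.1).trans ?_)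
  rw [mul_comm (l + 1)]
  rfl

theorem contract_polyPow_zero {l : ZMod 2} {g : M.Fn U} (hg : g ∈ M.parity U l) {τ : M.Poly U}
    (hτ : τ ∈ M.polyPow U 0) : M.contract hg τ = 0 := by
  have : M.polyPow U 0 ≤ LinearMap.ker (M.contract hg) := by
    refine sup_le ?_ ?_ <;>
    · refine Submodule.span_le.2 ?_
      rintro _ ⟨f, hf, rfl⟩
      exact M.contract_pFn hg hf
  exact this hτ

/-- Separate from `contractPow_vfPow` because `contractPow` is not defined on functions; the second
Leibniz term, the contraction of a function, is zero. -/
theorem contractPow_vfPow_zero {l i : ZMod 2} {g : M.Fn U} {X : M.LocalEnd U}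
    (hg : g ∈ M.parity U l) (hX : X ∈ M.vecField U i) (τ : M.polyPow U 0) :
    M.contractPow hg 0 (M.vfPow hX 0 τ) =
      koszulSign ((i + 1) * (l + 1)) • M.fnPow (M.ev_mem hX hg) 0 τ := by
  refine Subtype.ext ((M.contract_pVf_mul hg hX τ.1).trans ?_)
  rw [M.contract_polyPow_zero hg τ.2, mul_zero, smul_zero, add_zero]
  rfl

theorem liePow_vfPow {l i : ZMod 2} {X Y : M.LocalEnd U} (hY : Y ∈ M.vecField U l)
    (hX : X ∈ M.vecField U i) (n : ℕ) (τ : M.polyPow U n) :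
    M.liePow hY (n + 1) (M.vfPow hX n τ) = M.vfPow (M.bracket_mem hY hX) n τ +
      koszulSign (l * (i + 1)) • M.vfPow hX n (M.liePow hY n τ) :=
  Subtype.ext (M.lieDeriv_pVf_mul hY hX τ.1)

theorem vfPow_fnPow {i j : ZMod 2} {f : M.Fn U} {X : M.LocalEnd U} (hX : X ∈ M.vecField U i)
    (hf : f ∈ M.parity U j) (n : ℕ) (τ : M.polyPow U n) :
    M.vfPow hX n (M.fnPow hf n τ) =
      koszulSign ((i + 1) * j) • M.fnPow hf (n + 1) (M.vfPow hX n τ) := by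
  refine Subtype.ext ?_
  change M.pVf hX * (M.pFn hf * τ.1) = koszulSign _ • (M.pFn hf * (M.pVf hX * τ.1))
  rw [← mul_assoc, M.pVf_mul_pFn hf hX, smul_mul_assoc, mul_assoc]

theorem fnPow_fnPow {i j : ZMod 2} {f g : M.Fn U} (hf : f ∈ M.parity U i)
    (hg : g ∈ M.parity U j) (n : ℕ) (τ : M.polyPow U n) :
    M.fnPow hf n (M.fnPow hg n τ) = M.fnPow (M.parity_mul hf hg) n τ := by
  refine Subtype.ext ?_
  change M.pFn hf * (M.pFn hg * τ.1) = M.pFn _ * τ.1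
  rw [← mul_assoc, pFn_mul]

theorem fnPow_congr {i j : ZMod 2} {f g : M.Fn U} (hf : f ∈ M.parity U i)
    (hg : g ∈ M.parity U j) (hij : i = j) (h : f = g) (n : ℕ) : M.fnPow hf n = M.fnPow hg n := by
  subst hij; subst h; rfl

theorem fnPow_one (n : ℕ) (τ : M.polyPow U n) : M.fnPow (M.parity_one U) n τ = τ := by
  refine Subtype.ext ?_
  change M.pFn _ * τ.1 = τ.1
  rw [pFn_one, one_mul]

theorem fnPow_eq_zero {i : ZMod 2} {f : M.Fn U} (hf : f ∈ M.parity U i) (h : f = 0) (n : ℕ) :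
    M.fnPow hf n = 0 := by
  refine LinearMap.ext fun τ => Subtype.ext ?_
  change M.pFn hf * τ.1 = 0
  rw [M.pFn_eq_zero hf h, zero_mul]

/-- The span defining `polyDeg` lives in `Poly`. It is transported to the submodule `polyPow` so
that span induction applies to maps such as `spencerForm`, which are defined on `polyPow` only. -/
theorem vfPow_mem_span {n : ℕ} {t : ZMod 2} :
    M.homog U (n + 1) t = Submodule.span k {y | ∃ (i t' : ZMod 2) (X : M.LocalEnd U)
      (hX : X ∈ M.vecField U i) (τ : M.polyPow U n),
      t = (i + 1) + t' ∧ τ ∈ M.homog U n t' ∧ y = M.vfPow hX n τ} := by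
  apply le_antisymm
  · intro y hy
    have key : ∀ z (hz : z ∈ M.polyDeg U (n + 1) t),
        (⟨z, M.polyDeg_le U _ _ hz⟩ : M.polyPow U (n + 1)) ∈
        Submodule.span k {y | ∃ (i t' : ZMod 2) (X : M.LocalEnd U)
          (hX : X ∈ M.vecField U i) (τ : M.polyPow U n),
          t = (i + 1) + t' ∧ τ ∈ M.homog U n t' ∧ y = M.vfPow hX n τ} := by
      intro z hz
      induction hz using Submodule.span_induction with
      | mem y hy =>
        obtain ⟨i, t', X, hX, τ, h, hτ, rfl⟩ := hy
        exact Submodule.subset_span ⟨i, t', X, hX, ⟨τ, M.polyDeg_le U _ _ hτ⟩, h, hτ, rfl⟩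
      | zero => exact zero_mem _
      | add x y hx' hy' hx hy => exact add_mem hx hy
      | smul c x _ hx => exact Submodule.smul_mem _ c hx
    exact key y.1 hy
  · refine Submodule.span_le.2 ?_
    rintro _ ⟨i, t', X, hX, τ, rfl, hτ, rfl⟩
    exact M.vfPow_mem hX hτ

theorem homog_zero_eq_span {t : ZMod 2} :
    M.homog U 0 t = Submodule.span k {y | ∃ (f : M.Fn U) (hf : f ∈ M.parity U t),
      y.1 = M.pFn hf} := by
  apply le_antisymm
  · intro y hy
    have key : ∀ z (hz : z ∈ M.polyDeg U 0 t),
        (⟨z, M.polyDeg_le U _ _ hz⟩ : M.polyPow U 0) ∈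
        Submodule.span k {y | ∃ (f : M.Fn U) (hf : f ∈ M.parity U t), y.1 = M.pFn hf} := by
      intro z hz
      induction hz using Submodule.span_induction with
      | mem y hy =>
        obtain ⟨f, hf, rfl⟩ := hy
        exact Submodule.subset_span ⟨f, hf, rfl⟩
      | zero => exact zero_mem _
      | add x y hx' hy' hx hy => exact add_mem hx hy
      | smul c x _ hx => exact Submodule.smul_mem _ c hx
    exact key y.1 hy
  · refine Submodule.span_le.2 ?_
    rintro _ ⟨f, hf, h⟩
    change _ ∈ M.polyDeg U 0 t
    exact Submodule.subset_span ⟨f, hf, h⟩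

/-- Directness of the sum is not needed: linear maps are compared on homogeneous elements, and signs
are produced by linear operators. -/
theorem homog_sup (n : ℕ) : M.homog U n 0 ⊔ M.homog U n 1 = ⊤ := by
  refine eq_top_iff.2 fun τ _ => ?_
  obtain ⟨a, ha, b, hb, h⟩ := Submodule.mem_sup.1 τ.2
  exact Submodule.mem_sup.2 ⟨⟨a, M.polyDeg_le U _ _ ha⟩, ha, ⟨b, M.polyDeg_le U _ _ hb⟩, hb,
    Subtype.ext h⟩

/-! ### The tensor products of differential operators and polyvector fields -/

/-- The bilinear map `(F, τ) ↦ F ⊗ τ`. -/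
def spencerTmul (U : Opens M.space) (n : ℕ) :
    M.diffOp U →ₗ[k] M.polyPow U n →ₗ[k] M.SpencerSections U n :=
  (TensorProduct.mk k _ _).compr₂ (M.balanceRel U n).mkQ

theorem spencerMk_eq {n : ℕ} (F : M.diffOp U) {τ : M.Poly U} (hτ : τ ∈ M.polyPow U n) :
    M.spencerMk F hτ = M.spencerTmul U n F ⟨τ, hτ⟩ := rfl

theorem spencerTmul_fnOp {n : ℕ} (F : M.diffOp U) {j : ZMod 2} {f : M.Fn U}
    (hf : f ∈ M.parity U j) (τ : M.polyPow U n) :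
    M.spencerTmul U n (F * M.fnOp f) τ = M.spencerTmul U n F (M.fnPow hf n τ) := by
  rw [← sub_eq_zero]
  change (M.balanceRel U n).mkQ (_ - _) = 0
  rw [Submodule.mkQ_apply, Submodule.Quotient.mk_eq_zero]
  exact Submodule.subset_span ⟨F, j, f, hf, τ, _, rfl, rfl⟩

/-- Two linear maps which agree on `F ⊗ τ`, for homogeneous `τ`, are equal. -/
theorem spencer_hom_ext_homog {n : ℕ} {A : Type*} [AddCommGroup A] [Module k A]
    {φ ψ : M.SpencerSections U n →ₗ[k] A}
    (h : ∀ F t, ∀ τ ∈ M.homog U n t, φ (M.spencerTmul U n F τ) = ψ (M.spencerTmul U n F τ)) :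
    φ = ψ := by
  refine Submodule.linearMap_qext _ (TensorProduct.ext' fun F τ => ?_)
  change φ (M.spencerTmul U n F τ) = ψ (M.spencerTmul U n F τ)
  obtain ⟨a, ha, b, hb, rfl⟩ := Submodule.mem_sup.1 ((M.homog_sup n).ge (Submodule.mem_top (x := τ)))
  simp only [map_add, h F _ a ha, h F _ b hb]

/-- Linear maps out of the tensor product over the functions. -/
def spencerLift {n : ℕ} {A : Type*} [AddCommGroup A] [Module k A]
    (φ : M.diffOp U →ₗ[k] M.polyPow U n →ₗ[k] A)
    (h : ∀ F j f (hf : f ∈ M.parity U j) t, ∀ τ ∈ M.homog U n t,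
      φ (F * M.fnOp f) τ = φ F (M.fnPow hf n τ)) : M.SpencerSections U n →ₗ[k] A :=
  (M.balanceRel U n).liftQ (TensorProduct.lift φ) (by
    refine Submodule.span_le.2 ?_
    rintro _ ⟨F, j, f, hf, τ, τ', hτ, rfl⟩
    change TensorProduct.lift _ (_ - _) = 0
    rw [map_sub, sub_eq_zero, TensorProduct.lift.tmul, TensorProduct.lift.tmul]
    obtain rfl : τ' = M.fnPow hf n τ := Subtype.ext hτ
    obtain ⟨a, ha, b, hb, rfl⟩ :=
      Submodule.mem_sup.1 ((M.homog_sup n).ge (Submodule.mem_top (x := τ)))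
    simp only [map_add, h F j f hf _ a ha, h F j f hf _ b hb])

theorem spencerLift_tmul {n : ℕ} {A : Type*} [AddCommGroup A] [Module k A]
    (φ : M.diffOp U →ₗ[k] M.polyPow U n →ₗ[k] A) (h) (F : M.diffOp U) (τ : M.polyPow U n) :
    M.spencerLift φ h (M.spencerTmul U n F τ) = φ F τ := rfl

theorem vecOp_mul_fnOp {i j : ZMod 2} {X : M.LocalEnd U} (hX : X ∈ M.vecField U i) {f : M.Fn U}
    (hf : f ∈ M.parity U j) : M.vecOp ⟨X, hX⟩ * M.fnOp f =
      M.fnOp (M.ev X f) + koszulSign (i * j) • (M.fnOp f * M.vecOp ⟨X, hX⟩) :=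
  Subtype.ext (M.vecField_mul_multOp hX hf)

end Operators

end Superspace

namespace Superspace

variable {k : Type u} [Field k] (M : Superspace k)

/-! ### Vector fields in coordinates -/

section Coordinates

variable {U : Opens M.space}

/-- The value of local endomorphisms on a given section. -/
def evAt (f : M.Fn U) : M.LocalEnd U →+ M.Fn U where
  toFun P := M.ev P f
  map_zero' := rfl
  map_add' _ _ := rfl

theorem ev_add (P Q : M.LocalEnd U) (f : M.Fn U) : M.ev (P + Q) f = M.ev P f + M.ev Q f := rfl

theorem ev_sub (P Q : M.LocalEnd U) (f : M.Fn U) : M.ev (P - Q) f = M.ev P f - M.ev Q f := rfl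

theorem ev_zsmul (n : ℤ) (P : M.LocalEnd U) (f : M.Fn U) : M.ev (n • P) f = n • M.ev P f :=
  map_zsmul (M.evAt f) n P

theorem ev_sum {ι : Type*} (s : Finset ι) (P : ι → M.LocalEnd U) (f : M.Fn U) :
    M.ev (∑ a ∈ s, P a) f = ∑ a ∈ s, M.ev (P a) f :=
  map_sum (M.evAt f) P s

theorem ev_bracket (i j : ZMod 2) (X Y : M.LocalEnd U) (f : M.Fn U) :
    M.ev (M.bracket i j X Y) f = M.ev X (M.ev Y f) - koszulSign (i * j) • M.ev Y (M.ev X f) := by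
  rw [bracket, ev_sub, ev_zsmul, ev_mul, ev_mul]

theorem pVf_sum {ι : Type*} [Fintype ι] {i : ZMod 2} {X : M.LocalEnd U} (hX : X ∈ M.vecField U i)
    {Y : ι → M.LocalEnd U} (hY : ∀ a, Y a ∈ M.vecField U i) (h : X = ∑ a, Y a) :
    M.pVf hX = ∑ a, M.pVf (hY a) := by
  let φ : M.vecField U i →+ M.Poly U :=
    { toFun Z := M.pVf Z.2
      map_zero' := by
        have := (M.pVf_smul 0 (zero_mem (M.vecField U i))).trans (zero_smul k _)
        exact (M.pVf_congr _ _ rfl (zero_smul k _).symm).trans this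
      map_add' Z W := M.pVf_add Z.2 W.2 }
  have := map_sum φ (fun a => (⟨Y a, hY a⟩ : M.vecField U i)) Finset.univ
  refine Eq.trans (M.pVf_congr _ _ rfl ?_) this
  rw [h]
  exact (map_sum (M.vecField U i).subtype (fun a => (⟨Y a, hY a⟩ : M.vecField U i)) _).symm

variable {M}
variable {p q : ℕ} (x : M.Coordinates U p q)

namespace Coordinates

theorem span_self {i : ZMod 2} {X : M.LocalEnd U} (hX : X ∈ M.vecField U i) :
    X = ∑ a, M.multOp U (M.ev X (x.x a)) * x.partialD a := by
  refine (x.span U le_rfl i X hX).trans (Finset.sum_congr rfl fun a _ => ?_)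
  rw [res_self]
  rfl

/-- Vector fields are determined by their values on the coordinates. -/
theorem vecField_ext {i : ZMod 2} {X Y : M.LocalEnd U} (hX : X ∈ M.vecField U i)
    (hY : Y ∈ M.vecField U i) (h : ∀ a, M.ev X (x.x a) = M.ev Y (x.x a)) : X = Y := by
  rw [x.span_self hX, x.span_self hY]
  simp only [h]

theorem ev_partial (a b : Fin p ⊕ Fin q) :
    M.ev (x.partialD a) (x.x b) = if a = b then 1 else 0 := by
  split_ifs with h
  · subst h; exact x.partial_self a
  · exact x.partial_ne a b h

/-- The functions ∂_a x_b are the constants 0 and 1, which vector fields kill. This removes one of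
the two terms when a bracket with ∂_a is evaluated on a coordinate. -/
theorem ev_ev_partial {i : ZMod 2} {X : M.LocalEnd U} (hX : X ∈ M.vecField U i)
    (a b : Fin p ⊕ Fin q) : M.ev X (M.ev (x.partialD a) (x.x b)) = 0 := by
  rw [ev_partial]
  split_ifs
  · exact M.ev_one hX
  · exact map_zero _

theorem ev_bracket_partial {i : ZMod 2} {X : M.LocalEnd U} (hX : X ∈ M.vecField U i)
    (a b : Fin p ⊕ Fin q) :
    M.ev (M.bracket (coordParity a) i (x.partialD a) X) (x.x b) =
      M.ev (x.partialD a) (M.ev X (x.x b)) := by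
  rw [ev_bracket, x.ev_ev_partial hX, smul_zero, sub_zero]

/-- The bracket is a vector field that kills every coordinate, and vector fields are determined by
their values on coordinates. -/
theorem bracket_partial_partial (a b : Fin p ⊕ Fin q) :
    M.bracket (coordParity a) (coordParity b) (x.partialD a) (x.partialD b) = 0 := by
  refine x.vecField_ext (M.bracket_mem (x.partial_mem a) (x.partial_mem b)) (zero_mem _) ?_
  intro c
  rw [x.ev_bracket_partial (x.partial_mem b), x.ev_ev_partial (x.partial_mem a)]
  rfl

theorem parity_add_self (i a : ZMod 2) : i + a + a = i := by
  revert i a; decide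

theorem coeff_mul_partial_mem {i : ZMod 2} {X : M.LocalEnd U} (hX : X ∈ M.vecField U i)
    (a : Fin p ⊕ Fin q) : M.multOp U (M.ev X (x.x a)) * x.partialD a ∈ M.vecField U i := by
  have := M.multOp_mul_mem (M.ev_mem hX (x.x_mem a)) (x.partial_mem a)
  rwa [parity_add_self] at this

theorem pVf_eq_sum {i : ZMod 2} {X : M.LocalEnd U} (hX : X ∈ M.vecField U i) :
    M.pVf hX = ∑ a, M.pFn (M.ev_mem hX (x.x_mem a)) * M.pVf (x.partial_mem a) := by
  rw [M.pVf_sum hX (x.coeff_mul_partial_mem hX) (x.span_self hX)]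
  refine Finset.sum_congr rfl fun a _ => ?_
  rw [← pFn_mul_pVf]
  exact M.pVf_congr _ _ (parity_add_self _ _).symm rfl

/-- The underlying vector fields agree on each coordinate x_c: there [∂_a, Y] x_c = ∂_a(Y x_c), and
X = Σ X(x_a) ∂_a turns the sum into X(Y x_c) ∓ Y(X x_c). The form is chosen to match the terms of
`lieDeriv_eq_sum`. -/
theorem pVf_bracket {i j : ZMod 2} {X Y : M.LocalEnd U} (hX : X ∈ M.vecField U i)
    (hY : Y ∈ M.vecField U j) : M.pVf (M.bracket_mem hX hY) =
      ∑ a, (M.pFn (M.ev_mem hX (x.x_mem a)) * M.pVf (M.bracket_mem (x.partial_mem a) hY) -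
        koszulSign (i * j) • (M.pFn (M.ev_mem hY (x.x_mem a)) *
          M.pVf (M.bracket_mem (x.partial_mem a) hX))) := by
  have e1 (i j a : ZMod 2) : i + a + (a + j) = i + j := by revert i j a; decide
  have e2 (i j a : ZMod 2) : j + a + (a + i) = i + j := by revert i j a; decide
  have m1 (a : Fin p ⊕ Fin q) : M.multOp U (M.ev X (x.x a)) *
      M.bracket (coordParity a) j (x.partialD a) Y ∈ M.vecField U (i + j) := by
    have := M.multOp_mul_mem (M.ev_mem hX (x.x_mem a)) (M.bracket_mem (x.partial_mem a) hY)
    rwa [e1] at this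
  have m2 (a : Fin p ⊕ Fin q) : M.multOp U (M.ev Y (x.x a)) *
      M.bracket (coordParity a) i (x.partialD a) X ∈ M.vecField U (i + j) := by
    have := M.multOp_mul_mem (M.ev_mem hY (x.x_mem a)) (M.bracket_mem (x.partial_mem a) hX)
    rwa [e2] at this
  have m3 (a : Fin p ⊕ Fin q) := add_mem (m1 a) (zsmul_mem (m2 a) (-koszulSign (i * j)))
  rw [M.pVf_sum (M.bracket_mem hX hY) m3]
  · refine Finset.sum_congr rfl fun a _ => ?_
    rw [M.pVf_add (m1 a) (zsmul_mem (m2 a) _), M.pVf_zsmul _ (m2 a), ← pFn_mul_pVf, ← pFn_mul_pVf, neg_smul, ← sub_eq_add_neg]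
    congr 1
    · exact M.pVf_congr _ _ (e1 _ _ _).symm rfl
    · congr 1
      exact M.pVf_congr _ _ (e2 _ _ _).symm rfl
  · refine x.vecField_ext (M.bracket_mem hX hY) (sum_mem fun a _ => m3 a) fun c => ?_
    have key {i : ZMod 2} {X : M.LocalEnd U} (hX : X ∈ M.vecField U i) (f : M.Fn U) :
        ∑ a, M.ev X (x.x a) * M.ev (x.partialD a) f = M.ev X f := by
      conv_rhs => rw [x.span_self hX, ev_sum]
      refine Finset.sum_congr rfl fun a _ => ?_
      rw [ev_mul, ev_multOp]
    rw [ev_bracket, ev_sum, ← key hX (M.ev Y _), ← key hY (M.ev X _), Finset.smul_sum, ← Finset.sum_sub_distrib]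
    refine Finset.sum_congr rfl fun a _ => ?_
    rw [ev_add, ev_zsmul, ev_mul, ev_mul, ev_multOp, ev_multOp, x.ev_bracket_partial hX,
      x.ev_bracket_partial hY, neg_smul, ← sub_eq_add_neg]

/-- The Lie derivative along a vector field in terms of those along the coordinate fields. -/
theorem lieDeriv_eq_sum {i : ZMod 2} {X : M.LocalEnd U} (hX : X ∈ M.vecField U i) {n : ℕ}
    {t : ZMod 2} {τ : M.Poly U} (hτ : τ ∈ M.polyDeg U n t) :
    M.lieDeriv hX τ = ∑ a, (M.pFn (M.ev_mem hX (x.x_mem a)) * M.lieDeriv (x.partial_mem a) τ +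
      koszulSign ((i + 1) * coordParity a) • (M.pVf (M.bracket_mem (x.partial_mem a) hX) *
        M.contract (x.x_mem a) τ)) := by
  induction n generalizing t τ with
  | zero =>
    induction hτ using Submodule.span_induction with
    | mem y hy =>
      obtain ⟨f, hf, rfl⟩ := hy
      simp only [contract_pFn, mul_zero, smul_zero, add_zero, lieDeriv_pFn]
      have e (i t a : ZMod 2) : i + a + (a + t) = i + t := by revert i t a; decide
      have m (a : Fin p ⊕ Fin q) : M.ev X (x.x a) * M.ev (x.partialD a) f ∈ M.parity U (i + t) := by
        have := M.parity_mul (M.ev_mem hX (x.x_mem a)) (M.ev_mem (x.partial_mem a) hf)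
        rwa [e] at this
      let φ : M.parity U (i + t) →+ M.Poly U :=
        { toFun Z := M.pFn Z.2
          map_zero' := M.pFn_eq_zero _ rfl
          map_add' Z W := M.pFn_add Z.2 W.2 }
      have := map_sum φ (fun a => (⟨_, m a⟩ : M.parity U (i + t))) Finset.univ
      refine Eq.trans (M.pFn_congr _ (Subtype.prop _) rfl ?_) (this.trans ?_)
      · have := map_sum (M.parity U (i + t)).subtype
          (fun a => (⟨_, m a⟩ : M.parity U (i + t))) Finset.univ
        refine Eq.trans ?_ this.symm
        conv_lhs => rw [x.span_self hX, ev_sum]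
        refine Finset.sum_congr rfl fun a _ => ?_
        rw [ev_mul, ev_multOp]; rfl
      · refine Finset.sum_congr rfl fun a _ => ?_
        rw [← pFn_mul]
        exact M.pFn_congr _ _ (e _ _ _).symm rfl
    | zero => simp
    | add x y _ _ hx hy =>
      simp only [map_add, hx, hy, mul_add, smul_add, ← Finset.sum_add_distrib]
      exact Finset.sum_congr rfl fun a _ => by abel
    | smul c x _ hx =>
      simp only [map_smul, hx, mul_smul_comm, Finset.smul_sum, smul_add, smul_comm c]
  | succ n ih =>
    induction hτ using Submodule.span_induction with
    | mem y hy =>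
      obtain ⟨j, t', Y, hY, τ, rfl, hτ, rfl⟩ := hy
      -- The two sides match index by index: X(x_a) π[∂_a, Y] is the bracket part of L_{∂_a}(πY τ),
      -- and Y(x_a) π[∂_a, X] comes from contracting dx_a with πY.
      rw [lieDeriv_pVf_mul, x.pVf_bracket hX hY, ih hτ, Finset.sum_mul, Finset.mul_sum,
        Finset.smul_sum, ← Finset.sum_add_distrib]
      refine Finset.sum_congr rfl fun a _ => ?_
      rw [lieDeriv_pVf_mul, contract_pVf_mul]
      have c1 := M.pVf_mul_pFn (M.ev_mem hX (x.x_mem a)) hY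
      have c2 := M.pVf_mul_pFn (M.ev_mem hY (x.x_mem a)) (M.bracket_mem (x.partial_mem a) hX)
      have c3 := M.pVf_mul_pVf (M.bracket_mem (x.partial_mem a) hX) hY
      revert c1 c2 c3
      generalize M.contract (x.x_mem a) τ = C, M.lieDeriv (x.partial_mem a) τ = L
      generalize M.pVf (M.bracket_mem (x.partial_mem a) hX) = BX,
        M.pVf (M.bracket_mem (x.partial_mem a) hY) = BY, M.pVf hY = W,
        M.pFn (M.ev_mem hX (x.x_mem a)) = fX, M.pFn (M.ev_mem hY (x.x_mem a)) = fY
      generalize coordParity a = l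
      intro c1 c2 c3
      -- Once the factors stand in a common order, only signs depending on three parities remain,
      -- and the eight cases are checked one by one.
      simp only [mul_add, sub_mul, smul_add, mul_smul_comm, smul_mul_assoc, ← mul_assoc, c1, c2, c3]
      have h2 : (1 : ZMod 2) + 1 = 0 := rfl
      rcases parity_cases i with rfl | rfl <;> rcases parity_cases j with rfl | rfl <;>
        rcases parity_cases l with rfl | rfl <;>
        simp only [mul_zero, mul_one, add_zero, zero_add, h2, koszulSign_zero,
          koszulSign_one, one_smul, neg_smul, neg_neg, smul_neg] <;> abel
    | zero => simp
    | add x y _ _ hx hy =>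
      simp only [map_add, hx, hy, mul_add, smul_add, ← Finset.sum_add_distrib]
      exact Finset.sum_congr rfl fun a _ => by abel
    | smul c x _ hx =>
      simp only [map_smul, hx, mul_smul_comm, Finset.smul_sum, smul_add, smul_comm c]

end Coordinates

end Coordinates

end Superspace

namespace Superspace

variable {k : Type u} [Field k] (M : Superspace k)

/-! ### The Spencer differential in coordinates -/

section Differential

variable {U : Opens M.space}

/-- The operator `τ ↦ (-1) ^ (i |τ|) τ`. -/
def signPow (U : Opens M.space) (n : ℕ) (i : ZMod 2) : M.polyPow U n →ₗ[k] M.polyPow U n :=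
  if i = 0 then LinearMap.id else M.invPow U n

theorem signPow_of_mem {n : ℕ} {i t : ZMod 2} {τ : M.polyPow U n} (hτ : τ ∈ M.homog U n t) :
    M.signPow U n i τ = koszulSign (i * t) • τ := by
  rcases parity_cases i with rfl | rfl
  · rw [zero_mul]; exact (one_smul ℤ τ).symm
  · rw [one_mul]; exact M.invPow_of_mem hτ

/-- The map `F ⊗ τ ↦ (-1) ^ ((|X| + 1) |τ|) F ⊗ πX τ`, i.e. right multiplication by `πX`. -/
def vfMul {i : ZMod 2} {X : M.LocalEnd U} (hX : X ∈ M.vecField U i) (n : ℕ) :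
    M.SpencerSections U n →ₗ[k] M.SpencerSections U (n + 1) :=
  M.spencerLift ((M.spencerTmul U (n + 1)).compl₂ (M.vfPow hX n ∘ₗ M.signPow U n (i + 1))) (by
    intro F j f hf t τ hτ
    simp only [LinearMap.compl₂_apply, LinearMap.comp_apply]
    -- The sign of a right multiplication compensates for moving f past πX. Without it F ⊗ τ ↦ F ⊗
    -- πX τ would not respect the balancing relation in general.
    rw [M.signPow_of_mem hτ, M.signPow_of_mem (M.fnPow_mem hf hτ), map_zsmul, map_zsmul, map_zsmul,
      map_zsmul, vfPow_fnPow, map_zsmul, M.spencerTmul_fnOp F hf, koszulSign_smul_smul]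
    have e (i j t : ZMod 2) : (i + 1) * t = (i + 1) * (j + t) + (i + 1) * j := by
      revert i j t; decide
    rw [e i j t])

theorem vfMul_tmul {i t : ZMod 2} {X : M.LocalEnd U} (hX : X ∈ M.vecField U i) {n : ℕ}
    (F : M.diffOp U) {τ : M.polyPow U n} (hτ : τ ∈ M.homog U n t) :
    M.vfMul hX n (M.spencerTmul U n F τ) =
      koszulSign ((i + 1) * t) • M.spencerTmul U (n + 1) F (M.vfPow hX n τ) := by
  rw [vfMul, spencerLift_tmul, LinearMap.compl₂_apply, LinearMap.comp_apply, M.signPow_of_mem hτ,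
    map_zsmul, map_zsmul]

variable {M}
variable {p q : ℕ} (x : M.Coordinates U p q)

namespace Coordinates

theorem mulPartial_mul_fnOp (F : M.diffOp U) (a : Fin p ⊕ Fin q) {j : ZMod 2} {f : M.Fn U}
    (hf : f ∈ M.parity U j) : x.mulPartial F a * M.fnOp f = F * M.fnOp (M.ev (x.partialD a) f) +
      koszulSign (coordParity a * j) • x.mulPartial (F * M.fnOp f) a := by
  rw [mulPartial, mul_assoc, M.vecOp_mul_fnOp _ hf, mul_add, mul_smul_comm, ← mul_assoc]
  rfl

/-- Right multiplication of differential operators by `∂_a`, as a linear map. -/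
def mulPartialHom (a : Fin p ⊕ Fin q) : M.diffOp U →ₗ[k] M.diffOp U :=
  LinearMap.mulRight k (M.vecOp ⟨x.partialD a, x.partial_mem a⟩)

theorem mulPartialHom_apply (F : M.diffOp U) (a : Fin p ⊕ Fin q) :
    x.mulPartialHom a F = x.mulPartial F a := rfl

/-- The map `(F, τ) ↦ ∑ F ∂_a ⊗ ⟨dx_a, τ⟩ - F ⊗ ∑ ⟨dx_a, L_{∂_a} τ⟩`. -/
def spencerForm (n : ℕ) :
    M.diffOp U →ₗ[k] M.polyPow U (n + 1) →ₗ[k] M.SpencerSections U n :=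
  ∑ a, ((M.spencerTmul U n).compl₁₂ (x.mulPartialHom a) (M.contractPow (x.x_mem a) n) -
    (M.spencerTmul U n).compl₂
      (M.contractPow (x.x_mem a) n ∘ₗ M.liePow (x.partial_mem a) (n + 1)))

theorem spencerForm_apply (n : ℕ) (F : M.diffOp U) (τ : M.polyPow U (n + 1)) :
    x.spencerForm n F τ =
      ∑ a, (M.spencerTmul U n (x.mulPartial F a) (M.contractPow (x.x_mem a) n τ) -
        M.spencerTmul U n F (M.contractPow (x.x_mem a) n (M.liePow (x.partial_mem a) (n + 1) τ))) := by
  rw [spencerForm, LinearMap.sum_apply, LinearMap.sum_apply]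
  rfl

/-- For F and f τ the derivative ∂_a(f) occurs twice: when f is moved to the left past ∂_a in F ∂_a
f, and in the Lie derivative of f τ. The two occurrences cancel, which is the purpose of the second
sum. The remaining sign (-1)^|f| is absorbed by the factor (-1)^|τ| in δ. -/
theorem spencerForm_fnOp {n : ℕ} (F : M.diffOp U) {j : ZMod 2} {f : M.Fn U}
    (hf : f ∈ M.parity U j) (τ : M.polyPow U (n + 1)) :
    x.spencerForm n (F * M.fnOp f) τ =
      koszulSign j • x.spencerForm n F (M.fnPow hf (n + 1) τ) := by
  rw [spencerForm_apply, spencerForm_apply, Finset.smul_sum]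
  refine Finset.sum_congr rfl fun a _ => ?_
  rw [liePow_fnPow, map_add, map_zsmul, contractPow_fnPow, contractPow_fnPow, contractPow_fnPow,
    map_zsmul, ← spencerTmul_fnOp, mulPartial_mul_fnOp _ _ _ hf]
  simp only [M.spencerTmul_fnOp F (M.ev_mem (x.partial_mem a) hf),
    M.spencerTmul_fnOp F hf, map_add, map_zsmul, LinearMap.add_apply, LinearMap.smul_apply,
    smul_sub, smul_add, koszulSign_smul_smul]
  have e1 (j a : ZMod 2) : j + (a + 1) * (a + j) = j + (a + 1) * j := by revert j a; decide
  have e2 (j a : ZMod 2) : j + ((a + 1) * j + a * j) = 0 := by revert j a; decide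
  have e3 (j a : ZMod 2) : j + (a * j + (a + 1) * j) = 0 := by revert j a; decide
  rw [e1, e2, e3, koszulSign_zero, one_smul, one_smul]
  abel

/-- The Spencer differential in local coordinates. -/
def delta (n : ℕ) : M.SpencerSections U (n + 1) →ₗ[k] M.SpencerSections U n :=
  M.spencerLift ((x.spencerForm n).compl₂ (M.invPow U (n + 1))) (by
    intro F j f hf t τ hτ
    simp only [LinearMap.compl₂_apply]
    rw [M.invPow_of_mem hτ, M.invPow_of_mem (M.fnPow_mem hf hτ), map_zsmul, map_zsmul,
      x.spencerForm_fnOp F hf, koszulSign_smul_smul, add_comm])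

theorem delta_tmul {n : ℕ} (F : M.diffOp U) {t : ZMod 2} {τ : M.polyPow U (n + 1)}
    (hτ : τ ∈ M.homog U (n + 1) t) :
    x.delta n (M.spencerTmul U (n + 1) F τ) = koszulSign t • x.spencerForm n F τ := by
  rw [delta, spencerLift_tmul, LinearMap.compl₂_apply, M.invPow_of_mem hτ, map_zsmul]

theorem liePow_eq_sum {i t : ZMod 2} {X : M.LocalEnd U} (hX : X ∈ M.vecField U i) {n : ℕ}
    {τ : M.polyPow U (n + 1)} (hτ : τ ∈ M.homog U (n + 1) t) :
    M.liePow hX (n + 1) τ = ∑ a, (M.fnPow (M.ev_mem hX (x.x_mem a)) (n + 1)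
        (M.liePow (x.partial_mem a) (n + 1) τ) +
      koszulSign ((i + 1) * coordParity a) • M.vfPow (M.bracket_mem (x.partial_mem a) hX) n
        (M.contractPow (x.x_mem a) n τ)) := by
  refine Subtype.ext ((x.lieDeriv_eq_sum hX (Submodule.mem_comap.1 hτ)).trans ?_)
  rw [Submodule.coe_sum]
  rfl

theorem liePow_zero_eq_sum {i t : ZMod 2} {X : M.LocalEnd U} (hX : X ∈ M.vecField U i)
    {τ : M.polyPow U 0} (hτ : τ ∈ M.homog U 0 t) :
    M.liePow hX 0 τ = ∑ a, M.fnPow (M.ev_mem hX (x.x_mem a)) 0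
        (M.liePow (x.partial_mem a) 0 τ) := by
  refine Subtype.ext ((x.lieDeriv_eq_sum hX (Submodule.mem_comap.1 hτ)).trans ?_)
  rw [Submodule.coe_sum]
  refine Finset.sum_congr rfl fun a _ => ?_
  rw [Submodule.subtype_apply, M.contract_polyPow_zero _ τ.2, mul_zero, smul_zero, add_zero]
  rfl

theorem vecOp_eq_sum {i : ZMod 2} {X : M.LocalEnd U} (hX : X ∈ M.vecField U i) :
    M.vecOp ⟨X, hX⟩ =
      ∑ a, M.fnOp (M.ev X (x.x a)) * M.vecOp ⟨x.partialD a, x.partial_mem a⟩ := by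
  refine Subtype.ext ((x.span_self hX).trans ?_)
  rw [AddSubmonoidClass.coe_finsetSum]
  rfl

theorem mul_vecOp_eq_sum (F : M.diffOp U) {i : ZMod 2} {X : M.LocalEnd U}
    (hX : X ∈ M.vecField U i) :
    F * M.vecOp ⟨X, hX⟩ = ∑ a, x.mulPartial (F * M.fnOp (M.ev X (x.x a))) a := by
  rw [x.vecOp_eq_sum hX, Finset.mul_sum]
  exact Finset.sum_congr rfl fun a _ => (mul_assoc _ _ _).symm

theorem fnPow_bracket {i : ZMod 2} {X : M.LocalEnd U} (hX : X ∈ M.vecField U i) (n : ℕ)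
    (a : Fin p ⊕ Fin q) :
    M.fnPow (M.ev_mem (M.bracket_mem (x.partial_mem a) hX) (x.x_mem a)) n =
      M.fnPow (M.ev_mem (x.partial_mem a) (M.ev_mem hX (x.x_mem a))) n :=
  M.fnPow_congr _ _ (add_assoc _ _ _) (x.ev_bracket_partial hX a a) n

/-- The Cartan formula for the Spencer differential. -/
theorem spencerForm_vfPow (F : M.diffOp U) {i t : ZMod 2} {X : M.LocalEnd U}
    (hX : X ∈ M.vecField U i) {n : ℕ} {τ : M.polyPow U (n + 1)} (hτ : τ ∈ M.homog U (n + 1) t) :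
    x.spencerForm (n + 1) F (M.vfPow hX (n + 1) τ) =
      koszulSign (i + 1) • (M.spencerTmul U (n + 1) (F * M.vecOp ⟨X, hX⟩) τ -
        M.spencerTmul U (n + 1) F (M.liePow hX (n + 1) τ)) +
      koszulSign ((i + 1) * t) • M.vfMul hX n (x.spencerForm n F τ) := by
  rw [x.liePow_eq_sum hX hτ, x.mul_vecOp_eq_sum F hX, spencerForm_apply, spencerForm_apply,
    map_sum, map_sum, map_sum, LinearMap.sum_apply, ← Finset.sum_sub_distrib, Finset.smul_sum,
    Finset.smul_sum, ← Finset.sum_add_distrib]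
  refine Finset.sum_congr rfl fun a _ => ?_
  have hc := M.contractPow_mem (x.x_mem a) hτ
  have hl := M.contractPow_mem (x.x_mem a) (M.liePow_mem (x.partial_mem a) hτ)
  rw [map_sub, M.vfMul_tmul hX _ hc, M.vfMul_tmul hX _ hl, liePow_vfPow, map_add, map_zsmul,
    contractPow_vfPow, contractPow_vfPow, contractPow_vfPow, x.fnPow_bracket hX]
  -- Contracting dx_a with πX gives F ∂_a ⊗ X(x_a) τ. Moving X(x_a) to the left of ∂_a leaves the
  -- wanted part of FX ⊗ τ and a term with ∂_a(X(x_a)), which cancels against the contraction of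
  -- dx_a with π[∂_a, X].
  have hm := x.mulPartial_mul_fnOp F a (M.ev_mem hX (x.x_mem a))
  have h1 := congrArg (fun G => M.spencerTmul U (n + 1) G τ) hm
  simp only [map_add, map_zsmul, LinearMap.add_apply, LinearMap.smul_apply] at h1
  rw [M.spencerTmul_fnOp _ (M.ev_mem hX (x.x_mem a)),
    M.spencerTmul_fnOp _ (M.ev_mem (x.partial_mem a) (M.ev_mem hX (x.x_mem a)))] at h1
  simp only [map_add, map_zsmul, h1]
  generalize M.spencerTmul U (n + 1) F (M.fnPow (M.ev_mem (x.partial_mem a)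
      (M.ev_mem hX (x.x_mem a))) (n + 1) τ) = A,
    M.spencerTmul U (n + 1) (x.mulPartial (F * M.fnOp (M.ev X (x.x a))) a) τ = B,
    M.spencerTmul U (n + 1) F (M.fnPow (M.ev_mem hX (x.x_mem a)) (n + 1)
      (M.liePow (x.partial_mem a) (n + 1) τ)) = C,
    M.spencerTmul U (n + 1) F (M.vfPow (M.bracket_mem (x.partial_mem a) hX) n
      (M.contractPow (x.x_mem a) n τ)) = E,
    M.spencerTmul U (n + 1) F (M.vfPow hX n (M.contractPow (x.x_mem a) n
      (M.liePow (x.partial_mem a) (n + 1) τ))) = G,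
    M.spencerTmul U (n + 1) (x.mulPartial F a) (M.vfPow hX n (M.contractPow (x.x_mem a) n τ)) = H
  generalize coordParity a = l
  have h2 : (1 : ZMod 2) + 1 = 0 := rfl
  rcases parity_cases i with rfl | rfl <;> rcases parity_cases t with rfl | rfl <;>
    rcases parity_cases l with rfl | rfl <;>
    simp only [mul_zero, mul_one, add_zero, zero_add, h2, koszulSign_zero,
      koszulSign_one, one_smul, neg_smul] <;> abel

/-- Start of the recursion: contractions of functions vanish, so there is no term multiplied by πX.
-/
theorem spencerForm_vfPow_zero (F : M.diffOp U) {i t : ZMod 2} {X : M.LocalEnd U}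
    (hX : X ∈ M.vecField U i) {τ : M.polyPow U 0} (hτ : τ ∈ M.homog U 0 t) :
    x.spencerForm 0 F (M.vfPow hX 0 τ) =
      koszulSign (i + 1) • (M.spencerTmul U 0 (F * M.vecOp ⟨X, hX⟩) τ -
        M.spencerTmul U 0 F (M.liePow hX 0 τ)) := by
  rw [x.liePow_zero_eq_sum hX hτ, x.mul_vecOp_eq_sum F hX, spencerForm_apply,
    map_sum, map_sum, LinearMap.sum_apply, ← Finset.sum_sub_distrib, Finset.smul_sum]
  refine Finset.sum_congr rfl fun a _ => ?_
  rw [liePow_vfPow, map_add, map_zsmul,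
    contractPow_vfPow_zero, contractPow_vfPow_zero, contractPow_vfPow_zero, x.fnPow_bracket hX]
  have hm := x.mulPartial_mul_fnOp F a (M.ev_mem hX (x.x_mem a))
  have h1 := congrArg (fun G => M.spencerTmul U 0 G τ) hm
  simp only [map_add, map_zsmul, LinearMap.add_apply, LinearMap.smul_apply] at h1
  rw [M.spencerTmul_fnOp _ (M.ev_mem hX (x.x_mem a)),
    M.spencerTmul_fnOp _ (M.ev_mem (x.partial_mem a) (M.ev_mem hX (x.x_mem a)))] at h1
  simp only [map_add, map_zsmul, h1]
  generalize M.spencerTmul U 0 F (M.fnPow (M.ev_mem (x.partial_mem a)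
      (M.ev_mem hX (x.x_mem a))) 0 τ) = A,
    M.spencerTmul U 0 (x.mulPartial (F * M.fnOp (M.ev X (x.x a))) a) τ = B,
    M.spencerTmul U 0 F (M.fnPow (M.ev_mem hX (x.x_mem a)) 0
      (M.liePow (x.partial_mem a) 0 τ)) = C
  generalize coordParity a = l
  have h2 : (1 : ZMod 2) + 1 = 0 := rfl
  rcases parity_cases i with rfl | rfl <;> rcases parity_cases l with rfl | rfl <;>
    simp only [mul_zero, mul_one, add_zero, zero_add, h2, koszulSign_zero,
      koszulSign_one, one_smul, neg_smul, smul_neg] <;> abel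

/-- In the Cartan formula coordinates occur only through `spencerForm` one degree lower, so
induction on the degree removes them. Even the dimensions of the two systems need not be compared.
-/
theorem spencerForm_unique {p' q' : ℕ} (y : M.Coordinates U p' q') (F : M.diffOp U) {n : ℕ}
    {t : ZMod 2} {τ : M.polyPow U (n + 1)} (hτ : τ ∈ M.homog U (n + 1) t) :
    x.spencerForm n F τ = y.spencerForm n F τ := by
  induction n generalizing t with
  | zero =>
    rw [M.vfPow_mem_span] at hτ
    induction hτ using Submodule.span_induction with
    | mem z hz =>
      obtain ⟨i, t', X, hX, τ, rfl, hτ, rfl⟩ := hz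
      rw [x.spencerForm_vfPow_zero F hX hτ, y.spencerForm_vfPow_zero F hX hτ]
    | zero => simp
    | add x y _ _ hx hy => rw [map_add, hx, hy, map_add]
    | smul c x _ hx => rw [map_smul, hx, map_smul]
  | succ n ih =>
    rw [M.vfPow_mem_span] at hτ
    induction hτ using Submodule.span_induction with
    | mem z hz =>
      obtain ⟨i, t', X, hX, τ, rfl, hτ, rfl⟩ := hz
      rw [x.spencerForm_vfPow F hX hτ, y.spencerForm_vfPow F hX hτ, ih hτ]
    | zero => simp
    | add x y _ _ hx hy => rw [map_add, hx, hy, map_add]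
    | smul c x _ hx => rw [map_smul, hx, map_smul]

/-- The Spencer differential does not depend on the coordinates. -/
theorem delta_unique {p' q' : ℕ} (y : M.Coordinates U p' q') (n : ℕ) : x.delta n = y.delta n :=
  M.spencer_hom_ext_homog fun F _ τ hτ => by
    rw [x.delta_tmul F hτ, y.delta_tmul F hτ, x.spencerForm_unique y F hτ]

end Coordinates

end Differential

end Superspace

namespace Superspace

variable {k : Type u} [Field k] (M : Superspace k)

/-! ### Flat polyvector fields -/

theorem eq_zero_of_eq_neg (k : Type*) [Field k] [CharZero k] {V : Type*} [AddCommGroup V]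
    [Module k V] {v : V} (hv : v = -v) : v = 0 := by
  have : (2 : k) • v = 0 := by rw [two_smul]; nth_rw 1 [hv]; exact neg_add_cancel v
  exact (smul_eq_zero.1 this).resolve_left two_ne_zero

section Flat

variable {U : Opens M.space}

theorem contract_pFn_mul {l j : ZMod 2} {g f : M.Fn U} (hg : g ∈ M.parity U l)
    (hf : f ∈ M.parity U j) (τ : M.Poly U) : M.contract hg (M.pFn hf * τ) =
      koszulSign ((l + 1) * j) • (M.pFn hf * M.contract hg τ) := by
  refine (M.superDer_gen_mul (M.contractGen_compatible hg) (.fn j f hf) τ).trans ?_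
  simp only [contractGen, zero_mul, zero_add]
  rfl

/-- Contractions are superderivations that kill functions. On πX τ, the terms containing X(g) or
X(h) occur on both sides, and the remaining term is the induction hypothesis. -/
theorem contract_comm {l m t : ZMod 2} {g h : M.Fn U} (hg : g ∈ M.parity U l)
    (hh : h ∈ M.parity U m) {n : ℕ} {τ : M.Poly U} (hτ : τ ∈ M.polyDeg U n t) :
    M.contract hg (M.contract hh τ) =
      koszulSign ((l + 1) * (m + 1)) • M.contract hh (M.contract hg τ) := by
  induction n generalizing t τ with
  | zero =>
    rw [M.contract_polyPow_zero hg (M.polyDeg_le U _ _ hτ),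
      M.contract_polyPow_zero hh (M.polyDeg_le U _ _ hτ), map_zero, map_zero, smul_zero]
  | succ n ih =>
    induction hτ using Submodule.span_induction with
    | mem y hy =>
      obtain ⟨i, t', X, hX, τ, rfl, hτ, rfl⟩ := hy
      rw [contract_pVf_mul, contract_pVf_mul, map_add, map_add, map_zsmul, map_zsmul, map_zsmul,
        map_zsmul, contract_pFn_mul, contract_pFn_mul, contract_pVf_mul, contract_pVf_mul, ih hτ]
      generalize M.pFn (M.ev_mem hX hg) * M.contract hh τ = A,
        M.pFn (M.ev_mem hX hh) * M.contract hg τ = B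
      rw [mul_smul_comm]
      simp only [smul_add, koszulSign_smul_smul]
      generalize M.pVf hX * M.contract hh (M.contract hg τ) = C
      have h2 : (1 : ZMod 2) + 1 = 0 := rfl
      rcases parity_cases i with rfl | rfl <;> rcases parity_cases l with rfl | rfl <;>
        rcases parity_cases m with rfl | rfl <;>
        simp only [mul_zero, mul_one, add_zero, zero_add, h2, koszulSign_zero, koszulSign_one,
          one_smul, neg_smul] <;> abel
    | zero => simp
    | add x y _ _ hx hy => simp only [map_add, hx, hy, smul_add]
    | smul c x _ hx => simp only [map_smul, hx, smul_comm c]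

theorem contractPow_comm {l m t : ZMod 2} {g h : M.Fn U} (hg : g ∈ M.parity U l)
    (hh : h ∈ M.parity U m) {n : ℕ} {τ : M.polyPow U (n + 1 + 1)}
    (hτ : τ ∈ M.homog U (n + 1 + 1) t) :
    M.contractPow hg n (M.contractPow hh (n + 1) τ) =
      koszulSign ((l + 1) * (m + 1)) • M.contractPow hh n (M.contractPow hg (n + 1) τ) :=
  Subtype.ext (M.contract_comm hg hh (Submodule.mem_comap.1 hτ))

/-- Contraction with dg sees g only through the values X(g). This is applied to the constants ∂_b
x_a. -/
theorem contract_eq_zero {l t : ZMod 2} {g : M.Fn U} (hg : g ∈ M.parity U l)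
    (h : ∀ i, ∀ X ∈ M.vecField U i, M.ev X g = 0) {n : ℕ} {τ : M.Poly U}
    (hτ : τ ∈ M.polyDeg U n t) : M.contract hg τ = 0 := by
  induction n generalizing t τ with
  | zero => exact M.contract_polyPow_zero hg (M.polyDeg_le U _ _ hτ)
  | succ n ih =>
    induction hτ using Submodule.span_induction with
    | mem y hy =>
      obtain ⟨i, t', X, hX, τ, rfl, hτ, rfl⟩ := hy
      rw [contract_pVf_mul, ih hτ, M.pFn_eq_zero _ (h i X hX)]
      simp
    | zero => simp
    | add x y _ _ hx hy => simp only [map_add, hx, hy, add_zero]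
    | smul c x _ hx => simp only [map_smul, hx, smul_zero]

theorem vfPow_eq_zero {i : ZMod 2} {X : M.LocalEnd U} (hX : X ∈ M.vecField U i) (h : X = 0)
    (n : ℕ) : M.vfPow hX n = 0 := by
  have h0 : M.pVf hX = 0 := by
    rw [← zero_smul k (M.pVf hX), ← pVf_smul]
    exact M.pVf_congr _ _ rfl (h.trans (zero_smul k X).symm)
  refine LinearMap.ext fun τ => Subtype.ext ?_
  change M.pVf hX * τ.1 = 0
  rw [h0, zero_mul]

variable {M}
variable {p q : ℕ} (x : M.Coordinates U p q)

namespace Coordinates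

/-- A homogeneous polyvector field is flat if its Lie derivatives along the coordinate vector
fields vanish. -/
structure IsFlat (x : M.Coordinates U p q) {n : ℕ} (t : ZMod 2) (τ : M.polyPow U n) : Prop where
  mem : τ ∈ M.homog U n t
  lie : ∀ a, M.liePow (x.partial_mem a) n τ = 0

variable {x} in
theorem IsFlat.vfPow {n : ℕ} {t : ZMod 2} {τ : M.polyPow U n} (h : x.IsFlat t τ)
    (a : Fin p ⊕ Fin q) :
    x.IsFlat ((coordParity a + 1) + t) (M.vfPow (x.partial_mem a) n τ) where
  mem := M.vfPow_mem _ h.mem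
  lie b := by
    rw [liePow_vfPow, h.lie, map_zero, smul_zero, add_zero,
      M.vfPow_eq_zero _ (x.bracket_partial_partial b a)]
    rfl

variable {x} in
-- By `lieDeriv_contract` the only obstruction is the contraction with d(∂_b x_a), the differential
-- of a constant.
theorem IsFlat.contractPow {n : ℕ} {t : ZMod 2} {τ : M.polyPow U (n + 1)} (h : x.IsFlat t τ)
    (a : Fin p ⊕ Fin q) :
    x.IsFlat (t + (coordParity a + 1)) (M.contractPow (x.x_mem a) n τ) where
  mem := M.contractPow_mem _ h.mem
  lie b := by
    refine Subtype.ext ((M.lieDeriv_contract (x.partial_mem b) (x.x_mem a)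
      (Submodule.mem_comap.1 h.mem)).trans ?_)
    have h1 : M.lieDeriv (x.partial_mem b) τ.1 = 0 := congrArg Subtype.val (h.lie b)
    have h2 := M.contract_eq_zero (M.ev_mem (x.partial_mem b) (x.x_mem a))
      (fun i X hX => x.ev_ev_partial hX b a) (Submodule.mem_comap.1 h.mem)
    rw [Submodule.subtype_apply] at h2 ⊢
    rw [h1, h2]
    simp

theorem vfPow_eq_sum {i : ZMod 2} {X : M.LocalEnd U} (hX : X ∈ M.vecField U i) (n : ℕ)
    (τ : M.polyPow U n) : M.vfPow hX n τ =
      ∑ a, M.fnPow (M.ev_mem hX (x.x_mem a)) (n + 1) (M.vfPow (x.partial_mem a) n τ) := by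
  refine Subtype.ext ?_
  rw [Submodule.coe_sum]
  change M.pVf hX * τ.1 = ∑ a, M.pFn _ * (M.pVf _ * τ.1)
  rw [x.pVf_eq_sum hX, Finset.sum_mul]
  exact Finset.sum_congr rfl fun a _ => mul_assoc _ _ _

theorem one_mem_polyDeg : (1 : M.Poly U) ∈ M.polyDeg U 0 0 :=
  Submodule.subset_span ⟨1, M.parity_one U, M.pFn_one.symm⟩

theorem isFlat_one : x.IsFlat 0 (⟨1, M.polyDeg_le U 0 0 one_mem_polyDeg⟩ : M.polyPow U 0) where
  mem := one_mem_polyDeg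
  lie a := by
    refine Subtype.ext ?_
    change M.lieDeriv _ 1 = 0
    rw [← pFn_one, lieDeriv_pFn]
    exact M.pFn_eq_zero _ (M.ev_one (x.partial_mem a))

/-- Polyvector fields are combinations of flat ones, with functions as coefficients. -/
theorem homog_le_span_flat (n : ℕ) (t : ZMod 2) : M.homog U n t ≤ Submodule.span k
    {y | ∃ (j s : ZMod 2) (f : M.Fn U) (hf : f ∈ M.parity U j) (σ : M.polyPow U n),
      x.IsFlat s σ ∧ y = M.fnPow hf n σ} := by
  induction n generalizing t with
  | zero =>
    rw [homog_zero_eq_span]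
    refine Submodule.span_le.2 ?_
    rintro y ⟨f, hf, hy⟩
    refine Submodule.subset_span ⟨t, 0, f, hf, _, x.isFlat_one, Subtype.ext (hy.trans ?_)⟩
    exact (mul_one _).symm
  | succ n ih =>
    rw [vfPow_mem_span]
    refine Submodule.span_le.2 ?_
    rintro _ ⟨i, t', X, hX, τ, rfl, hτ, rfl⟩
    have := ih t' hτ
    clear hτ
    induction this using Submodule.span_induction with
    | mem y hy =>
      obtain ⟨j, s, f, hf, σ, hσ, rfl⟩ := hy
      -- Here πX f σ is ± Σ f X(x_a) π∂_a σ, and each π∂_a σ is again flat because the coordinate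
      -- fields supercommute.
      rw [vfPow_fnPow, x.vfPow_eq_sum hX, map_sum]
      refine zsmul_mem (sum_mem fun a _ => ?_) _
      rw [fnPow_fnPow]
      exact Submodule.subset_span ⟨_, _, _, _, _, hσ.vfPow a, rfl⟩
    | zero => rw [map_zero]; exact zero_mem _
    | add x y _ _ hx hy => rw [map_add]; exact add_mem hx hy
    | smul c x _ hx => rw [map_smul]; exact Submodule.smul_mem _ c hx

/-- The function coefficient of a flat field crosses the tensor sign and is absorbed into F, so only
flat fields have to be tested. -/
theorem spencer_hom_ext_flat {n : ℕ} {A : Type*} [AddCommGroup A] [Module k A]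
    {φ ψ : M.SpencerSections U n →ₗ[k] A}
    (h : ∀ F t (τ : M.polyPow U n), x.IsFlat t τ →
      φ (M.spencerTmul U n F τ) = ψ (M.spencerTmul U n F τ)) : φ = ψ := by
  refine M.spencer_hom_ext_homog fun F t τ hτ => ?_
  have := x.homog_le_span_flat n t hτ
  clear hτ
  induction this using Submodule.span_induction with
  | mem y hy =>
    obtain ⟨j, s, f, hf, σ, hσ, rfl⟩ := hy
    rw [← spencerTmul_fnOp]
    exact h _ _ _ hσ
  | zero => simp
  | add x y _ _ hx hy => simp only [map_add, hx, hy]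
  | smul c x _ hx => simp only [map_smul, hx]

/-- The Lie derivatives vanish, and what remains is a Koszul differential in which the ∂_a act on F
from the right. -/
theorem delta_flat {n : ℕ} (F : M.diffOp U) {t : ZMod 2} {τ : M.polyPow U (n + 1)}
    (hτ : x.IsFlat t τ) : x.delta n (M.spencerTmul U (n + 1) F τ) =
      koszulSign t • ∑ a, M.spencerTmul U n (x.mulPartial F a)
        (M.contractPow (x.x_mem a) n τ) := by
  rw [x.delta_tmul F hτ.mem, spencerForm_apply]
  congr 1
  refine Finset.sum_congr rfl fun a _ => ?_
  rw [hτ.lie, map_zero, map_zero, sub_zero]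

theorem mulPartial_comm (F : M.diffOp U) (a b : Fin p ⊕ Fin q) :
    x.mulPartial (x.mulPartial F a) b =
      koszulSign (coordParity a * coordParity b) • x.mulPartial (x.mulPartial F b) a := by
  have h : M.vecOp ⟨_, x.partial_mem a⟩ * M.vecOp ⟨_, x.partial_mem b⟩ =
      koszulSign (coordParity a * coordParity b) •
        (M.vecOp ⟨_, x.partial_mem b⟩ * M.vecOp ⟨_, x.partial_mem a⟩) :=
    Subtype.ext (sub_eq_zero.1 (x.bracket_partial_partial a b))
  rw [mulPartial, mulPartial, mulPartial, mulPartial, mul_assoc, h, mul_smul_comm, mul_assoc]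

/-- In the double sum of F ∂_a ∂_b ⊗ ⟨dx_b, ⟨dx_a, τ⟩⟩, exchanging a and b costs (-1)^(|a||b|) from
the operators and (-1)^((|a|+1)(|b|+1)) from the contractions. Combined with the parity sign in the
outer δ this is −1, so the sum equals its own negative and vanishes because 2 is invertible. -/
theorem delta_delta [CharZero k] (n : ℕ) : x.delta n ∘ₗ x.delta (n + 1) = 0 := by
  refine x.spencer_hom_ext_flat fun F t τ hτ => ?_
  rw [LinearMap.comp_apply, x.delta_flat F hτ, map_zsmul, map_sum]
  have key (a b : Fin p ⊕ Fin q) : koszulSign (t + (coordParity a + 1)) •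
      M.spencerTmul U n (x.mulPartial (x.mulPartial F a) b)
        (M.contractPow (x.x_mem b) n (M.contractPow (x.x_mem a) (n + 1) τ)) =
      -(koszulSign (t + (coordParity b + 1)) •
      M.spencerTmul U n (x.mulPartial (x.mulPartial F b) a)
        (M.contractPow (x.x_mem a) n (M.contractPow (x.x_mem b) (n + 1) τ))) := by
    rw [mulPartial_comm, M.contractPow_comm (x.x_mem b) (x.x_mem a) hτ.mem]
    simp only [map_zsmul, LinearMap.smul_apply, koszulSign_smul_smul]
    generalize M.spencerTmul U n (x.mulPartial (x.mulPartial F b) a) _ = A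
    generalize coordParity a = l, coordParity b = m
    have h2 : (1 : ZMod 2) + 1 = 0 := rfl
    rcases parity_cases t with rfl | rfl <;> rcases parity_cases l with rfl | rfl <;>
      rcases parity_cases m with rfl | rfl <;>
      simp only [mul_zero, mul_one, add_zero, zero_add, h2, koszulSign_zero, koszulSign_one,
        one_smul, neg_smul, neg_neg]
  refine (congrArg _ (eq_zero_of_eq_neg k ?_)).trans (smul_zero _)
  simp only [x.delta_flat _ (hτ.contractPow _), Finset.smul_sum]
  conv_lhs => rw [Finset.sum_comm]
  rw [← Finset.sum_neg_distrib]
  refine Finset.sum_congr rfl fun a _ => ?_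
  rw [← Finset.sum_neg_distrib]
  exact Finset.sum_congr rfl fun b _ => key b a

theorem homog_zero_exists {t : ZMod 2} {τ : M.polyPow U 0} (hτ : τ ∈ M.homog U 0 t) :
    ∃ (f : M.Fn U) (hf : f ∈ M.parity U t), τ.1 = M.pFn hf := by
  rw [homog_zero_eq_span] at hτ
  induction hτ using Submodule.span_induction with
  | mem y hy => exact hy
  | zero => exact ⟨0, zero_mem _, (M.pFn_eq_zero _ rfl).symm⟩
  | add x y _ _ hx hy =>
    obtain ⟨f, hf, h⟩ := hx
    obtain ⟨g, hg, h'⟩ := hy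
    exact ⟨f + g, add_mem hf hg, by rw [M.pFn_add hf hg, ← h, ← h']; rfl⟩
  | smul c x _ hx =>
    obtain ⟨f, hf, h⟩ := hx
    exact ⟨c • f, Submodule.smul_mem _ c hf, by rw [M.pFn_smul c hf, ← h]; rfl⟩

/-- By the Cartan formula δ(F ⊗ πX f) is ±(FX ⊗ f − F ⊗ X(f)), and both terms have augmentation
F(X(f)). -/
theorem augSections_delta : M.augSections U ∘ₗ x.delta 0 = 0 := by
  refine M.spencer_hom_ext_homog fun F t τ hτ => ?_
  rw [LinearMap.comp_apply, x.delta_tmul F hτ, map_zsmul]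
  refine (congrArg _ ?_).trans (smul_zero _)
  rw [vfPow_mem_span] at hτ
  induction hτ using Submodule.span_induction with
  | mem y hy =>
    obtain ⟨i, t', X, hX, τ, rfl, hτ, rfl⟩ := hy
    rw [x.spencerForm_vfPow_zero F hX hτ, map_zsmul, map_sub]
    obtain ⟨f, hf, h⟩ := homog_zero_exists hτ
    refine (congrArg _ (sub_eq_zero.2 ?_)).trans (smul_zero _)
    change M.ev (F.1 * X) (M.polyBody U τ.1) = M.ev F.1 (M.polyBody U (M.lieDeriv hX τ.1))
    rw [h, lieDeriv_pFn, polyBody_pFn, polyBody_pFn, ev_mul]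
  | zero => simp
  | add x y _ _ hx hy => rw [map_add, map_add, hx, hy, add_zero]
  | smul c x _ hx => rw [map_smul, map_smul, hx, smul_zero]

end Coordinates

end Flat

end Superspace

namespace Superspace

variable {k : Type u} [Field k] (M : Superspace k)

/-! ### Operators with a spectral decomposition -/

section Spectral

variable {V W : Type*} [AddCommGroup V] [Module k V] [AddCommGroup W] [Module k W]

/-- The sum of the eigenspaces of an endomorphism with nonzero eigenvalue. -/
def nonzeroPart (N : Module.End k V) : Submodule k V :=
  ⨆ μ : k, ⨆ _ : μ ≠ 0, N.eigenspace μ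

/-- On an eigenspace with eigenvalue μ ≠ 0 one divides by μ. Working with the sum of eigenspaces
avoids any claim about N on the whole space. -/
theorem nonzeroPart_surj {N : Module.End k V} {v : V} (hv : v ∈ nonzeroPart N) :
    ∃ w ∈ nonzeroPart N, N w = v := by
  have : nonzeroPart N ≤ (nonzeroPart N).map N := by
    refine iSup_le fun μ => iSup_le fun hμ v hv => ?_
    refine ⟨μ⁻¹ • v, Submodule.smul_mem _ _ ?_, ?_⟩
    · exact Submodule.mem_iSup_of_mem μ (Submodule.mem_iSup_of_mem hμ hv)
    · rw [map_smul, Module.End.mem_eigenspace_iff.1 hv, inv_smul_smul₀ hμ]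
  obtain ⟨w, hw, h⟩ := this hv
  exact ⟨w, hw, h⟩

/-- The kernel of N is the eigenspace for 0, and eigenspaces are independent. -/
theorem nonzeroPart_inj {N : Module.End k V} {v : V} (hv : v ∈ nonzeroPart N) (h : N v = 0) :
    v = 0 := by
  have := N.eigenspaces_iSupIndep 0
  refine Submodule.disjoint_def.1 this v ?_ hv
  rw [Module.End.mem_eigenspace_iff, h, zero_smul]

theorem map_nonzeroPart {N : Module.End k V} {N' : Module.End k W} (δ : V →ₗ[k] W)
    (h : δ ∘ₗ N = N' ∘ₗ δ) {v : V} (hv : v ∈ nonzeroPart N) : δ v ∈ nonzeroPart N' := by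
  have : nonzeroPart N ≤ (nonzeroPart N').comap δ := by
    refine iSup_le fun μ => iSup_le fun hμ v hv => ?_
    refine Submodule.mem_iSup_of_mem μ (Submodule.mem_iSup_of_mem hμ ?_)
    rw [Module.End.mem_eigenspace_iff]
    have := LinearMap.congr_fun h v
    rw [LinearMap.comp_apply, LinearMap.comp_apply, Module.End.mem_eigenspace_iff.1 hv,
      map_smul] at this
    exact this.symm
  exact this hv

end Spectral

/-! ### The contracting homotopy -/

section Homotopy

/-- The parity operator `f ↦ (-1) ^ |f| f` on functions. -/
noncomputable def fnInv (U : Opens M.space) : M.Fn U →ₗ[k] M.Fn U :=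
  LinearMap.ofIsCompl (M.isCompl U) (M.parity U 0).subtype (-(M.parity U 1).subtype)

theorem fnInv_of_mem {U : Opens M.space} {j : ZMod 2} {f : M.Fn U} (hf : f ∈ M.parity U j) :
    M.fnInv U f = koszulSign j • f := by
  rcases parity_cases j with rfl | rfl
  · refine (LinearMap.ofIsCompl_apply_left (M.isCompl U) ⟨f, hf⟩).trans ?_
    rw [koszulSign_zero, one_smul]; rfl
  · refine (LinearMap.ofIsCompl_apply_right (M.isCompl U) ⟨f, hf⟩).trans ?_
    rw [koszulSign_one, neg_smul, one_smul]; rfl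

theorem exists_parity {U : Opens M.space} (f : M.Fn U) :
    ∃ a ∈ M.parity U 0, ∃ b ∈ M.parity U 1, f = a + b := by
  obtain ⟨a, ha, b, hb, h⟩ := Submodule.mem_sup.1
    ((M.isCompl U).codisjoint.eq_top.ge (Submodule.mem_top (x := f)))
  exact ⟨a, ha, b, hb, h.symm⟩

/-- To prove a property of sections, additive in the section, one may assume homogeneity. -/
theorem parity_induction {U : Opens M.space} {P : M.Fn U → Prop}
    (hom : ∀ j, ∀ f ∈ M.parity U j, P f) (add : ∀ f g, P f → P g → P (f + g)) (f : M.Fn U) :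
    P f := by
  obtain ⟨a, ha, b, hb, rfl⟩ := M.exists_parity f
  exact add _ _ (hom 0 a ha) (hom 1 b hb)

theorem fnInv_fnInv {U : Opens M.space} (f : M.Fn U) : M.fnInv U (M.fnInv U f) = f := by
  induction f using M.parity_induction with
  | hom j f hf =>
    rw [M.fnInv_of_mem hf, map_zsmul, M.fnInv_of_mem hf, koszulSign_smul_self]
  | add f g hf hg => rw [map_add, map_add, hf, hg]

theorem fnInv_mul {U : Opens M.space} (f g : M.Fn U) :
    M.fnInv U (f * g) = M.fnInv U f * M.fnInv U g := by
  induction f using M.parity_induction with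
  | hom i f hf =>
    induction g using M.parity_induction with
    | hom j g hg =>
      rw [M.fnInv_of_mem hf, M.fnInv_of_mem hg, M.fnInv_of_mem (M.parity_mul hf hg),
        smul_mul_assoc, mul_smul_comm, koszulSign_smul_smul]
    | add f g hf hg => rw [mul_add, map_add, map_add, hf, hg, mul_add]
  | add f g hf hg => rw [add_mul, map_add, map_add, hf, hg, add_mul]

theorem res_fnInv {U V : Opens M.space} (h : V ≤ U) (f : M.Fn U) :
    M.res h (M.fnInv U f) = M.fnInv V (M.res h f) := by
  induction f using M.parity_induction with
  | hom j f hf => rw [M.fnInv_of_mem hf, map_zsmul]; exact (M.fnInv_of_mem (M.parity_res h hf)).symm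
  | add f g hf hg => simp only [map_add, hf, hg]

/-- The parity operator, as a local endomorphism of the structure sheaf. -/
noncomputable def parityOp (U : Opens M.space) : M.LocalEnd U :=
  ⟨fun V => M.fnInv V.1, fun _ _ h f => M.res_fnInv h f⟩

theorem parityOp_mul_self (U : Opens M.space) : M.parityOp U * M.parityOp U = 1 :=
  M.app_ext fun _ f => M.fnInv_fnInv f

/-- Conjugation with the parity operator. -/
noncomputable def conjEnd (U : Opens M.space) : M.LocalEnd U →ₐ[k] M.LocalEnd U where
  toFun P := M.parityOp U * P * M.parityOp U
  map_one' := by rw [mul_one, parityOp_mul_self]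
  map_mul' P Q := by
    calc M.parityOp U * (P * Q) * M.parityOp U
        = M.parityOp U * P * 1 * Q * M.parityOp U := by simp only [mul_one, mul_assoc]
      _ = _ := by rw [← M.parityOp_mul_self U]; simp only [mul_assoc]
  map_zero' := by rw [mul_zero, zero_mul]
  map_add' P Q := by rw [mul_add, add_mul]
  commutes' c := by rw [← Algebra.commutes, mul_assoc, parityOp_mul_self, mul_one]

theorem conjEnd_apply {U : Opens M.space} (P : M.LocalEnd U) (V : {V : Opens M.space // V ≤ U})
    (f : M.Fn V.1) : M.app (M.conjEnd U P) V f = M.fnInv V.1 (M.app P V (M.fnInv V.1 f)) := rfl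

theorem conjEnd_multOp {U : Opens M.space} (f : M.Fn U) :
    M.conjEnd U (M.multOp U f) = M.multOp U (M.fnInv U f) := by
  refine M.app_ext fun V g => ?_
  change M.fnInv V.1 (M.res V.2 f * M.fnInv V.1 g) = M.res V.2 (M.fnInv U f) * g
  rw [fnInv_mul, fnInv_fnInv, res_fnInv]

/-- A vector field of parity i shifts parities by i. Conjugation with f ↦ (-1)^|f| f therefore
supplies the signs (-1)^|F| of operators without a grading on `diffOp`. -/
theorem conjEnd_vecField {U : Opens M.space} {i : ZMod 2} {X : M.LocalEnd U}
    (hX : X ∈ M.vecField U i) : M.conjEnd U X = koszulSign i • X := by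
  have hz : ∀ (n : ℤ) V f, M.app (n • X) V f = n • M.app X V f := fun n V f =>
    map_zsmul (⟨⟨fun P => M.app P V f, rfl⟩, fun _ _ => rfl⟩ : M.LocalEnd U →+ M.Fn V.1) n X
  refine M.app_ext fun V g => ?_
  rw [conjEnd_apply, hz]
  induction g using M.parity_induction with
  | hom j f hf =>
    rw [M.fnInv_of_mem hf, map_zsmul, map_zsmul, M.fnInv_of_mem (hX V j f hf).1,
      koszulSign_smul_smul]
    congr 2
    rw [add_comm, Coordinates.parity_add_self]
  | add f g hf hg => simp only [map_add, hf, hg, smul_add]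

theorem conjEnd_mem_gen {U : Opens M.space} {P : M.LocalEnd U} (hP : P ∈ M.diffOpGen U) :
    M.conjEnd U P ∈ M.diffOpGen U := by
  have : M.diffOpGen U ≤ (M.diffOpGen U).comap (M.conjEnd U) := by
    refine Algebra.adjoin_le ?_
    rintro _ ((⟨f, rfl⟩ | hX) | hX)
    · change M.conjEnd U _ ∈ M.diffOpGen U
      rw [conjEnd_multOp]
      exact M.multOp_mem_gen _
    · change M.conjEnd U _ ∈ M.diffOpGen U
      rw [M.conjEnd_vecField hX]
      exact zsmul_mem (M.vecField_mem_gen hX) _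
    · change M.conjEnd U _ ∈ M.diffOpGen U
      rw [M.conjEnd_vecField hX]
      exact zsmul_mem (M.vecField_mem_gen hX) _
  exact this hP

theorem endRes_conjEnd {U V : Opens M.space} (h : V ≤ U) (P : M.LocalEnd U) :
    M.endRes h (M.conjEnd U P) = M.conjEnd V (M.endRes h P) :=
  M.app_ext fun _ _ => rfl

theorem conjEnd_mem_diffOp {U : Opens M.space} {P : M.LocalEnd U} (hP : P ∈ M.diffOp U) :
    M.conjEnd U P ∈ M.diffOp U := by
  intro x hx
  obtain ⟨V, hV, hxV, hP⟩ := hP x hx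
  refine ⟨V, hV, hxV, ?_⟩
  rw [endRes_conjEnd]
  exact M.conjEnd_mem_gen hP

/-- Conjugation of differential operators with the parity operator. -/
noncomputable def conjOp (U : Opens M.space) : M.diffOp U →ₐ[k] M.diffOp U :=
  ((M.conjEnd U).comp (M.diffOp U).val).codRestrict (M.diffOp U) fun P =>
    M.conjEnd_mem_diffOp P.2

/-- Conjugation with the `i`-th power of the parity operator. -/
noncomputable def conjSign (U : Opens M.space) (i : ZMod 2) : M.diffOp U →ₐ[k] M.diffOp U :=
  if i = 0 then AlgHom.id k _ else M.conjOp U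

variable {U : Opens M.space}

theorem conjSign_fnOp (i : ZMod 2) {j : ZMod 2} {f : M.Fn U} (hf : f ∈ M.parity U j) :
    M.conjSign U i (M.fnOp f) = koszulSign (i * j) • M.fnOp f := by
  rcases parity_cases i with rfl | rfl
  · rw [zero_mul]; exact (one_smul ℤ _).symm
  · rw [one_mul]
    refine Subtype.ext ((M.conjEnd_multOp f).trans ?_)
    rw [M.fnInv_of_mem hf, map_zsmul]; rfl

theorem conjSign_vecOp (i : ZMod 2) {j : ZMod 2} {X : M.LocalEnd U} (hX : X ∈ M.vecField U j) :
    M.conjSign U i (M.vecOp ⟨X, hX⟩) = koszulSign (i * j) • M.vecOp ⟨X, hX⟩ := by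
  rcases parity_cases i with rfl | rfl
  · rw [zero_mul]; exact (one_smul ℤ _).symm
  · rw [one_mul]
    exact Subtype.ext (M.conjEnd_vecField hX)

theorem fnOp_mul_fnOp (f g : M.Fn U) : M.fnOp f * M.fnOp g = M.fnOp (f * g) :=
  Subtype.ext (map_mul (M.multOp U) f g).symm

theorem fnOp_zsmul (n : ℤ) (f : M.Fn U) : M.fnOp (n • f) = n • M.fnOp f :=
  Subtype.ext (map_zsmul (M.multOp U) n f)

theorem fnOp_add (f g : M.Fn U) : M.fnOp (f + g) = M.fnOp f + M.fnOp g :=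
  Subtype.ext (map_add (M.multOp U) f g)

theorem fnOp_one : M.fnOp (1 : M.Fn U) = 1 := Subtype.ext (map_one (M.multOp U))

variable {M}
variable {p q : ℕ} (x : M.Coordinates U p q)

namespace Coordinates

/-- The supercommutator `[F, x_a]`, i.e. the derivative of the symbol of `F` with respect
to `∂_a`. -/
noncomputable def commCoord (a : Fin p ⊕ Fin q) : M.diffOp U →ₗ[k] M.diffOp U :=
  LinearMap.mulRight k (M.fnOp (x.x a)) -
    LinearMap.mulLeft k (M.fnOp (x.x a)) ∘ₗ (M.conjSign U (coordParity a)).toLinearMap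

theorem commCoord_apply (a : Fin p ⊕ Fin q) (F : M.diffOp U) :
    x.commCoord a F = F * M.fnOp (x.x a) - M.fnOp (x.x a) * M.conjSign U (coordParity a) F := rfl

/-- Functions supercommute with x_a, so [·, x_a] is linear up to sign for right multiplication by
functions. This makes the homotopy well defined on the tensor product. -/
theorem commCoord_mul_fnOp (a : Fin p ⊕ Fin q) (F : M.diffOp U) {j : ZMod 2} {f : M.Fn U}
    (hf : f ∈ M.parity U j) : x.commCoord a (F * M.fnOp f) =
      koszulSign (coordParity a * j) • (x.commCoord a F * M.fnOp f) := by
  rw [commCoord_apply, commCoord_apply, map_mul, M.conjSign_fnOp _ hf, mul_assoc, fnOp_mul_fnOp,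
    M.supercomm (x.x_mem a) hf, fnOp_zsmul, ← fnOp_mul_fnOp, sub_mul, smul_sub]
  simp only [mul_smul_comm, mul_assoc]

/-- The canonical relation [∂_b, x_a] = δ_ab and the Leibniz rule: [·, x_a] acts on words in the ∂_b
as differentiation with respect to ∂_a. -/
theorem commCoord_mulPartial (a b : Fin p ⊕ Fin q) (F : M.diffOp U) :
    x.commCoord a (x.mulPartial F b) = (if b = a then F else 0) +
      koszulSign (coordParity b * coordParity a) • x.mulPartial (x.commCoord a F) b := by
  have h1 : F * M.fnOp (M.ev (x.partialD b) (x.x a)) = if b = a then F else 0 := by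
    rw [ev_partial]
    split_ifs
    · rw [fnOp_one, mul_one]
    · exact (congrArg _ (Subtype.ext (map_zero (M.multOp U)))).trans (mul_zero _)
  rw [commCoord_apply, commCoord_apply, mulPartial_mul_fnOp _ _ _ (x.x_mem a), h1]
  simp only [mulPartial]
  rw [map_mul, M.conjSign_vecOp, sub_mul, smul_sub, mul_comm (coordParity a) (coordParity b)]
  simp only [mul_smul_comm, mul_assoc]
  abel

theorem commCoord_fnOp (a : Fin p ⊕ Fin q) (f : M.Fn U) : x.commCoord a (M.fnOp f) = 0 := by
  have h1 : x.commCoord a 1 = 0 := by rw [commCoord_apply, map_one, one_mul, mul_one, sub_self]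
  induction f using M.parity_induction with
  | hom j f hf => rw [← one_mul (M.fnOp f), x.commCoord_mul_fnOp a 1 hf, h1, zero_mul, smul_zero]
  | add f g hf hg => rw [fnOp_add, map_add, hf, hg, add_zero]

/-- The Euler operator `F ↦ ∑ [F, x_a] ∂_a`. -/
noncomputable def euler : M.diffOp U →ₗ[k] M.diffOp U :=
  ∑ a, x.mulPartialHom a ∘ₗ x.commCoord a

theorem euler_apply (F : M.diffOp U) : x.euler F = ∑ a, x.mulPartial (x.commCoord a F) a := by
  rw [euler, LinearMap.sum_apply]; rfl

theorem euler_fnOp (f : M.Fn U) : x.euler (M.fnOp f) = 0 := by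
  rw [euler_apply]
  refine Finset.sum_eq_zero fun a _ => ?_
  rw [commCoord_fnOp, mulPartial, zero_mul]

/-- The relation [∂_b, x_b] = 1 contributes one copy of F ∂_b. In the remaining terms ∂_b can be
moved to the right end, and the signs from passing x_a and ∂_a cancel. -/
theorem euler_mulPartial (F : M.diffOp U) (b : Fin p ⊕ Fin q) :
    x.euler (x.mulPartial F b) = x.mulPartial F b + x.mulPartial (x.euler F) b := by
  have h (a : Fin p ⊕ Fin q) : x.mulPartial (x.commCoord a (x.mulPartial F b)) a =
      (if b = a then x.mulPartial F a else 0) +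
        x.mulPartial (x.mulPartial (x.commCoord a F) a) b := by
    rw [commCoord_mulPartial, mulPartial_comm, mul_comm (coordParity a)]
    simp only [mulPartial, add_mul, smul_mul_assoc, ite_mul, zero_mul]
  rw [euler_apply, euler_apply, Finset.sum_congr rfl fun a _ => h a, Finset.sum_add_distrib,
    Finset.sum_ite_eq, if_pos (Finset.mem_univ b)]
  congr 1
  exact (Finset.sum_mul _ _ _).symm

/-- The homotopy `F ⊗ τ ↦ (-1) ^ |τ| ∑ [F, x_a] ⊗ π∂_a τ`. -/
noncomputable def homotopy (n : ℕ) : M.SpencerSections U n →ₗ[k] M.SpencerSections U (n + 1) :=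
  M.spencerLift (∑ a, (M.spencerTmul U (n + 1)).compl₁₂ (x.commCoord a)
    (M.vfPow (x.partial_mem a) n ∘ₗ M.invPow U n)) (by
    intro F j f hf t τ hτ
    rw [LinearMap.sum_apply, LinearMap.sum_apply, LinearMap.sum_apply, LinearMap.sum_apply]
    refine Finset.sum_congr rfl fun a _ => ?_
    simp only [LinearMap.compl₁₂_apply, LinearMap.comp_apply]
    rw [M.invPow_of_mem hτ, M.invPow_of_mem (M.fnPow_mem hf hτ), x.commCoord_mul_fnOp a F hf]
    simp only [map_zsmul, LinearMap.smul_apply]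
    rw [M.spencerTmul_fnOp _ hf, vfPow_fnPow, map_zsmul, koszulSign_smul_smul, koszulSign_smul_smul]
    have e (a j t : ZMod 2) : t + a * j = j + t + (a + 1) * j := by revert a j t; decide
    rw [e])

theorem homotopy_tmul {n : ℕ} (F : M.diffOp U) {t : ZMod 2} {τ : M.polyPow U n}
    (hτ : τ ∈ M.homog U n t) : x.homotopy n (M.spencerTmul U n F τ) =
      koszulSign t • ∑ a, M.spencerTmul U (n + 1) (x.commCoord a F)
        (M.vfPow (x.partial_mem a) n τ) := by
  rw [homotopy, spencerLift_tmul, LinearMap.sum_apply, LinearMap.sum_apply, Finset.smul_sum]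
  refine Finset.sum_congr rfl fun a _ => ?_
  rw [LinearMap.compl₁₂_apply, LinearMap.comp_apply, M.invPow_of_mem hτ, map_zsmul, map_zsmul]

end Coordinates

end Homotopy

end Superspace

namespace Superspace

variable {k : Type u} [Field k] (M : Superspace k)

/-! ### Local exactness -/

section Exactness

variable {M}
variable {U : Opens M.space} {p q : ℕ} (x : M.Coordinates U p q)

namespace Coordinates

/-- The counterpart of the Euler operator on polyvector fields; it counts the factors πX. On πX τ,
contracting the first factor restores πX because X = Σ X(x_a) ∂_a, and the other terms pass to τ. -/
theorem sum_pVf_contract {n : ℕ} {t : ZMod 2} {τ : M.Poly U} (hτ : τ ∈ M.polyDeg U n t) :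
    ∑ a, koszulSign (coordParity a + 1) •
      (M.pVf (x.partial_mem a) * M.contract (x.x_mem a) τ) = n • τ := by
  induction n generalizing t τ with
  | zero =>
    rw [zero_smul]
    refine Finset.sum_eq_zero fun a _ => ?_
    rw [M.contract_polyPow_zero _ (M.polyDeg_le U _ _ hτ), mul_zero, smul_zero]
  | succ n ih =>
    induction hτ using Submodule.span_induction with
    | mem y hy =>
      obtain ⟨i, t', X, hX, τ, rfl, hτ, rfl⟩ := hy
      have key (a : Fin p ⊕ Fin q) : koszulSign (coordParity a + 1) •
          (M.pVf (x.partial_mem a) * M.contract (x.x_mem a) (M.pVf hX * τ)) =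
          M.pFn (M.ev_mem hX (x.x_mem a)) * M.pVf (x.partial_mem a) * τ +
          M.pVf hX * (koszulSign (coordParity a + 1) •
            (M.pVf (x.partial_mem a) * M.contract (x.x_mem a) τ)) := by
        rw [contract_pVf_mul, mul_add, mul_smul_comm, mul_smul_comm, ← mul_assoc, ← mul_assoc,
          M.pVf_mul_pFn _ (x.partial_mem a), M.pVf_mul_pVf (x.partial_mem a) hX, smul_mul_assoc,
          smul_mul_assoc, mul_smul_comm, ← mul_assoc]
        generalize M.pFn (M.ev_mem hX (x.x_mem a)) * M.pVf (x.partial_mem a) * τ = A,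
          M.pVf hX * M.pVf (x.partial_mem a) * M.contract (x.x_mem a) τ = B
        generalize coordParity a = l
        have h2 : (1 : ZMod 2) + 1 = 0 := rfl
        rcases parity_cases i with rfl | rfl <;> rcases parity_cases l with rfl | rfl <;>
          simp only [mul_zero, mul_one, add_zero, zero_add, h2, koszulSign_zero, koszulSign_one,
            one_smul, neg_smul, neg_neg, smul_add, smul_neg]
      rw [Finset.sum_congr rfl fun a _ => key a, Finset.sum_add_distrib, ← Finset.sum_mul,
        ← x.pVf_eq_sum hX, ← Finset.mul_sum, ih hτ, mul_smul_comm, succ_nsmul']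
    | zero => simp
    | add x y _ _ hx hy =>
      simp only [map_add, mul_add, smul_add, Finset.sum_add_distrib, hx, hy]
    | smul c x _ hx =>
      rw [smul_comm, ← hx, Finset.smul_sum]
      refine Finset.sum_congr rfl fun a _ => ?_
      rw [map_smul, mul_smul_comm, smul_comm]

theorem sum_vfPow_contractPow {n : ℕ} {t : ZMod 2} {τ : M.polyPow U (n + 1)}
    (hτ : τ ∈ M.homog U (n + 1) t) : ∑ a, koszulSign (coordParity a + 1) •
      M.vfPow (x.partial_mem a) n (M.contractPow (x.x_mem a) n τ) = (n + 1) • τ := by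
  refine Subtype.ext (Eq.trans ?_ (x.sum_pVf_contract (Submodule.mem_comap.1 hτ)))
  rw [Submodule.coe_sum]
  rfl

theorem fnPow_ev_partial (a b : Fin p ⊕ Fin q) (n : ℕ) (τ : M.polyPow U n) :
    M.fnPow (M.ev_mem (x.partial_mem b) (x.x_mem a)) n τ = if b = a then τ else 0 := by
  split_ifs with h
  · subst h
    rw [M.fnPow_congr _ (M.parity_one U) (by generalize coordParity b = l; revert l; decide)
      (x.partial_self b), fnPow_one]
  · rw [M.fnPow_eq_zero _ (x.partial_ne b a h)]; rfl

/-- The Koszul homotopy formula: creating and then removing a direction, in both orders, leaves only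
the number of ∂'s in F (the Euler operator) and the number of π-factors of τ
(`sum_vfPow_contractPow`). -/
theorem delta_homotopy {n : ℕ} (F : M.diffOp U) {t : ZMod 2} {τ : M.polyPow U (n + 1)}
    (hτ : x.IsFlat t τ) :
    x.delta (n + 1) (x.homotopy (n + 1) (M.spencerTmul U (n + 1) F τ)) +
      x.homotopy n (x.delta n (M.spencerTmul U (n + 1) F τ)) =
      M.spencerTmul U (n + 1) (x.euler F) τ + (n + 1) • M.spencerTmul U (n + 1) F τ := by
  rw [x.homotopy_tmul F hτ.mem, x.delta_flat F hτ, map_zsmul, map_sum, map_zsmul, map_sum,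
    ← map_nsmul, ← x.sum_vfPow_contractPow hτ.mem, euler_apply, map_sum, map_sum,
    LinearMap.sum_apply]
  have k1 (a b : Fin p ⊕ Fin q) : M.spencerTmul U (n + 1) (x.mulPartial (x.commCoord b F) a)
      (M.contractPow (x.x_mem a) (n + 1) (M.vfPow (x.partial_mem b) (n + 1) τ)) =
      koszulSign ((coordParity b + 1) * (coordParity a + 1)) •
        ((if b = a then M.spencerTmul U (n + 1) (x.mulPartial (x.commCoord b F) a) τ else 0) +
          M.spencerTmul U (n + 1) (x.mulPartial (x.commCoord b F) a)
            (M.vfPow (x.partial_mem b) n (M.contractPow (x.x_mem a) n τ))) := by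
    rw [contractPow_vfPow, fnPow_ev_partial, map_add, map_zsmul, map_zsmul, smul_add]
    congr 2
    split_ifs
    · rfl
    · exact map_zero _
  have k2 (a b : Fin p ⊕ Fin q) : M.spencerTmul U (n + 1) (x.commCoord b (x.mulPartial F a))
      (M.vfPow (x.partial_mem b) n (M.contractPow (x.x_mem a) n τ)) =
      (if b = a then M.spencerTmul U (n + 1) F
        (M.vfPow (x.partial_mem b) n (M.contractPow (x.x_mem b) n τ)) else 0) +
      koszulSign (coordParity a * coordParity b) •
        M.spencerTmul U (n + 1) (x.mulPartial (x.commCoord b F) a)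
          (M.vfPow (x.partial_mem b) n (M.contractPow (x.x_mem a) n τ)) := by
    rw [commCoord_mulPartial, map_add, LinearMap.add_apply, map_zsmul, LinearMap.smul_apply]
    congr 1
    by_cases h : b = a
    · subst h; rw [if_pos rfl, if_pos rfl]
    · rw [if_neg h, if_neg (Ne.symm h), map_zero]; rfl
  simp only [x.delta_flat _ (hτ.vfPow _), x.homotopy_tmul _ (hτ.contractPow _).mem, Finset.smul_sum,
    k1, k2]
  -- In δh the index b of the homotopy is the outer one, in hδ the inner one; the orders are aligned
  -- to compare summands.
  conv_lhs => enter [2]; rw [Finset.sum_comm]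
  rw [← Finset.sum_add_distrib, ← Finset.sum_add_distrib]
  refine Finset.sum_congr rfl fun b _ => ?_
  rw [← Finset.sum_add_distrib]
  -- For a ≠ b the two contributions are the same tensor with opposite signs, so only a = b
  -- survives.
  rw [Finset.sum_eq_single b]
  · rw [if_pos rfl, if_pos rfl, map_zsmul]
    generalize M.vfPow (x.partial_mem b) n (M.contractPow (x.x_mem b) n τ) = τ'
    generalize M.spencerTmul U (n + 1) (x.mulPartial (x.commCoord b F) b) τ = A,
      M.spencerTmul U (n + 1) (x.mulPartial (x.commCoord b F) b) τ' = B,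
      M.spencerTmul U (n + 1) F τ' = C
    generalize coordParity b = l
    have h2 : (1 : ZMod 2) + 1 = 0 := rfl
    rcases parity_cases t with rfl | rfl <;> rcases parity_cases l with rfl | rfl <;>
      simp only [mul_zero, mul_one, add_zero, zero_add, h2, koszulSign_zero, koszulSign_one,
        one_smul, neg_smul, neg_neg] <;> abel
  · intro a _ hab
    rw [if_neg (Ne.symm hab), if_neg (Ne.symm hab), zero_add, zero_add]
    generalize M.spencerTmul U (n + 1) (x.mulPartial (x.commCoord b F) a) _ = B
    generalize coordParity b = l, coordParity a = m
    have h2 : (1 : ZMod 2) + 1 = 0 := rfl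
    rcases parity_cases t with rfl | rfl <;> rcases parity_cases l with rfl | rfl <;>
      rcases parity_cases m with rfl | rfl <;>
      simp only [mul_zero, mul_one, add_zero, zero_add, h2, koszulSign_zero, koszulSign_one,
        one_smul, neg_smul, neg_neg] <;> abel
  · exact fun h => absurd (Finset.mem_univ b) h

/-- On functions there is neither a term hδ nor a contraction, and only the Euler term is left. -/
theorem delta_homotopy_zero (F : M.diffOp U) {t : ZMod 2} {τ : M.polyPow U 0}
    (hτ : x.IsFlat t τ) :
    x.delta 0 (x.homotopy 0 (M.spencerTmul U 0 F τ)) = M.spencerTmul U 0 (x.euler F) τ := by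
  rw [x.homotopy_tmul F hτ.mem, map_zsmul, map_sum, euler_apply, map_sum,
    LinearMap.sum_apply, Finset.smul_sum]
  refine Finset.sum_congr rfl fun b _ => ?_
  rw [x.delta_flat _ (hτ.vfPow _), Finset.sum_eq_single b]
  · rw [contractPow_vfPow_zero, fnPow_ev_partial, if_pos rfl, map_zsmul]
    generalize M.spencerTmul U 0 (x.mulPartial (x.commCoord b F) b) τ = A
    generalize coordParity b = l
    have h2 : (1 : ZMod 2) + 1 = 0 := rfl
    rcases parity_cases t with rfl | rfl <;> rcases parity_cases l with rfl | rfl <;>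
      simp only [mul_zero, mul_one, add_zero, zero_add, h2, koszulSign_zero, koszulSign_one,
        one_smul, neg_smul, neg_neg]
  · intro a _ hab
    rw [contractPow_vfPow_zero, fnPow_ev_partial, if_neg (Ne.symm hab), smul_zero, map_zero]
  · exact fun h => absurd (Finset.mem_univ b) h

/-- The combinations of the operators `f ∂_{a_1} ⋯ ∂_{a_r}`. -/
def words (x : M.Coordinates U p q) : ℕ → Submodule k (M.diffOp U)
  | 0 => Submodule.span k (Set.range M.fnOp)
  | r + 1 => ⨆ a, (x.words r).map (x.mulPartialHom a)

/-- The Euler operator kills functions and gains one with each factor ∂_a. -/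
theorem euler_words {r : ℕ} {F : M.diffOp U} (hF : F ∈ x.words r) : x.euler F = (r : k) • F := by
  induction r generalizing F with
  | zero =>
    have : x.words 0 ≤ LinearMap.ker x.euler := by
      refine Submodule.span_le.2 ?_
      rintro _ ⟨f, rfl⟩
      exact x.euler_fnOp f
    rw [Nat.cast_zero, zero_smul]
    exact this hF
  | succ r ih =>
    have : x.words (r + 1) ≤ LinearMap.eqLocus x.euler (((r + 1 : ℕ) : k) • LinearMap.id) := by
      refine iSup_le fun a => ?_
      rintro _ ⟨F, hF, rfl⟩
      change x.euler (x.mulPartial F a) = ((r + 1 : ℕ) : k) • x.mulPartial F a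
      rw [euler_mulPartial, ih hF, Nat.cast_succ, add_smul, one_smul, add_comm]
      rw [← mulPartialHom_apply, ← mulPartialHom_apply, map_smul]
    exact this hF

theorem mulPartial_mem_words {F : M.diffOp U} (hF : F ∈ ⨆ r, x.words r) (a : Fin p ⊕ Fin q) :
    x.mulPartial F a ∈ ⨆ r, x.words r := by
  have : ⨆ r, x.words r ≤ (⨆ r, x.words r).comap (x.mulPartialHom a) := by
    refine iSup_le fun r F hF => ?_
    exact Submodule.mem_iSup_of_mem (r + 1) (Submodule.mem_iSup_of_mem a ⟨F, hF, rfl⟩)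
  exact this hF

/-- The function is moved to the left past each ∂_a by the Leibniz rule. This produces shorter
words, hence the supremum over all lengths. -/
theorem mul_fnOp_mem_words {F : M.diffOp U} (hF : F ∈ ⨆ r, x.words r) (f : M.Fn U) :
    F * M.fnOp f ∈ ⨆ r, x.words r := by
  have key (r : ℕ) : ∀ f, x.words r ≤ (⨆ r, x.words r).comap (LinearMap.mulRight k (M.fnOp f)) := by
    induction r with
    | zero =>
      intro f
      refine Submodule.span_le.2 ?_
      rintro _ ⟨g, rfl⟩
      change M.fnOp g * M.fnOp f ∈ ⨆ r, x.words r
      rw [fnOp_mul_fnOp]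
      exact Submodule.mem_iSup_of_mem 0 (Submodule.subset_span ⟨_, rfl⟩)
    | succ r ih =>
      intro f
      refine iSup_le fun a => ?_
      rintro _ ⟨F, hF, rfl⟩
      change x.mulPartial F a * M.fnOp f ∈ ⨆ r, x.words r
      induction f using M.parity_induction with
      | hom j f hf =>
        rw [x.mulPartial_mul_fnOp F a hf]
        exact add_mem (ih _ hF) (zsmul_mem (x.mulPartial_mem_words (ih _ hF) a) _)
      | add f g hf hg => rw [fnOp_add, mul_add]; exact add_mem hf hg
  exact iSup_le (fun r => key r f) hF

theorem mul_vecOp_mem_words {F : M.diffOp U} (hF : F ∈ ⨆ r, x.words r) {i : ZMod 2}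
    {X : M.LocalEnd U} (hX : X ∈ M.vecField U i) :
    F * M.vecOp ⟨X, hX⟩ ∈ ⨆ r, x.words r := by
  rw [x.mul_vecOp_eq_sum F hX]
  exact sum_mem fun a _ => x.mulPartial_mem_words (x.mul_fnOp_mem_words hF _) a

/-- The functions and vector fields generate the operators `f ∂_{a_1} ⋯ ∂_{a_r}`. -/
theorem mem_words {P : M.diffOp U} (hP : P.1 ∈ M.diffOpGen U) : P ∈ ⨆ r, x.words r := by
  -- Products are handled one factor at a time by letting Q multiply an arbitrary sum of words F
  -- from the right; the claim is the case F = 1.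
  have key : ∀ Q (hQ : Q ∈ M.diffOpGen U), ∀ F ∈ ⨆ r, x.words r,
      F * ⟨Q, M.gen_le_diffOp U hQ⟩ ∈ ⨆ r, x.words r := by
    intro Q hQ
    induction hQ using Algebra.adjoin_induction with
    | mem Q hQ =>
      intro F hF
      rcases hQ with (⟨f, rfl⟩ | hX) | hX
      · exact x.mul_fnOp_mem_words hF f
      · exact x.mul_vecOp_mem_words hF hX
      · exact x.mul_vecOp_mem_words hF hX
    | algebraMap c =>
      intro F hF
      have h : F * ⟨algebraMap k _ c, M.gen_le_diffOp U (Subalgebra.algebraMap_mem _ c)⟩ = c • F := by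
        exact ((Algebra.smul_def c F).trans (Algebra.commutes c F)).symm
      rw [h]
      exact Submodule.smul_mem _ c hF
    | add Q R hQ hR ihQ ihR =>
      intro F hF
      exact (mul_add F ⟨Q, M.gen_le_diffOp U hQ⟩ ⟨R, M.gen_le_diffOp U hR⟩) ▸
        add_mem (ihQ F hF) (ihR F hF)
    | mul Q R hQ hR ihQ ihR =>
      intro F hF
      exact (mul_assoc F ⟨Q, M.gen_le_diffOp U hQ⟩ ⟨R, M.gen_le_diffOp U hR⟩) ▸
        ihR _ (ihQ F hF)
  have := key P.1 hP 1 (Submodule.mem_iSup_of_mem 0 (Submodule.subset_span ⟨1, M.fnOp_one⟩))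
  rwa [one_mul] at this

end Coordinates

/-- The sections of the tensor products generated by `F ⊗ τ` with `F` in the algebra generated
by functions and vector fields. -/
def genSections (M : Superspace k) (U : Opens M.space) (n : ℕ) :
    Submodule k (M.SpencerSections U n) :=
  Submodule.span k {s | ∃ (F : M.diffOp U) (τ : M.polyPow U n),
    F.1 ∈ M.diffOpGen U ∧ s = M.spencerTmul U n F τ}

namespace Coordinates

/-- Generated sections are sums of F ⊗ σ with F a word and σ flat: coefficients of flat fields are
absorbed into F, and sums of words are stable under this. -/
theorem genSections_le {n : ℕ} {S : Submodule k (M.SpencerSections U n)}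
    (h : ∀ r, ∀ F ∈ x.words r, ∀ t (τ : M.polyPow U n), x.IsFlat t τ →
      M.spencerTmul U n F τ ∈ S) : M.genSections U n ≤ S := by
  have h1 : ∀ F ∈ ⨆ r, x.words r, ∀ t (τ : M.polyPow U n), x.IsFlat t τ →
      M.spencerTmul U n F τ ∈ S := by
    intro F hF t τ hτ
    have : ⨆ r, x.words r ≤ S.comap ((M.spencerTmul U n).flip τ) :=
      iSup_le fun r F hF => h r F hF t τ hτ
    exact this hF
  have h2 : ∀ F ∈ ⨆ r, x.words r, ∀ t, ∀ τ ∈ M.homog U n t, M.spencerTmul U n F τ ∈ S := by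
    intro F hF t τ hτ
    have : M.homog U n t ≤ S.comap (M.spencerTmul U n F) := by
      refine (x.homog_le_span_flat n t).trans (Submodule.span_le.2 ?_)
      rintro _ ⟨j, s, f, hf, σ, hσ, rfl⟩
      change M.spencerTmul U n F _ ∈ S
      rw [← spencerTmul_fnOp]
      exact h1 _ (x.mul_fnOp_mem_words hF f) s σ hσ
    exact this hτ
  refine Submodule.span_le.2 ?_
  rintro _ ⟨F, τ, hF, rfl⟩
  have : (⊤ : Submodule k (M.polyPow U n)) ≤ S.comap (M.spencerTmul U n F) := by
    rw [← M.homog_sup n]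
    exact sup_le (h2 F (x.mem_words hF) 0) (h2 F (x.mem_words hF) 1)
  exact this (Submodule.mem_top (x := τ))

/-- Local exactness of the Spencer complex in positive degrees. -/
theorem exact_succ [CharZero k] {n : ℕ} {s : M.SpencerSections U (n + 1)}
    (hs : s ∈ M.genSections U (n + 1)) (h : x.delta n s = 0) : ∃ t, x.delta (n + 1) t = s := by
  let N := x.delta (n + 1) ∘ₗ x.homotopy (n + 1) + x.homotopy n ∘ₗ x.delta n
  have h1 : M.genSections U (n + 1) ≤ nonzeroPart N := by
    refine x.genSections_le fun r F hF t τ hτ => ?_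
    -- The eigenvalue is the length r of the word plus the degree n + 1 of the polyvector field; it
    -- is nonzero in characteristic zero.
    refine Submodule.mem_iSup_of_mem ((r + (n + 1) : ℕ) : k)
      (Submodule.mem_iSup_of_mem (Nat.cast_ne_zero.2 (by omega)) ?_)
    rw [Module.End.mem_eigenspace_iff]
    refine (x.delta_homotopy F hτ).trans ?_
    rw [x.euler_words hF, map_smul, LinearMap.smul_apply, Nat.cast_add, add_smul ((r : ℕ) : k)]
    refine congrArg _ ?_
    exact (Nat.cast_smul_eq_nsmul k (n + 1) (M.spencerTmul U (n + 1) F τ)).symm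
  obtain ⟨s', hs', rfl⟩ := nonzeroPart_surj (h1 hs)
  -- The section s = N s' is a cycle, but the homotopy is applied to s'. Since δ² = 0, δ intertwines
  -- N with δh one degree lower. Thus δ s' lies in the nonzero part of δh and is killed by it, so it
  -- vanishes and s = δ(h s').
  have h2 : x.delta n ∘ₗ N = (x.delta n ∘ₗ x.homotopy n) ∘ₗ x.delta n := by
    rw [LinearMap.comp_add, ← LinearMap.comp_assoc, x.delta_delta, LinearMap.zero_comp, zero_add,
      LinearMap.comp_assoc]
  have h3 : x.delta n s' = 0 :=
    nonzeroPart_inj (map_nonzeroPart _ h2 hs') ((LinearMap.congr_fun h2 s').symm.trans h)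
  refine ⟨x.homotopy (n + 1) s', ?_⟩
  change _ = x.delta (n + 1) (x.homotopy (n + 1) s') + x.homotopy n (x.delta n s')
  rw [h3, map_zero, add_zero]

/-- Functions split uniquely into even and odd parts, so an element of degree zero is determined by
the function it represents. -/
theorem polyBody_eq_zero {τ : M.polyPow U 0} (h : M.polyBody U τ.1 = 0) : τ = 0 := by
  obtain ⟨a, ha, b, hb, rfl⟩ :=
    Submodule.mem_sup.1 ((M.homog_sup 0).ge (Submodule.mem_top (x := τ)))
  obtain ⟨f, hf, h1⟩ := homog_zero_exists ha
  obtain ⟨g, hg, h2⟩ := homog_zero_exists hb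
  have h3 : f + g = 0 := by
    rw [← h, Submodule.coe_add, h1, h2, map_add, polyBody_pFn, polyBody_pFn]
  have h4 : f = 0 := by
    refine Submodule.disjoint_def.1 (M.isCompl U).disjoint f hf ?_
    rw [eq_neg_of_add_eq_zero_left h3]
    exact neg_mem hg
  refine Subtype.ext ?_
  rw [Submodule.coe_add, h1, h2, M.pFn_eq_zero hf h4,
    M.pFn_eq_zero hg (by rwa [h4, zero_add] at h3)]
  exact add_zero _

/-- Local exactness of the augmented Spencer complex in degree zero. -/
theorem exact_zero [CharZero k] {s : M.SpencerSections U 0}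
    (hs : s ∈ M.genSections U 0) (h : M.augSections U s = 0) : ∃ t, x.delta 0 t = s := by
  let N := x.delta 0 ∘ₗ x.homotopy 0
  -- Words of length zero are functions, which cross the tensor sign and give 1 ⊗ τ; longer words
  -- are eigenvectors with nonzero eigenvalue.
  have h1 : M.genSections U 0 ≤ LinearMap.range (M.spencerTmul U 0 1) ⊔ nonzeroPart N := by
    refine x.genSections_le fun r F hF t τ hτ => ?_
    cases r with
    | zero =>
      have : x.words 0 ≤ (LinearMap.range (M.spencerTmul U 0 1) ⊔ nonzeroPart N).comap
          ((M.spencerTmul U 0).flip τ) := by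
        refine Submodule.span_le.2 ?_
        rintro _ ⟨f, rfl⟩
        change M.spencerTmul U 0 (M.fnOp f) τ ∈
          LinearMap.range (M.spencerTmul U 0 1) ⊔ nonzeroPart N
        induction f using M.parity_induction with
        | hom j f hf =>
          rw [← one_mul (M.fnOp f), M.spencerTmul_fnOp _ hf]
          exact Submodule.mem_sup_left ⟨_, rfl⟩
        | add f g hf hg => rw [fnOp_add, map_add]; exact add_mem hf hg
      exact this hF
    | succ r =>
      refine Submodule.mem_sup_right (Submodule.mem_iSup_of_mem ((r + 1 : ℕ) : k)
        (Submodule.mem_iSup_of_mem (Nat.cast_ne_zero.2 (by omega)) ?_))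
      rw [Module.End.mem_eigenspace_iff]
      refine (x.delta_homotopy_zero F hτ).trans ?_
      rw [x.euler_words hF, map_smul, LinearMap.smul_apply]
  obtain ⟨_, ⟨τ, rfl⟩, s', hs', rfl⟩ := Submodule.mem_sup.1 (h1 hs)
  obtain ⟨w, -, rfl⟩ := nonzeroPart_surj hs'
  -- The element N w is a boundary, so the augmentation sees only 1 ⊗ τ, whose image is the function
  -- represented by τ.
  have h2 : M.augSections U (N w) = 0 := LinearMap.congr_fun x.augSections_delta (x.homotopy 0 w)
  rw [map_add, h2, add_zero] at h
  refine ⟨x.homotopy 0 w, ?_⟩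
  rw [polyBody_eq_zero (τ := τ) h, map_zero]
  exact (zero_add (N w)).symm

end Coordinates

theorem augSections_surjective (U : Opens M.space) : Function.Surjective (M.augSections U) := by
  intro f
  induction f using M.parity_induction with
  | hom j f hf =>
    have hm : M.pFn hf ∈ M.polyDeg U 0 j := Submodule.subset_span ⟨f, hf, rfl⟩
    refine ⟨M.spencerMk 1 (M.polyDeg_le U 0 j hm), ?_⟩
    rw [augSections_mk, polyBody_pFn]
    rfl
  | add f g hf hg =>
    obtain ⟨s, rfl⟩ := hf
    obtain ⟨t, rfl⟩ := hg
    exact ⟨s + t, map_add _ _ _⟩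

end Exactness

end Superspace

namespace Superspace

variable {k : Type u} [Field k] (M : Superspace k)

/-! ### Restriction -/

section Restriction

theorem polyRes_pFn {U V : Opens M.space} (h : V ≤ U) {i : ZMod 2} {f : M.Fn U}
    (hf : f ∈ M.parity U i) : M.polyRes h (M.pFn hf) = M.pFn (M.parity_res h hf) :=
  M.polyLift_gen _ _ _

theorem polyRes_pVf {U V : Opens M.space} (h : V ≤ U) {i : ZMod 2} {X : M.LocalEnd U}
    (hX : X ∈ M.vecField U i) : M.polyRes h (M.pVf hX) = M.pVf (M.endRes_mem h hX) :=
  M.polyLift_gen _ _ _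

/-- Contractions are defined on each open set separately from generators; compatibility with
restriction follows from the Leibniz rule by induction on the degree. -/
theorem polyRes_contract {U V : Opens M.space} (h : V ≤ U) {l t : ZMod 2} {g : M.Fn U}
    (hg : g ∈ M.parity U l) {n : ℕ} {τ : M.Poly U} (hτ : τ ∈ M.polyDeg U n t) :
    M.polyRes h (M.contract hg τ) =
      M.contract (M.parity_res h hg : M.res h g ∈ M.parity V l) (M.polyRes h τ) := by
  induction n generalizing t τ with
  | zero =>
    rw [M.contract_polyPow_zero hg (M.polyDeg_le U _ _ hτ), map_zero]
    exact (M.contract_polyPow_zero _ (M.polyDeg_le V _ _ (M.polyRes_mem_deg h hτ))).symm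
  | succ n ih =>
    induction hτ using Submodule.span_induction with
    | mem y hy =>
      obtain ⟨i, t', X, hX, τ, rfl, hτ, rfl⟩ := hy
      have h1 : M.pFn (M.parity_res h (M.ev_mem hX hg)) = M.pFn (M.ev_mem (M.endRes_mem h hX)
          (M.parity_res h hg : M.res h g ∈ M.parity V l)) := M.pFn_congr _ _ rfl (M.res_ev h X g)
      rw [map_mul (M.polyRes h), polyRes_pVf, contract_pVf_mul, contract_pVf_mul, map_add, map_zsmul, map_zsmul,
        map_mul, map_mul, ih hτ, polyRes_pFn, polyRes_pVf, h1]
    | zero => simp only [map_zero]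
    | add x y _ _ hx hy => simp only [map_add, hx, hy]
    | smul c x _ hx => simp only [map_smul, hx]

theorem endRes_bracket {U V : Opens M.space} (h : V ≤ U) (i j : ZMod 2) (X Y : M.LocalEnd U) :
    M.endRes h (M.bracket i j X Y) = M.bracket i j (M.endRes h X) (M.endRes h Y) := by
  rw [bracket, bracket, map_sub, map_zsmul, map_mul, map_mul]

theorem polyRes_lieDeriv {U V : Opens M.space} (h : V ≤ U) {l t : ZMod 2} {Y : M.LocalEnd U}
    (hY : Y ∈ M.vecField U l) {n : ℕ} {τ : M.Poly U} (hτ : τ ∈ M.polyDeg U n t) :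
    M.polyRes h (M.lieDeriv hY τ) = M.lieDeriv (M.endRes_mem h hY) (M.polyRes h τ) := by
  induction n generalizing t τ with
  | zero =>
    induction hτ using Submodule.span_induction with
    | mem y hy =>
      obtain ⟨f, hf, rfl⟩ := hy
      rw [lieDeriv_pFn, polyRes_pFn, polyRes_pFn, lieDeriv_pFn]
      exact M.pFn_congr _ _ rfl (M.res_ev h Y f)
    | zero => simp only [map_zero]
    | add x y _ _ hx hy => simp only [map_add, hx, hy]
    | smul c x _ hx => simp only [map_smul, hx]
  | succ n ih =>
    induction hτ using Submodule.span_induction with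
    | mem y hy =>
      obtain ⟨i, t', X, hX, τ, rfl, hτ, rfl⟩ := hy
      have h1 : M.pVf (M.endRes_mem h (M.bracket_mem hY hX)) =
          M.pVf (M.bracket_mem (M.endRes_mem h hY) (M.endRes_mem h hX)) :=
        M.pVf_congr _ _ rfl (M.endRes_bracket h _ _ Y X)
      rw [map_mul (M.polyRes h), polyRes_pVf, lieDeriv_pVf_mul, lieDeriv_pVf_mul, map_add, map_zsmul,
        map_mul, map_mul, ih hτ, polyRes_pVf, polyRes_pVf, h1]
    | zero => simp only [map_zero]
    | add x y _ _ hx hy => simp only [map_add, hx, hy]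
    | smul c x _ hx => simp only [map_smul, hx]

variable {M}
variable {U : Opens M.space} {p q : ℕ} (x : M.Coordinates U p q)

/-- The restriction of local coordinates to a smaller open set. -/
def Coordinates.restrict {V : Opens M.space} (h : V ≤ U) : M.Coordinates V p q where
  x a := M.res h (x.x a)
  x_mem a := M.parity_res h (x.x_mem a)
  partialD a := M.endRes h (x.partialD a)
  partial_mem a := M.endRes_mem h (x.partial_mem a)
  partial_self a := by rw [← res_ev, x.partial_self, map_one]
  partial_ne a b hab := by rw [← res_ev, x.partial_ne a b hab, map_zero]
  span W hW i X hX := by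
    simp only [res_res]
    exact x.span W (hW.trans h) i X hX

theorem spencerRes_tmul {V : Opens M.space} (h : V ≤ U) (n : ℕ) (F : M.diffOp U)
    (τ : M.polyPow U n) : M.spencerRes h n (M.spencerTmul U n F τ) =
      M.spencerTmul V n (M.diffOpRes h F) (M.polyPowRes h n τ) := rfl

namespace Coordinates

theorem spencerForm_res {V : Opens M.space} (h : V ≤ U) {n : ℕ} (F : M.diffOp U) {t : ZMod 2}
    {τ : M.polyPow U (n + 1)} (hτ : τ ∈ M.homog U (n + 1) t) :
    M.spencerRes h n (x.spencerForm n F τ) =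
      (x.restrict h).spencerForm n (M.diffOpRes h F) (M.polyPowRes h (n + 1) τ) := by
  rw [spencerForm_apply, spencerForm_apply, map_sum]
  refine Finset.sum_congr rfl fun a _ => ?_
  rw [map_sub, spencerRes_tmul, spencerRes_tmul]
  have h1 : M.polyPowRes h n (M.contractPow (x.x_mem a) n τ) =
      M.contractPow ((x.restrict h).x_mem a) n (M.polyPowRes h (n + 1) τ) :=
    Subtype.ext (M.polyRes_contract h (x.x_mem a) (Submodule.mem_comap.1 hτ))
  have h2 : M.polyPowRes h n (M.contractPow (x.x_mem a) n (M.liePow (x.partial_mem a) (n + 1) τ)) =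
      M.contractPow ((x.restrict h).x_mem a) n
        (M.liePow ((x.restrict h).partial_mem a) (n + 1) (M.polyPowRes h (n + 1) τ)) := by
    refine Subtype.ext ?_
    refine (M.polyRes_contract h (x.x_mem a)
      (Submodule.mem_comap.1 (M.liePow_mem (x.partial_mem a) hτ))).trans ?_
    exact congrArg _ (M.polyRes_lieDeriv h (x.partial_mem a) (Submodule.mem_comap.1 hτ))
  rw [h1, h2]
  congr 3

theorem delta_res {V : Opens M.space} (h : V ≤ U) (n : ℕ) :
    M.spencerRes h n ∘ₗ x.delta n = (x.restrict h).delta n ∘ₗ M.spencerRes h (n + 1) := by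
  refine M.spencer_hom_ext_homog fun F t τ hτ => ?_
  have hτ' : M.polyPowRes h (n + 1) τ ∈ M.homog V (n + 1) t :=
    M.polyRes_mem_deg h (Submodule.mem_comap.1 hτ)
  rw [LinearMap.comp_apply, LinearMap.comp_apply, x.delta_tmul F hτ, map_zsmul,
    x.spencerForm_res h F hτ, spencerRes_tmul, delta_tmul _ _ hτ']

end Coordinates

theorem spencerRes_mem_genSections {V : Opens M.space} (h : V ≤ U) {n : ℕ}
    {s : M.SpencerSections U n} (hs : s ∈ M.genSections U n) :
    M.spencerRes h n s ∈ M.genSections V n := by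
  have : M.genSections U n ≤ (M.genSections V n).comap (M.spencerRes h n) := by
    refine Submodule.span_le.2 ?_
    rintro _ ⟨F, τ, hF, rfl⟩
    exact Submodule.subset_span ⟨_, _, M.endRes_mem_gen h hF, rfl⟩
  exact this hs

/-- Every section of the tensor products is locally generated by operators which are polynomials
in functions and vector fields. -/
theorem exists_genSections {n : ℕ} (s : M.SpencerSections U n) {y : M.space} (hy : y ∈ U) :
    ∃ (V : Opens M.space) (h : V ≤ U), y ∈ V ∧ M.spencerRes h n s ∈ M.genSections V n := by
  obtain ⟨s, rfl⟩ := (M.balanceRel U n).mkQ_surjective s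
  induction s using TensorProduct.induction_on with
  | zero => exact ⟨U, le_rfl, hy, by rw [map_zero, map_zero]; exact zero_mem _⟩
  | tmul F τ =>
    obtain ⟨V, h, hyV, hF⟩ := F.2 y hy
    exact ⟨V, h, hyV, Submodule.subset_span ⟨_, _, hF, rfl⟩⟩
  | add s t hs ht =>
    obtain ⟨V, h, hyV, hs⟩ := hs
    obtain ⟨W, h', hyW, ht⟩ := ht
    refine ⟨V ⊓ W, inf_le_left.trans h, ⟨hyV, hyW⟩, ?_⟩
    rw [map_add, map_add]
    refine add_mem ?_ ?_
    · have := spencerRes_mem_genSections (inf_le_left : V ⊓ W ≤ V) hs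
      rwa [← LinearMap.comp_apply, spencerRes_comp] at this
    · have := spencerRes_mem_genSections (inf_le_right : V ⊓ W ≤ W) ht
      rwa [← LinearMap.comp_apply, spencerRes_comp] at this

end Restriction

end Superspace

namespace Superspace

variable {k : Type u} [Field k] (M : Superspace k)

/-! ### Sheaves -/

section Sheaves

/-- Exactness of sheaves of modules can be checked locally on sections. -/
theorem exact_of_locally_exact {X : TopCat.{u}}
    (S : ShortComplex (TopCat.Sheaf (ModuleCat.{u} k) X))
    (h : ∀ (U : Opens X) (s : S.X₂.presheaf.obj (op U)), (S.g.hom.app (op U)).hom s = 0 →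
      ∀ y ∈ U, ∃ (V : Opens X) (hV : V ≤ U) (t : S.X₁.presheaf.obj (op V)), y ∈ V ∧
        (S.f.hom.app (op V)).hom t = (S.X₂.presheaf.map (homOfLE hV).op).hom s) :
    S.Exact := by
  rw [TopCat.Sheaf.exact_iff_stalkFunctor_map_exact]
  intro y
  rw [ShortComplex.moduleCat_exact_iff]
  intro s hs
  obtain ⟨U, hyU, s, rfl⟩ := TopCat.Presheaf.exists_germ_eq S.X₂.presheaf s
  have hs' : (S.X₃.presheaf.germ U y hyU).hom ((S.g.hom.app (op U)).hom s) =
      (S.X₃.presheaf.germ U y hyU).hom 0 := by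
    rw [map_zero]
    exact (TopCat.Presheaf.stalkFunctor_map_germ_apply U y hyU S.g.hom s).symm.trans hs
  -- A germ mapped to zero is represented by a section that is mapped to zero on a smaller
  -- neighbourhood, where the hypothesis applies.
  obtain ⟨W, hyW, iU, iV, e⟩ := TopCat.Presheaf.germ_eq S.X₃.presheaf y hyU hyU _ _ hs'
  have e' : (S.g.hom.app (op W)).hom ((S.X₂.presheaf.map iU.op).hom s) = 0 := by
    have := congrArg (fun φ => φ.hom s) (S.g.hom.naturality iU.op)
    refine this.trans (e.trans (map_zero _))
  obtain ⟨V, hV, t, hyV, ht⟩ := h W _ e' y hyW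
  refine ⟨(S.X₁.presheaf.germ V y hyV).hom t, ?_⟩
  refine (TopCat.Presheaf.stalkFunctor_map_germ_apply V y hyV S.f.hom t).trans ?_
  refine (congrArg (S.X₂.presheaf.germ V y hyV).hom ht).trans ?_
  refine (TopCat.Presheaf.germ_res_apply S.X₂.presheaf (homOfLE hV) y hyV _).trans ?_
  exact TopCat.Presheaf.germ_res_apply S.X₂.presheaf iU y hyW s

/-- The section of the universal Spencer sheaf defined by an element of the tensor product. -/
noncomputable def toSections (U : Opens M.space) (n : ℕ) :
    M.SpencerSections U n →ₗ[k] (M.spencerSheaf n).presheaf.obj (op U) :=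
  ((toSheafify (Opens.grothendieckTopology M.space) (M.spencerPresheaf n)).app (op U)).hom

theorem toSections_res {U V : Opens M.space} (h : V ≤ U) (n : ℕ) (s : M.SpencerSections U n) :
    ((M.spencerSheaf n).presheaf.map (homOfLE h).op).hom (M.toSections U n s) =
      M.toSections V n (M.spencerRes h n s) :=
  (congrArg (fun φ => φ.hom s) ((toSheafify (Opens.grothendieckTopology M.space)
    (M.spencerPresheaf n)).naturality (homOfLE h).op)).symm

theorem exists_toSections {U : Opens M.space} {n : ℕ} (s : (M.spencerSheaf n).presheaf.obj (op U))
    {y : M.space} (hy : y ∈ U) : ∃ (V : Opens M.space) (h : V ≤ U) (t : M.SpencerSections V n),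
      y ∈ V ∧ M.toSections V n t = ((M.spencerSheaf n).presheaf.map (homOfLE h).op).hom s := by
  have h1 : Presheaf.IsLocallySurjective (Opens.grothendieckTopology M.space)
    (toSheafify (Opens.grothendieckTopology M.space) (M.spencerPresheaf n)) := inferInstance
  obtain ⟨V, i, ⟨t, ht⟩, hyV⟩ := h1.imageSieve_mem s y hy
  exact ⟨V, i.le, t, hyV, ht⟩

/-- A tensor that becomes zero in the associated sheaf is zero only after shrinking the open set. -/
theorem exists_res_eq_zero {U : Opens M.space} {n : ℕ} {s : M.SpencerSections U n}
    (hs : M.toSections U n s = 0) {y : M.space} (hy : y ∈ U) :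
    ∃ (V : Opens M.space) (h : V ≤ U), y ∈ V ∧ M.spencerRes h n s = 0 := by
  have h1 : Presheaf.IsLocallyInjective (Opens.grothendieckTopology M.space)
    (toSheafify (Opens.grothendieckTopology M.space) (M.spencerPresheaf n)) := inferInstance
  obtain ⟨V, i, e, hyV⟩ := h1.equalizerSieve_mem (X := op U) s 0
    (hs.trans (map_zero (M.toSections U n)).symm) y hy
  exact ⟨V, i.le, hyV, e.trans (map_zero (M.spencerRes i.le n))⟩

variable {M}

theorem coordinates_isBasis {p q : ℕ}
    (hloc : ∀ y : M.space, ∃ U : Opens M.space, y ∈ U ∧ Nonempty (M.Coordinates U p q)) :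
    Opens.IsBasis (Set.range fun i : Σ U, M.Coordinates U p q => i.1) := by
  rw [Opens.isBasis_iff_nbhd]
  intro U y hy
  obtain ⟨V, hyV, ⟨x⟩⟩ := hloc y
  exact ⟨U ⊓ V, ⟨⟨_, x.restrict inf_le_right⟩, rfl⟩, ⟨hy, hyV⟩, inf_le_left⟩

/-- Morphisms from an associated sheaf to a sheaf are determined on the presheaf, and there on a
basis of open sets. -/
theorem spencerSheaf_hom_ext {p q : ℕ}
    (hloc : ∀ y : M.space, ∃ U : Opens M.space, y ∈ U ∧ Nonempty (M.Coordinates U p q))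
    {n : ℕ} {G : TopCat.Sheaf (ModuleCat.{u} k) M.space} {φ ψ : M.spencerSheaf n ⟶ G}
    (h : ∀ (U : Opens M.space) (_ : M.Coordinates U p q) (s : M.SpencerSections U n),
      (φ.hom.app (op U)).hom (M.toSections U n s) = (ψ.hom.app (op U)).hom (M.toSections U n s)) :
    φ = ψ := by
  refine Sheaf.hom_ext (sheafify_hom_ext _ _ _ G.property ?_)
  refine TopCat.Sheaf.hom_ext (B := fun i : Σ U, M.Coordinates U p q => i.1)
    (F := M.spencerPresheaf n) (F' := G) (coordinates_isBasis hloc) fun i => ?_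
  exact ModuleCat.hom_ext (LinearMap.ext (h i.1 i.2))

end Sheaves

end Superspace

namespace Superspace

variable {k : Type u} [Field k] (M : Superspace k)

/-! ### The global Spencer differential and its homology -/

section SpencerDifferential

/-- In degree zero everything is a cycle, so the homology is the cokernel of d. Exactness and
surjectivity make F another cokernel, and the comparison of cokernels respects the projections. -/
theorem exists_homology_zero_iso_of_exact {C : Type*} [Category* C] [Abelian C]
    (K : ChainComplex C ℕ) {F : C} (a : K.X 0 ⟶ F) [Epi a] (w : K.d 1 0 ≫ a = 0)
    (h : (ShortComplex.mk _ _ w).Exact) :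
    ∃ e : K.homology 0 ≅ F, K.homologyπ 0 ≫ e.hom = K.iCycles 0 ≫ a := by
  have hc : K.toCycles 1 0 ≫ K.iCycles 0 ≫ a = 0 := by
    rw [← Category.assoc, K.toCycles_i, w]
  have hex : (ShortComplex.mk _ _ hc).Exact := by
    refine ShortComplex.exact_of_iso (ShortComplex.isoMk (S₁ := ShortComplex.mk _ _ w)
      (S₂ := ShortComplex.mk _ _ hc) (Iso.refl (K.X 1)) (asIso (K.iCycles 0)).symm
      (Iso.refl F) ?_ ?_) h
    · change 𝟙 _ ≫ K.toCycles 1 0 = K.d 1 0 ≫ inv (K.iCycles 0)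
      rw [IsIso.eq_comp_inv, Category.id_comp, K.toCycles_i]
    · change inv (K.iCycles 0) ≫ K.iCycles 0 ≫ a = a ≫ 𝟙 _
      rw [IsIso.inv_hom_id_assoc, Category.comp_id]
  have : Epi (K.iCycles 0 ≫ a) := epi_comp _ _
  have hi : (ComplexShape.down ℕ).prev 0 = 1 := by simp
  exact ⟨(K.homologyIsCokernel 1 0 hi).coconePointUniqueUpToIso hex.gIsCokernel,
    (K.homologyIsCokernel 1 0 hi).comp_coconePointUniqueUpToIso_hom hex.gIsCokernel
      Limits.WalkingParallelPair.one⟩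

variable {M}

/-- The local differentials, as a morphism of presheaves on the basis of coordinate
neighbourhoods. -/
noncomputable def basisDelta (M : Superspace k) (p q n : ℕ) :
    (inducedFunctor fun i : Σ U, M.Coordinates U p q => i.1).op ⋙ M.spencerPresheaf (n + 1) ⟶
      (inducedFunctor fun i : Σ U, M.Coordinates U p q => i.1).op ⋙ (M.spencerSheaf n).1 where
  app i := ModuleCat.ofHom (M.toSections i.unop.1 n ∘ₗ i.unop.2.delta n)
  naturality i j f := by
    have h : j.unop.1 ≤ i.unop.1 := f.unop.hom.le
    refine ModuleCat.hom_ext (LinearMap.ext fun s => ?_)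
    change M.toSections j.unop.1 n (j.unop.2.delta n (M.spencerRes h (n + 1) s)) =
      ((M.spencerSheaf n).presheaf.map (homOfLE h).op).hom
        (M.toSections i.unop.1 n (i.unop.2.delta n s))
    refine Eq.trans ?_ (M.toSections_res h n _).symm
    refine congrArg _ (Eq.trans ?_ (congrArg (fun φ => φ s) (i.unop.2.delta_res h n)).symm)
    -- Morphisms of the index category are mere inclusions, so the coordinates attached to the
    -- smaller set are unrelated to the restricted ones. Naturality is exactly independence of the
    -- coordinates.
    rw [Coordinates.delta_unique _ (i.unop.2.restrict h)]
    rfl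

/-- The Spencer differential. -/
noncomputable def spencerDelta {p q : ℕ}
    (hloc : ∀ y : M.space, ∃ U : Opens M.space, y ∈ U ∧ Nonempty (M.Coordinates U p q)) (n : ℕ) :
    M.spencerSheaf (n + 1) ⟶ M.spencerSheaf n :=
  ⟨sheafifyLift (Opens.grothendieckTopology M.space)
    (TopCat.Sheaf.restrictHomEquivHom (M.spencerPresheaf (n + 1)) (M.spencerSheaf n)
      (coordinates_isBasis hloc) (basisDelta M p q n)) (M.spencerSheaf n).property⟩

theorem spencerDelta_toSections {p q : ℕ}
    (hloc : ∀ y : M.space, ∃ U : Opens M.space, y ∈ U ∧ Nonempty (M.Coordinates U p q)) (n : ℕ)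
    {U : Opens M.space} (x : M.Coordinates U p q) (s : M.SpencerSections U (n + 1)) :
    ((spencerDelta hloc n).hom.app (op U)).hom (M.toSections U (n + 1) s) =
      M.toSections U n (x.delta n s) := by
  have h1 := toSheafify_sheafifyLift (Opens.grothendieckTopology M.space)
    (TopCat.Sheaf.restrictHomEquivHom (M.spencerPresheaf (n + 1)) (M.spencerSheaf n)
      (coordinates_isBasis hloc) (basisDelta M p q n)) (M.spencerSheaf n).property
  have h2 := TopCat.Sheaf.extend_hom_app (M.spencerPresheaf (n + 1)) (M.spencerSheaf n)
    (coordinates_isBasis hloc) (basisDelta M p q n) ⟨U, x⟩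
  have h3 := congrArg (fun φ => (φ.app (op U)).hom s) h1
  exact h3.trans (congrArg (fun φ => φ.hom s) h2)

theorem toSections_delta_tens {U : Opens M.space} {p q : ℕ} (x : M.Coordinates U p q) {n : ℕ}
    (F : M.diffOp U) {t : ZMod 2} {τ : M.Poly U} (hτ : τ ∈ M.polyDeg U (n + 1) t) :
    M.toSections U n (x.delta n (M.spencerMk F (M.polyDeg_le U _ _ hτ))) =
      koszulSign t • (∑ a, M.tens (x.mulPartial F a)
          (M.polyDeg_le U n _ (M.contract_mem (x.x_mem a) hτ))) -
      koszulSign t • (∑ a, M.tens F (M.polyDeg_le U n _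
          (M.contract_mem (x.x_mem a) (M.lieDeriv_mem (x.partial_mem a) hτ)))) := by
  rw [spencerMk_eq, x.delta_tmul F (t := t) (Submodule.mem_comap.2 hτ), map_zsmul,
    Coordinates.spencerForm_apply, map_sum, ← smul_sub, ← Finset.sum_sub_distrib]
  refine congrArg _ (Finset.sum_congr rfl fun a _ => ?_)
  rw [map_sub]
  rfl

/-- Replaces the defining formula on homogeneous tensors by the map `delta` on all elements of the
tensor product. Afterwards the sheaf morphism is used only through its local form. -/
theorem isSpencerDifferential_iff {p q : ℕ}
    (δ : ∀ n, M.spencerSheaf (n + 1) ⟶ M.spencerSheaf n) :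
    M.IsSpencerDifferential p q δ ↔ ∀ (n : ℕ) (U : Opens M.space) (x : M.Coordinates U p q)
      (s : M.SpencerSections U (n + 1)),
      ((δ n).hom.app (op U)).hom (M.toSections U (n + 1) s) = M.toSections U n (x.delta n s) := by
  constructor
  · intro h n U x s
    have : ((δ n).hom.app (op U)).hom ∘ₗ M.toSections U (n + 1) = M.toSections U n ∘ₗ x.delta n := by
      refine M.spencer_hom_ext_homog fun F t τ hτ => ?_
      exact (h n U x F t τ.1 (Submodule.mem_comap.1 hτ)).trans
        (toSections_delta_tens x F (Submodule.mem_comap.1 hτ)).symm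
    exact congrArg (fun φ => φ s) this
  · intro h n U x F t τ hτ
    exact (h n U x _).trans (toSections_delta_tens x F hτ)

theorem existsUnique_isSpencerDifferential {p q : ℕ}
    (hloc : ∀ y : M.space, ∃ U : Opens M.space, y ∈ U ∧ Nonempty (M.Coordinates U p q)) :
    ∃! δ : ∀ n, M.spencerSheaf (n + 1) ⟶ M.spencerSheaf n, M.IsSpencerDifferential p q δ := by
  refine ⟨spencerDelta hloc, (isSpencerDifferential_iff _).2 fun n U x s =>
    spencerDelta_toSections hloc n x s, fun δ hδ => funext fun n => ?_⟩
  refine spencerSheaf_hom_ext hloc fun U x s => ?_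
  rw [(isSpencerDifferential_iff _).1 hδ n U x, spencerDelta_toSections hloc n x]

variable {p q : ℕ} {δ : ∀ n, M.spencerSheaf (n + 1) ⟶ M.spencerSheaf n}

theorem IsSpencerDifferential.comp_eq_zero [CharZero k]
    (hloc : ∀ y : M.space, ∃ U : Opens M.space, y ∈ U ∧ Nonempty (M.Coordinates U p q))
    (h : M.IsSpencerDifferential p q δ) (n : ℕ) : δ (n + 1) ≫ δ n = 0 := by
  rw [isSpencerDifferential_iff] at h
  refine spencerSheaf_hom_ext hloc fun U x s => ?_
  change ((δ n).hom.app (op U)).hom (((δ (n + 1)).hom.app (op U)).hom _) = 0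
  rw [h (n + 1) U x, h n U x, ← LinearMap.comp_apply (x.delta n), x.delta_delta,
    LinearMap.zero_apply, map_zero]

theorem augmentation_toSections {U : Opens M.space} (s : M.SpencerSections U 0) :
    (M.augmentation.hom.app (op U)).hom (M.toSections U 0 s) = M.augSections U s := by
  have h1 := toSheafify_sheafifyLift (Opens.grothendieckTopology M.space)
    (P := M.spencerPresheaf 0) (Q := M.fnSheaf.obj)
    { app U := ModuleCat.ofHom (M.augSections U.unop)
      naturality _ _ i := ModuleCat.hom_ext (M.augSections_res i.unop.le).symm }
    M.fnSheaf.property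
  exact congrArg (fun φ => (φ.app (op U)).hom s) h1

theorem IsSpencerDifferential.comp_augmentation
    (hloc : ∀ y : M.space, ∃ U : Opens M.space, y ∈ U ∧ Nonempty (M.Coordinates U p q))
    (h : M.IsSpencerDifferential p q δ) : δ 0 ≫ M.augmentation = 0 := by
  rw [isSpencerDifferential_iff] at h
  refine spencerSheaf_hom_ext hloc fun U x s => ?_
  change (M.augmentation.hom.app (op U)).hom (((δ 0).hom.app (op U)).hom _) = 0
  rw [h 0 U x, augmentation_toSections, ← LinearMap.comp_apply, x.augSections_delta]
  rfl

/-- A section of the universal Spencer sheaf comes, near any point, from an element of a tensor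
product which is generated by polynomials in functions and vector fields, in coordinates. -/
theorem exists_coordinates_toSections
    (hloc : ∀ y : M.space, ∃ U : Opens M.space, y ∈ U ∧ Nonempty (M.Coordinates U p q))
    {U : Opens M.space} {n : ℕ} (s : (M.spencerSheaf n).presheaf.obj (op U)) {y : M.space}
    (hy : y ∈ U) : ∃ (V : Opens M.space) (h : V ≤ U) (_ : M.Coordinates V p q),
      y ∈ V ∧ ∃ t ∈ M.genSections V n,
        M.toSections V n t = ((M.spencerSheaf n).presheaf.map (homOfLE h).op).hom s := by
  obtain ⟨V, hV, t, hyV, ht⟩ := M.exists_toSections s hy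
  obtain ⟨W, hyW, ⟨x⟩⟩ := hloc y
  obtain ⟨V', hV', hyV', ht'⟩ := exists_genSections (M := M) t hyV
  refine ⟨V' ⊓ W, (inf_le_left.trans hV').trans hV, x.restrict inf_le_right, ⟨hyV', hyW⟩, _,
    spencerRes_mem_genSections inf_le_left ht', ?_⟩
  rw [← LinearMap.comp_apply (M.spencerRes _ _), spencerRes_comp, ← toSections_res, ht,
    ← ModuleCat.comp_apply, ← Functor.map_comp]
  rfl

theorem IsSpencerDifferential.exact_succ [CharZero k]
    (hloc : ∀ y : M.space, ∃ U : Opens M.space, y ∈ U ∧ Nonempty (M.Coordinates U p q))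
    (h : M.IsSpencerDifferential p q δ) (n : ℕ) :
    (ShortComplex.mk _ _ (h.comp_eq_zero hloc n)).Exact := by
  refine exact_of_locally_exact _ fun U s hs y hy => ?_
  obtain ⟨V, hV, x, hyV, t, ht, hts⟩ := exists_coordinates_toSections hloc s hy
  have h1 : M.toSections V n (x.delta n t) = 0 := by
    rw [← (isSpencerDifferential_iff _).1 h n V x, hts]
    refine (congrArg (fun φ => φ.hom s) ((δ n).hom.naturality (homOfLE hV).op)).trans ?_
    exact (congrArg ((M.spencerSheaf n).obj.map (homOfLE hV).op).hom hs).trans (map_zero _)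
  -- The vanishing in h1 takes place in the associated sheaf. On a smaller set the tensor itself
  -- vanishes, and exactness in the restricted coordinates applies.
  obtain ⟨W, hW, hyW, h2⟩ := M.exists_res_eq_zero h1 hyV
  rw [← LinearMap.comp_apply, x.delta_res hW, LinearMap.comp_apply] at h2
  obtain ⟨r, hr⟩ := (x.restrict hW).exact_succ (spencerRes_mem_genSections hW ht) h2
  refine ⟨W, hW.trans hV, M.toSections W _ r, hyW, ?_⟩
  refine ((isSpencerDifferential_iff _).1 h (n + 1) W (x.restrict hW) r).trans ?_
  rw [hr, ← toSections_res, hts, ← ModuleCat.comp_apply, ← Functor.map_comp]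
  rfl

theorem IsSpencerDifferential.exact_zero [CharZero k]
    (hloc : ∀ y : M.space, ∃ U : Opens M.space, y ∈ U ∧ Nonempty (M.Coordinates U p q))
    (h : M.IsSpencerDifferential p q δ) :
    (ShortComplex.mk (δ 0) M.augmentation (h.comp_augmentation hloc)).Exact := by
  refine exact_of_locally_exact _ fun U s hs y hy => ?_
  obtain ⟨V, hV, x, hyV, t, ht, hts⟩ := exists_coordinates_toSections hloc s hy
  -- No shrinking is needed, since the augmentation takes values in the structure sheaf itself.
  have h2 : M.augSections V t = 0 := by
    rw [← augmentation_toSections, hts]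
    refine (congrArg (fun φ => φ.hom s) (M.augmentation.hom.naturality (homOfLE hV).op)).trans ?_
    exact (congrArg (M.fnSheaf.obj.map (homOfLE hV).op).hom hs).trans (map_zero _)
  obtain ⟨r, hr⟩ := x.exact_zero ht h2
  refine ⟨V, hV, M.toSections V _ r, hyV, ?_⟩
  refine ((isSpencerDifferential_iff _).1 h 0 V x r).trans ?_
  rw [hr, hts]

instance augmentation_epi : Epi M.augmentation := by
  rw [← TopCat.Sheaf.isLocallySurjective_iff_epi, TopCat.Presheaf.isLocallySurjective_iff]
  intro U f y hy
  obtain ⟨s, hs⟩ := M.augSections_surjective U f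
  refine ⟨U, le_rfl, ⟨M.toSections U 0 s, ?_⟩, hy⟩
  refine (augmentation_toSections s).trans (hs.trans ?_)
  exact (M.res_self f).symm

theorem IsSpencerDifferential.isZero_homology_succ [CharZero k]
    (hloc : ∀ y : M.space, ∃ U : Opens M.space, y ∈ U ∧ Nonempty (M.Coordinates U p q))
    (h : M.IsSpencerDifferential p q δ) (hδ : ∀ n, δ (n + 1) ≫ δ n = 0) (n : ℕ) :
    Limits.IsZero ((M.spencerComplex δ hδ).homology (n + 1)) := by
  rw [← HomologicalComplex.exactAt_iff_isZero_homology,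
    HomologicalComplex.exactAt_iff' _ (n + 2) (n + 1) n (by simp) (by simp)]
  refine ShortComplex.exact_of_iso (ShortComplex.isoMk (Iso.refl (M.spencerSheaf (n + 2)))
    (Iso.refl (M.spencerSheaf (n + 1))) (Iso.refl (M.spencerSheaf n)) ?_ ?_) (h.exact_succ hloc n)
  · exact (Category.id_comp _).trans ((ChainComplex.of_d M.spencerSheaf δ (n + 1)).trans
      (Category.comp_id _).symm)
  · exact (Category.id_comp _).trans ((ChainComplex.of_d M.spencerSheaf δ n).trans (Category.comp_id _).symm)

theorem IsSpencerDifferential.exists_homology_zero_iso [CharZero k]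
    (hloc : ∀ y : M.space, ∃ U : Opens M.space, y ∈ U ∧ Nonempty (M.Coordinates U p q))
    (h : M.IsSpencerDifferential p q δ) (hδ : ∀ n, δ (n + 1) ≫ δ n = 0) :
    ∃ e : (M.spencerComplex δ hδ).homology 0 ≅ M.fnSheaf,
      (M.spencerComplex δ hδ).homologyπ 0 ≫ e.hom =
        (M.spencerComplex δ hδ).iCycles 0 ≫ M.augmentation := by
  have hd : (M.spencerComplex δ hδ).d 1 0 = δ 0 := ChainComplex.of_d M.spencerSheaf δ 0
  have w : (M.spencerComplex δ hδ).d 1 0 ≫ M.augmentation = 0 := by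
    rw [hd]
    exact h.comp_augmentation hloc
  have : Epi (X := (M.spencerComplex δ hδ).X 0) M.augmentation := augmentation_epi
  refine exists_homology_zero_iso_of_exact (M.spencerComplex δ hδ) M.augmentation w ?_
  refine ShortComplex.exact_of_iso (ShortComplex.isoMk (Iso.refl (M.spencerSheaf 1))
    (Iso.refl (M.spencerSheaf 0)) (Iso.refl M.fnSheaf) ?_ ?_) (h.exact_zero hloc)
  · exact (Category.id_comp _).trans (hd.trans (Category.comp_id _).symm)
  · exact (Category.id_comp _).trans (Category.comp_id _).symm

end SpencerDifferential

end Superspace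

namespace Superspace

variable {k : Type u} [Field k] (M : Superspace k)

/-! ### Contractions of the exterior algebra -/

section Contraction

variable {q : ℕ}

/-- Contraction is an odd superderivation of the exterior algebra. The induction adds two generators
at a time, so the parity stays fixed and the base cases are scalars and vectors. -/
theorem contractLeft_mem_and_mul (d : Module.Dual k (Fin q → k)) {j : ZMod 2} {l : Grassmann k q}
    (hl : l ∈ CliffordAlgebra.evenOdd (0 : QuadraticForm k (Fin q → k)) j) :
    CliffordAlgebra.contractLeft d l ∈
        CliffordAlgebra.evenOdd (0 : QuadraticForm k (Fin q → k)) (1 + j) ∧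
      ∀ l' : Grassmann k q, CliffordAlgebra.contractLeft d (l * l') =
        CliffordAlgebra.contractLeft d l * l' +
          koszulSign j • (l * CliffordAlgebra.contractLeft d l') := by
  have h1 : (1 : Grassmann k q) ∈ CliffordAlgebra.evenOdd (0 : QuadraticForm k (Fin q → k)) 0 :=
    SetLike.GradedOne.one_mem
  induction l, hl using CliffordAlgebra.evenOdd_induction with
  | range_ι_pow v hv =>
    rcases parity_cases j with rfl | rfl
    · obtain ⟨r, rfl⟩ := Submodule.mem_one.1 (by simpa using hv)
      refine ⟨?_, fun l' => ?_⟩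
      · rw [CliffordAlgebra.contractLeft_algebraMap]
        exact zero_mem _
      · rw [CliffordAlgebra.contractLeft_algebraMap, CliffordAlgebra.contractLeft_algebraMap_mul,
          koszulSign_zero, one_smul, zero_mul, zero_add]
    · obtain ⟨m, rfl⟩ : ∃ m, CliffordAlgebra.ι 0 m = v := by simpa [ZMod.val_one] using hv
      refine ⟨?_, fun l' => ?_⟩
      · rw [CliffordAlgebra.contractLeft_ι, Algebra.algebraMap_eq_smul_one]
        exact Submodule.smul_mem _ _ h1
      · rw [CliffordAlgebra.contractLeft_ι_mul, CliffordAlgebra.contractLeft_ι, koszulSign_one,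
          neg_one_smul, ← sub_eq_add_neg, Algebra.smul_def]
  | add x y hx hy ihx ihy =>
    refine ⟨by rw [map_add]; exact add_mem ihx.1 ihy.1, fun l' => ?_⟩
    rw [add_mul, map_add, ihx.2, ihy.2, map_add, add_mul, add_mul, smul_add]
    abel
  | ι_mul_ι_mul m₁ m₂ x hx ih =>
    have hm : ∀ m : Fin q → k, ∀ {i : ZMod 2} {y : Grassmann k q},
        y ∈ CliffordAlgebra.evenOdd (0 : QuadraticForm k (Fin q → k)) i →
        CliffordAlgebra.ι 0 m * y ∈
          CliffordAlgebra.evenOdd (0 : QuadraticForm k (Fin q → k)) (1 + i) := fun m _ _ hy =>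
      SetLike.GradedMul.mul_mem (CliffordAlgebra.ι_mem_evenOdd_one _ m) hy
    have e : ∀ i : ZMod 2, 1 + (1 + i) = i := by decide
    refine ⟨?_, fun l' => ?_⟩
    · rw [mul_assoc, CliffordAlgebra.contractLeft_ι_mul, CliffordAlgebra.contractLeft_ι_mul]
      refine sub_mem (Submodule.smul_mem _ _ (hm m₂ hx)) ?_
      rw [mul_sub, mul_smul_comm]
      refine sub_mem (Submodule.smul_mem _ _ (hm m₁ hx)) ?_
      have := hm m₁ (hm m₂ ih.1)
      rwa [e] at this
    · simp only [mul_assoc, CliffordAlgebra.contractLeft_ι_mul, ih.2, mul_sub, sub_mul, mul_add,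
        smul_mul_assoc, mul_smul_comm]
      abel

end Contraction

end Superspace

namespace Superspace

variable {k : Type u} [Field k] (M : Superspace k)

/-! ### Coordinates in split charts -/

section EvenCoordinates

/-- Restriction of sections of a presheaf of commutative algebras. -/
def comRes {Z : TopCat.{u}} (A : TopCat.Presheaf (CommAlgCat.{u} k) Z) {V W : Opens Z}
    (h : W ≤ V) : A.obj (op V) →ₐ[k] A.obj (op W) :=
  (A.map (homOfLE h).op).hom

theorem comRes_comRes {Z : TopCat.{u}} (A : TopCat.Presheaf (CommAlgCat.{u} k) Z)
    {V W O : Opens Z} (h : W ≤ V) (h' : O ≤ W) (f : A.obj (op V)) :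
    comRes A h' (comRes A h f) = comRes A (h'.trans h) f := by
  have : A.map (homOfLE (h'.trans h)).op = A.map (homOfLE h).op ≫ A.map (homOfLE h').op := by
    rw [← Functor.map_comp]; rfl
  simp [comRes, this]

theorem comRes_self {Z : TopCat.{u}} (A : TopCat.Presheaf (CommAlgCat.{u} k) Z)
    {V : Opens Z} (h : V ≤ V) (f : A.obj (op V)) : comRes A h f = f := by
  have : A.map (homOfLE h).op = 𝟙 _ := by
    rw [← A.map_id]; rfl
  unfold comRes
  rw [this]
  rfl

/-- Coordinates `z_1, …, z_p` for a presheaf of commutative algebras over an open set, with the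
partial derivatives `∂ / ∂ z_i`; natural derivations are determined by their values on the `z_i`. -/
structure EvenCoordinates {Z : TopCat.{u}} (A : TopCat.Presheaf (CommAlgCat.{u} k) Z) (O : Opens Z)
    (p : ℕ) where
  z : Fin p → A.obj (op O)
  d : Fin p → ∀ V : Opens Z, V ≤ O → (A.obj (op V) →ₗ[k] A.obj (op V))
  d_mul : ∀ i V hV f g, d i V hV (f * g) = d i V hV f * g + f * d i V hV g
  d_res : ∀ i V hV W (h : W ≤ V) f, comRes A h (d i V hV f) = d i W (h.trans hV) (comRes A h f)
  d_self : ∀ i, d i O le_rfl (z i) = 1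
  d_ne : ∀ i j, i ≠ j → d i O le_rfl (z j) = 0
  eq_zero : ∀ (V : Opens Z) (hV : V ≤ O)
    (D : ∀ W : Opens Z, W ≤ V → (A.obj (op W) →ₗ[k] A.obj (op W))),
    (∀ W hW f g, D W hW (f * g) = D W hW f * g + f * D W hW g) →
    (∀ W hW W' (h : W' ≤ W) f, comRes A h (D W hW f) = D W' (h.trans hW) (comRes A h f)) →
    (∀ i, D V le_rfl (comRes A hV (z i)) = 0) → ∀ f, D V le_rfl f = 0

theorem EvenCoordinates.d_one {Z : TopCat.{u}} {A : TopCat.Presheaf (CommAlgCat.{u} k) Z}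
    {O : Opens Z} {p : ℕ} (e : EvenCoordinates A O p) (i : Fin p) {V : Opens Z} (hV : V ≤ O) :
    e.d i V hV 1 = 0 := by
  have := e.d_mul i V hV 1 1
  simpa using this

end EvenCoordinates

section SplitChart

variable {M}
variable {U : Opens M.space} {Z : TopCat.{u}} {A : TopCat.Presheaf (CommAlgCat.{u} k) Z} {q : ℕ}
variable (c : M.SplitChart U Z A q)

namespace SplitChart

/-- The image of an open set under a chart. -/
abbrev im (V : Opens M.space) : Opens Z := M.imageOpen c.isOpenEmbedding V

/-- The inverse image of an open set under a chart. -/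
def preim (O : Opens Z) : Opens M.space :=
  ⟨Subtype.val '' (c.map ⁻¹' (O : Set Z)),
    U.isOpen.isOpenMap_subtype_val _ (O.isOpen.preimage c.isOpenEmbedding.continuous)⟩

theorem preim_le_of_le {O : Opens Z} {V : Opens M.space} (h : O ≤ c.im V) : c.preim O ≤ V := by
  rintro _ ⟨y, hy, rfl⟩
  obtain ⟨y', hy', e⟩ := h hy
  rw [← c.isOpenEmbedding.injective e]
  exact hy'

theorem preim_mono {O O' : Opens Z} (h : O' ≤ O) : c.preim O' ≤ c.preim O :=
  Set.image_mono (Set.preimage_mono h)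

theorem im_preim_le (O : Opens Z) : c.im (c.preim O) ≤ O := by
  rintro _ ⟨y, ⟨y', hy', e⟩, rfl⟩
  rw [← Subtype.ext e]
  exact hy'

/-- The inclusion opposite to `im_preim_le` needs O to lie in the image of the chart, which need not
be all of Z. -/
theorem le_im_preim {O : Opens Z} {V : Opens M.space} (h : O ≤ c.im V) : O ≤ c.im (c.preim O) := by
  intro w hw
  obtain ⟨y, hy, rfl⟩ := h hw
  exact ⟨y, ⟨y, hw, rfl⟩, rfl⟩

theorem mem_preim {O : Opens Z} {y : M.space} (hy : y ∈ U) (h : c.map ⟨y, hy⟩ ∈ O) :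
    y ∈ c.preim O := ⟨⟨y, hy⟩, h, rfl⟩

theorem preim_le (O : Opens Z) : c.preim O ≤ U := by
  rintro _ ⟨y, -, rfl⟩
  exact y.2

/-- Restriction in the split model. -/
noncomputable def modelRes {V W : Opens M.space} (h : W ≤ V) :
    A.obj (op (c.im V)) ⊗[k] Grassmann k q →ₐ[k] A.obj (op (c.im W)) ⊗[k] Grassmann k q :=
  Algebra.TensorProduct.map (comRes A (M.imageOpen_mono c.isOpenEmbedding h)) (AlgHom.id k _)

theorem iso_res {V W : Opens M.space} (hV : V ≤ U) (h : W ≤ V) (f : M.Fn V) :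
    c.iso W (h.trans hV) (M.res h f) = c.modelRes h (c.iso V hV f) :=
  c.naturality V hV W h f

theorem res_iso_symm {V W : Opens M.space} (hV : V ≤ U) (h : W ≤ V)
    (t : A.obj (op (c.im V)) ⊗[k] Grassmann k q) :
    M.res h ((c.iso V hV).symm t) = (c.iso W (h.trans hV)).symm (c.modelRes h t) := by
  rw [AlgEquiv.eq_symm_apply, c.iso_res hV, AlgEquiv.apply_symm_apply]

theorem iso_mem {V : Opens M.space} (hV : V ≤ U) {i : ZMod 2} {f : M.Fn V} :
    c.iso V hV f ∈ splitParity (A.obj (op (c.im V))) q i ↔ f ∈ M.parity V i := by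
  rw [← c.map_parity V hV i, Submodule.mem_map]
  constructor
  · rintro ⟨g, hg, e⟩
    rwa [← (c.iso V hV).injective e]
  · exact fun h => ⟨f, h, rfl⟩

theorem symm_mem {V : Opens M.space} (hV : V ≤ U) {i : ZMod 2}
    {t : A.obj (op (c.im V)) ⊗[k] Grassmann k q} (ht : t ∈ splitParity (A.obj (op (c.im V))) q i) :
    (c.iso V hV).symm t ∈ M.parity V i := by
  rw [← c.iso_mem hV, AlgEquiv.apply_symm_apply]
  exact ht

theorem tmul_mem_splitParity {B : Type u} [CommRing B] [Algebra k B] (b : B) {i : ZMod 2}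
    {l : Grassmann k q} (hl : l ∈ CliffordAlgebra.evenOdd (0 : QuadraticForm k (Fin q → k)) i) :
    b ⊗ₜ[k] l ∈ splitParity B q i := Submodule.subset_span ⟨b, l, hl, rfl⟩

/-- A local endomorphism given in a chart. -/
noncomputable def localEnd {V₀ : Opens M.space} (h₀ : V₀ ≤ U)
    (T : ∀ V : Opens M.space, V ≤ V₀ → (A.obj (op (c.im V)) ⊗[k] Grassmann k q →ₗ[k]
      A.obj (op (c.im V)) ⊗[k] Grassmann k q))
    (hT : ∀ V hV W (h : W ≤ V) t, c.modelRes h (T V hV t) = T W (h.trans hV) (c.modelRes h t)) :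
    M.LocalEnd V₀ :=
  ⟨fun V => (c.iso V.1 (V.2.trans h₀)).symm.toLinearMap ∘ₗ T V.1 V.2 ∘ₗ
    (c.iso V.1 (V.2.trans h₀)).toLinearMap, fun V W h f => by
      change M.res h ((c.iso V.1 _).symm (T V.1 V.2 (c.iso V.1 _ f))) =
        (c.iso W.1 _).symm (T W.1 W.2 (c.iso W.1 _ (M.res h f)))
      rw [res_iso_symm, hT, iso_res]⟩

/-- Both the parity condition and the Leibniz rule are additive in each argument, so pure tensors
with homogeneous exterior factor suffice. -/
theorem localEnd_mem {V₀ : Opens M.space} (h₀ : V₀ ≤ U)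
    (T : ∀ V : Opens M.space, V ≤ V₀ → (A.obj (op (c.im V)) ⊗[k] Grassmann k q →ₗ[k]
      A.obj (op (c.im V)) ⊗[k] Grassmann k q))
    (hT : ∀ V hV W (h : W ≤ V) t, c.modelRes h (T V hV t) = T W (h.trans hV) (c.modelRes h t))
    {i : ZMod 2}
    (h : ∀ V hV (a : A.obj (op (c.im V))) (j : ZMod 2) (l : Grassmann k q),
      l ∈ CliffordAlgebra.evenOdd (0 : QuadraticForm k (Fin q → k)) j →
      T V hV (a ⊗ₜ l) ∈ splitParity _ q (i + j) ∧ ∀ b l', T V hV (a ⊗ₜ l * b ⊗ₜ l') =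
        T V hV (a ⊗ₜ l) * b ⊗ₜ l' + koszulSign (i * j) • (a ⊗ₜ l * T V hV (b ⊗ₜ l'))) :
    c.localEnd h₀ T hT ∈ M.vecField V₀ i := by
  have key : ∀ V hV j t, t ∈ splitParity (A.obj (op (c.im V))) q j →
      T V hV t ∈ splitParity _ q (i + j) ∧ ∀ s, T V hV (t * s) =
        T V hV t * s + koszulSign (i * j) • (t * T V hV s) := by
    intro V hV j t ht
    induction ht using Submodule.span_induction with
    | mem y hy =>
      obtain ⟨a, l, hl, rfl⟩ := hy
      refine ⟨(h V hV a j l hl).1, fun s => ?_⟩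
      induction s using TensorProduct.induction_on with
      | zero => simp only [mul_zero, map_zero, smul_zero, add_zero]
      | tmul b l' => exact (h V hV a j l hl).2 b l'
      | add x y hx hy =>
        rw [mul_add, map_add, hx, hy, map_add, mul_add, mul_add, smul_add]
        abel
    | zero =>
      refine ⟨by rw [map_zero]; exact zero_mem _, fun s => ?_⟩
      simp only [zero_mul, map_zero, smul_zero, add_zero]
    | add x y _ _ hx hy =>
      refine ⟨by rw [map_add]; exact add_mem hx.1 hy.1, fun s => ?_⟩
      rw [add_mul, map_add, hx.2, hy.2, map_add, add_mul, add_mul, smul_add]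
      abel
    | smul r x _ hx =>
      refine ⟨by rw [map_smul]; exact Submodule.smul_mem _ _ hx.1, fun s => ?_⟩
      rw [smul_mul_assoc, map_smul, hx.2, map_smul, smul_mul_assoc, smul_mul_assoc, smul_add,
        smul_comm r]
  intro V j f hf
  have := key V.1 V.2 j _ ((c.iso_mem (V.2.trans h₀)).2 hf)
  refine ⟨c.symm_mem _ this.1, fun g => ?_⟩
  change (c.iso V.1 _).symm (T V.1 V.2 (c.iso V.1 _ (f * g))) =
    (c.iso V.1 _).symm (T V.1 V.2 (c.iso V.1 _ f)) * g +
      koszulSign (i * j) • (f * (c.iso V.1 _).symm (T V.1 V.2 (c.iso V.1 _ g)))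
  rw [map_mul, this.2, map_add, map_zsmul, map_mul, map_mul, AlgEquiv.symm_apply_apply,
    AlgEquiv.symm_apply_apply]

theorem ev_localEnd {V₀ : Opens M.space} (h₀ : V₀ ≤ U)
    (T : ∀ V : Opens M.space, V ≤ V₀ → (A.obj (op (c.im V)) ⊗[k] Grassmann k q →ₗ[k]
      A.obj (op (c.im V)) ⊗[k] Grassmann k q))
    (hT : ∀ V hV W (h : W ≤ V) t, c.modelRes h (T V hV t) = T W (h.trans hV) (c.modelRes h t))
    (t : A.obj (op (c.im V₀)) ⊗[k] Grassmann k q) :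
    M.ev (c.localEnd h₀ T hT) ((c.iso V₀ h₀).symm t) = (c.iso V₀ h₀).symm (T V₀ le_rfl t) := by
  change (c.iso V₀ _).symm (T V₀ _ (c.iso V₀ _ ((c.iso V₀ _).symm t))) = _
  rw [AlgEquiv.apply_symm_apply]

end SplitChart

end SplitChart

end Superspace

namespace Superspace

variable {k : Type u} [Field k] (M : Superspace k)

/-! ### Coordinate functions and coordinate vector fields of a chart -/

section ChartCoordinates

variable {M}
variable {U : Opens M.space} {Z : TopCat.{u}} {A : TopCat.Presheaf (CommAlgCat.{u} k) Z} {q : ℕ}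
variable (c : M.SplitChart U Z A q)

namespace SplitChart

theorem modelRes_tmul {V W : Opens M.space} (h : W ≤ V) (a : A.obj (op (c.im V)))
    (l : Grassmann k q) : c.modelRes h (a ⊗ₜ[k] l) =
      comRes A (M.imageOpen_mono c.isOpenEmbedding h) a ⊗ₜ[k] l :=
  rfl

/-- The derivation `∂ / ∂ z_i` in a chart. -/
noncomputable def evenPartial {O : Opens Z} {p : ℕ} (e : EvenCoordinates A O p)
    {V₀ : Opens M.space} (h₀ : V₀ ≤ U) (hO : c.im V₀ ≤ O) (i : Fin p) : M.LocalEnd V₀ :=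
  c.localEnd h₀ (fun V hV => TensorProduct.map
      (e.d i (c.im V) ((M.imageOpen_mono c.isOpenEmbedding hV).trans hO)) LinearMap.id)
    (fun V hV W h t => by
      induction t using TensorProduct.induction_on with
      | zero => simp only [map_zero]
      | tmul a l =>
        rw [TensorProduct.map_tmul, modelRes_tmul, modelRes_tmul, TensorProduct.map_tmul, e.d_res]
      | add x y hx hy => simp only [map_add, hx, hy])

/-- The derivation `∂ / ∂ θ_b` in a chart. -/
noncomputable def oddPartial {V₀ : Opens M.space} (h₀ : V₀ ≤ U) (b : Fin q) : M.LocalEnd V₀ :=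
  c.localEnd h₀ (fun V _ => TensorProduct.map LinearMap.id
      (CliffordAlgebra.contractLeft (Q := (0 : QuadraticForm k (Fin q → k))) (LinearMap.proj b)))
    (fun V hV W h t => by
      induction t using TensorProduct.induction_on with
      | zero => simp only [map_zero]
      | tmul a l =>
        rw [TensorProduct.map_tmul, modelRes_tmul, modelRes_tmul, TensorProduct.map_tmul]
        rfl
      | add x y hx hy => simp only [map_add, hx, hy])

theorem evenPartial_mem {O : Opens Z} {p : ℕ} (e : EvenCoordinates A O p)
    {V₀ : Opens M.space} (h₀ : V₀ ≤ U) (hO : c.im V₀ ≤ O) (i : Fin p) :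
    c.evenPartial e h₀ hO i ∈ M.vecField V₀ 0 := by
  refine c.localEnd_mem _ _ _ fun V hV a j l hl => ⟨?_, fun b l' => ?_⟩
  · rw [TensorProduct.map_tmul, zero_add]
    exact tmul_mem_splitParity _ hl
  · rw [Algebra.TensorProduct.tmul_mul_tmul, TensorProduct.map_tmul, TensorProduct.map_tmul,
      TensorProduct.map_tmul, Algebra.TensorProduct.tmul_mul_tmul,
      Algebra.TensorProduct.tmul_mul_tmul, e.d_mul, zero_mul, koszulSign_zero, one_smul,
      TensorProduct.add_tmul]
    rfl

theorem oddPartial_mem {V₀ : Opens M.space} (h₀ : V₀ ≤ U) (b : Fin q) :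
    c.oddPartial h₀ b ∈ M.vecField V₀ 1 := by
  refine c.localEnd_mem _ _ _ fun V hV a j l hl => ⟨?_, fun b l' => ?_⟩
  · rw [TensorProduct.map_tmul]
    exact tmul_mem_splitParity _ (contractLeft_mem_and_mul _ hl).1
  · rw [Algebra.TensorProduct.tmul_mul_tmul, TensorProduct.map_tmul, TensorProduct.map_tmul,
      TensorProduct.map_tmul, Algebra.TensorProduct.tmul_mul_tmul,
      Algebra.TensorProduct.tmul_mul_tmul, (contractLeft_mem_and_mul _ hl).2, one_mul,
      TensorProduct.tmul_add, TensorProduct.tmul_smul]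
    rfl

theorem ev_evenPartial {O : Opens Z} {p : ℕ} (e : EvenCoordinates A O p)
    {V₀ : Opens M.space} (h₀ : V₀ ≤ U) (hO : c.im V₀ ≤ O) (i : Fin p) (a : A.obj (op (c.im V₀)))
    (l : Grassmann k q) : M.ev (c.evenPartial e h₀ hO i) ((c.iso V₀ h₀).symm (a ⊗ₜ l)) =
      (c.iso V₀ h₀).symm (e.d i (c.im V₀) hO a ⊗ₜ l) :=
  c.ev_localEnd h₀ _ _ _

theorem ev_oddPartial {V₀ : Opens M.space} (h₀ : V₀ ≤ U) (b : Fin q) (a : A.obj (op (c.im V₀)))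
    (l : Grassmann k q) : M.ev (c.oddPartial h₀ b) ((c.iso V₀ h₀).symm (a ⊗ₜ l)) =
      (c.iso V₀ h₀).symm (a ⊗ₜ CliffordAlgebra.contractLeft
        (Q := (0 : QuadraticForm k (Fin q → k))) (LinearMap.proj b) l) :=
  c.ev_localEnd h₀ _ _ _

variable {c}

/-- The derivation of a commutative algebra obtained from a superderivation of its exterior
extension and a functional on the exterior algebra vanishes if it does so on coordinates. -/
theorem symm_tmul_one_eq_zero {O : Opens Z} {p : ℕ} (e : EvenCoordinates A O p)
    {V : Opens M.space} (hV : V ≤ U) (hO : c.im V ≤ O) {i : ZMod 2} {X : M.LocalEnd V}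
    (hX : X ∈ M.vecField V i)
    (hz : ∀ j, M.ev X ((c.iso V hV).symm (comRes A hO (e.z j) ⊗ₜ 1)) = 0)
    (a : A.obj (op (c.im V))) : M.ev X ((c.iso V hV).symm (a ⊗ₜ 1)) = 0 := by
  classical
  let ℬ := Module.Basis.ofVectorSpace k (Grassmann k q)
  rw [← (c.iso V hV).map_eq_zero_iff]
  -- An element of A ⊗ Λ vanishes if all its coefficients in a basis of Λ do. Each coefficient of X
  -- on A is an ordinary derivation of A: the elements of A are even and the coefficient map is
  -- A-linear. Hence `EvenCoordinates.eq_zero` applies.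
  refine (TensorProduct.equivFinsuppOfBasisRight (R := k) (M := A.obj (op (c.im V))) ℬ).injective
    (Finsupp.ext fun κ => ?_)
  rw [map_zero, Finsupp.zero_apply]
  -- the coefficient functional
  let ev (W : Opens M.space) : A.obj (op (c.im W)) ⊗[k] Grassmann k q →ₗ[k] A.obj (op (c.im W)) :=
    (TensorProduct.rid k _).toLinearMap ∘ₗ LinearMap.lTensor _ (ℬ.coord κ)
  have ev_tmul : ∀ W b l, ev W (b ⊗ₜ l) = ℬ.coord κ l • b := fun W b l => TensorProduct.rid_tmul ..
  have ev_mul : ∀ W t b, ev W (t * b ⊗ₜ 1) = ev W t * b := fun W t b => by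
    induction t using TensorProduct.induction_on with
    | zero => rw [zero_mul, map_zero, zero_mul]
    | tmul b' l =>
      rw [Algebra.TensorProduct.tmul_mul_tmul, ev_tmul, ev_tmul, mul_one, smul_mul_assoc]
    | add x y hx hy => rw [add_mul, map_add, hx, hy, map_add, add_mul]
  have ev_mul' : ∀ W t b, ev W (b ⊗ₜ 1 * t) = b * ev W t := fun W t b => by
    induction t using TensorProduct.induction_on with
    | zero => rw [mul_zero, map_zero, mul_zero]
    | tmul b' l =>
      rw [Algebra.TensorProduct.tmul_mul_tmul, ev_tmul, ev_tmul, one_mul, mul_smul_comm]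
    | add x y hx hy => rw [mul_add, map_add, hx, hy, map_add, mul_add]
  have ev_res : ∀ W W' (h : W' ≤ W) t, comRes A (M.imageOpen_mono c.isOpenEmbedding h) (ev W t) =
      ev W' (c.modelRes h t) := fun W W' h t => by
    induction t using TensorProduct.induction_on with
    | zero => simp only [map_zero]
    | tmul b' l => rw [modelRes_tmul, ev_tmul, ev_tmul, map_smul]
    | add x y hx hy => simp only [map_add, hx, hy]
  have ev_eq : ∀ t, TensorProduct.equivFinsuppOfBasisRight ℬ t κ = ev V t := fun t => by
    induction t using TensorProduct.induction_on with
    | zero => rw [map_zero, map_zero, Finsupp.zero_apply]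
    | tmul b l =>
      rw [ev_tmul, TensorProduct.equivFinsuppOfBasisRight_apply_tmul_apply, Module.Basis.coord_apply]
    | add x y hx hy => rw [map_add, map_add, Finsupp.add_apply, hx, hy]
  -- the derivation on the opens of `V`
  let D (W : Opens M.space) (hW : W ≤ V) : A.obj (op (c.im W)) →ₗ[k] A.obj (op (c.im W)) :=
    ev W ∘ₗ (c.iso W (hW.trans hV)).toLinearMap ∘ₗ M.app X ⟨W, hW⟩ ∘ₗ
      (c.iso W (hW.trans hV)).symm.toLinearMap ∘ₗ
        (Algebra.TensorProduct.includeLeft (R := k) (S := k) (B := Grassmann k q)).toLinearMap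
  have D_mul : ∀ W hW f g, D W hW (f * g) = D W hW f * g + f * D W hW g := fun W hW f g => by
    have hf : (c.iso W (hW.trans hV)).symm (f ⊗ₜ 1) ∈ M.parity W 0 :=
      c.symm_mem _ (tmul_mem_splitParity _ SetLike.GradedOne.one_mem)
    have h1 : (c.iso W (hW.trans hV)).symm ((f * g) ⊗ₜ 1) =
        (c.iso W (hW.trans hV)).symm (f ⊗ₜ 1) * (c.iso W (hW.trans hV)).symm (g ⊗ₜ 1) := by
      rw [← map_mul, Algebra.TensorProduct.tmul_mul_tmul, mul_one]
    change ev W (c.iso W _ (M.app X ⟨W, hW⟩ ((c.iso W _).symm ((f * g) ⊗ₜ 1)))) =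
      ev W (c.iso W _ (M.app X ⟨W, hW⟩ ((c.iso W _).symm (f ⊗ₜ 1)))) * g +
      f * ev W (c.iso W _ (M.app X ⟨W, hW⟩ ((c.iso W _).symm (g ⊗ₜ 1))))
    rw [h1, (hX ⟨W, hW⟩ 0 _ hf).2, mul_zero, koszulSign_zero, one_smul, map_add, map_mul, map_mul,
      AlgEquiv.apply_symm_apply, AlgEquiv.apply_symm_apply, map_add, ev_mul, ev_mul']
  have D_res : ∀ W hW W' (h : W' ≤ W) f,
      comRes A (M.imageOpen_mono c.isOpenEmbedding h) (D W hW f) =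
        D W' (h.trans hW) (comRes A (M.imageOpen_mono c.isOpenEmbedding h) f) :=
    fun W hW W' h f => by
      change comRes A _ (ev W (c.iso W _ (M.app X ⟨W, hW⟩ ((c.iso W _).symm (f ⊗ₜ 1))))) =
        ev W' (c.iso W' _ (M.app X ⟨W', _⟩ ((c.iso W' _).symm (comRes A _ f ⊗ₜ 1))))
      rw [ev_res W W' h, ← c.iso_res (hW.trans hV) h, ← c.modelRes_tmul h,
        ← c.res_iso_symm (hW.trans hV) h]
      exact congrArg (fun s => ev W' (c.iso W' _ s)) (X.2 ⟨W, hW⟩ ⟨W', h.trans hW⟩ h _)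
  have hp : ∀ W (hW : W ≤ c.im V), c.im (c.preim W) ≤ W := fun W _ => c.im_preim_le W
  have hp' : ∀ W (hW : W ≤ c.im V), W ≤ c.im (c.preim W) := fun W hW => c.le_im_preim hW
  -- The derivation `D` is indexed by open sets of M, but `eq_zero` requires open sets of Z. They
  -- are matched by `preim`, with restrictions in both directions because the image of the preimage
  -- equals W only propositionally.
  have key := e.eq_zero (c.im V) hO
    (fun W hW => (comRes A (hp' W hW)).toLinearMap ∘ₗ D (c.preim W) (c.preim_le_of_le hW) ∘ₗ
      (comRes A (hp W hW)).toLinearMap)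
    (fun W hW f g => by
      change comRes A _ (D _ _ (comRes A _ (f * g))) = comRes A _ (D _ _ (comRes A _ f)) * g +
        f * comRes A _ (D _ _ (comRes A _ g))
      rw [map_mul, D_mul, map_add, map_mul, map_mul, comRes_comRes, comRes_comRes, comRes_self,
        comRes_self])
    (fun W hW W' h f => by
      change comRes A _ (comRes A _ (D _ _ (comRes A _ f))) =
        comRes A _ (D _ _ (comRes A _ (comRes A _ f)))
      rw [comRes_comRes, comRes_comRes,
        ← comRes_comRes A (M.imageOpen_mono c.isOpenEmbedding (c.preim_mono h))
          (hp' W' (h.trans hW)), D_res _ _ _ (c.preim_mono h), comRes_comRes])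
    (fun j => by
      change comRes A _ (D _ _ (comRes A _ _)) = 0
      rw [comRes_comRes, ← comRes_comRes A hO (M.imageOpen_mono c.isOpenEmbedding
        (c.preim_le_of_le le_rfl)), ← D_res V le_rfl _ (c.preim_le_of_le le_rfl)]
      have h0 : D V le_rfl (comRes A hO (e.z j)) = 0 := by
        change ev V (c.iso V _ (M.ev X ((c.iso V _).symm (_ ⊗ₜ 1)))) = 0
        rw [hz, map_zero, map_zero]
      rw [h0, map_zero, map_zero])
    a
  have h2 : D V le_rfl a = 0 := by
    change comRes A _ (D _ _ (comRes A _ a)) = 0 at key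
    rw [← D_res V le_rfl (c.preim (c.im V)) (c.preim_le_of_le le_rfl), comRes_comRes,
      comRes_self] at key
    exact key
  exact (ev_eq _).trans h2

/-- A vector field which kills the coordinates of a chart is zero. -/
theorem eq_zero_of_ev_coord {O : Opens Z} {p : ℕ} (e : EvenCoordinates A O p)
    {V : Opens M.space} (hV : V ≤ U) (hO : c.im V ≤ O) {i : ZMod 2} {X : M.LocalEnd V}
    (hX : X ∈ M.vecField V i)
    (hz : ∀ j, M.ev X ((c.iso V hV).symm (comRes A hO (e.z j) ⊗ₜ 1)) = 0)
    (hθ : ∀ b, M.ev X ((c.iso V hV).symm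
      (1 ⊗ₜ CliffordAlgebra.ι (0 : QuadraticForm k (Fin q → k)) (Pi.single b 1))) = 0)
    (f : M.Fn V) : M.ev X f = 0 := by
  have h1 : (1 : Grassmann k q) ∈ CliffordAlgebra.evenOdd (0 : QuadraticForm k (Fin q → k)) 0 :=
    SetLike.GradedOne.one_mem
  have hι : ∀ m : Fin q → k, M.ev X ((c.iso V hV).symm
      (1 ⊗ₜ CliffordAlgebra.ι (0 : QuadraticForm k (Fin q → k)) m)) = 0 := fun m => by
    rw [← Finset.univ_sum_single m, map_sum, TensorProduct.tmul_sum, map_sum, map_sum]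
    refine Finset.sum_eq_zero fun b _ => ?_
    have : (Pi.single b (m b) : Fin q → k) = m b • Pi.single b 1 := by
      rw [← Pi.single_smul, smul_eq_mul, mul_one]
    rw [this, map_smul, TensorProduct.tmul_smul, map_smul, map_smul, hθ, smul_zero]
  -- X kills the generators of Λ and hence, by the Leibniz rule, all of Λ. A general a ⊗ l is then
  -- treated as the product of a ⊗ 1 and 1 ⊗ l.
  have hΛ : ∀ l : Grassmann k q, M.ev X ((c.iso V hV).symm (1 ⊗ₜ l)) = 0 := fun l => by
    induction l using CliffordAlgebra.left_induction with
    | algebraMap r =>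
      rw [Algebra.algebraMap_eq_smul_one, TensorProduct.tmul_smul, map_smul, map_smul,
        ← Algebra.TensorProduct.one_def, map_one, M.ev_one hX, smul_zero]
    | add x y hx hy => rw [TensorProduct.tmul_add, map_add, map_add, hx, hy, add_zero]
    | ι_mul x m hx =>
      have hm : (c.iso V hV).symm (1 ⊗ₜ CliffordAlgebra.ι (0 : QuadraticForm k (Fin q → k)) m) ∈
          M.parity V 1 := c.symm_mem _ (tmul_mem_splitParity _ (CliffordAlgebra.ι_mem_evenOdd_one _ m))
      rw [← one_mul (1 : A.obj (op (c.im V))), ← Algebra.TensorProduct.tmul_mul_tmul, map_mul,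
        M.ev_leibniz hX hm, hx, hι, zero_mul, mul_zero, smul_zero, add_zero]
  obtain ⟨t, rfl⟩ := (c.iso V hV).symm.surjective f
  induction t using TensorProduct.induction_on with
  | zero => rw [map_zero, map_zero]
  | tmul a l =>
    rw [← mul_one a, ← one_mul l, ← Algebra.TensorProduct.tmul_mul_tmul, map_mul,
      M.ev_leibniz hX (c.symm_mem _ (tmul_mem_splitParity _ h1)), hΛ,
      symm_tmul_one_eq_zero e hV hO hX hz]
    simp only [zero_mul, mul_zero, smul_zero, add_zero]
  | add x y hx hy => rw [map_add, map_add, hx, hy, add_zero]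

variable (c)

/-- The coordinate functions of a chart. -/
noncomputable def coordFn {O : Opens Z} {p : ℕ} (e : EvenCoordinates A O p)
    {V : Opens M.space} (hV : V ≤ U) (hO : c.im V ≤ O) : Fin p ⊕ Fin q → M.Fn V
  | .inl j => (c.iso V hV).symm (comRes A hO (e.z j) ⊗ₜ 1)
  | .inr b => (c.iso V hV).symm
      (1 ⊗ₜ CliffordAlgebra.ι (0 : QuadraticForm k (Fin q → k)) (Pi.single b 1))

/-- The coordinate vector fields of a chart. -/
noncomputable def coordPartial {O : Opens Z} {p : ℕ} (e : EvenCoordinates A O p)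
    {V : Opens M.space} (hV : V ≤ U) (hO : c.im V ≤ O) : Fin p ⊕ Fin q → M.LocalEnd V
  | .inl j => c.evenPartial e hV hO j
  | .inr b => c.oddPartial hV b

variable {O : Opens Z} {p : ℕ} (e : EvenCoordinates A O p) {V : Opens M.space} (hV : V ≤ U)
  (hO : c.im V ≤ O)

theorem coordFn_mem (a : Fin p ⊕ Fin q) : c.coordFn e hV hO a ∈ M.parity V (coordParity a) := by
  rcases a with j | b
  · exact c.symm_mem _ (tmul_mem_splitParity _ SetLike.GradedOne.one_mem)
  · exact c.symm_mem _ (tmul_mem_splitParity _ (CliffordAlgebra.ι_mem_evenOdd_one _ _))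

theorem coordPartial_mem (a : Fin p ⊕ Fin q) :
    c.coordPartial e hV hO a ∈ M.vecField V (coordParity a) := by
  rcases a with j | b
  · exact c.evenPartial_mem e hV hO j
  · exact c.oddPartial_mem hV b

theorem ev_coordPartial (a b : Fin p ⊕ Fin q) :
    M.ev (c.coordPartial e hV hO a) (c.coordFn e hV hO b) = if a = b then 1 else 0 := by
  have hz : ∀ i j, e.d i (c.im V) hO (comRes A hO (e.z j)) = if i = j then 1 else 0 := fun i j => by
    rw [← e.d_res i O le_rfl]
    split_ifs with h
    · rw [h, e.d_self, map_one]
    · rw [e.d_ne i j h, map_zero]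
  rcases a with i | i <;> rcases b with j | j
  · refine (c.ev_evenPartial e hV hO i _ _).trans ?_
    rw [hz]
    simp only [Sum.inl.injEq]
    split_ifs
    · exact map_one (c.iso V hV).symm
    · rw [TensorProduct.zero_tmul, map_zero]
  · refine (c.ev_evenPartial e hV hO i _ _).trans ?_
    rw [e.d_one, TensorProduct.zero_tmul, map_zero, if_neg (by simp)]
  · refine (c.ev_oddPartial hV i _ _).trans ?_
    rw [CliffordAlgebra.contractLeft_one, TensorProduct.tmul_zero, map_zero,
      if_neg (by simp)]
  · refine (c.ev_oddPartial hV i _ _).trans ?_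
    rw [CliffordAlgebra.contractLeft_ι, LinearMap.proj_apply,
      Pi.single_apply]
    simp only [Sum.inr.injEq]
    split_ifs
    · rw [map_one]
      exact map_one (c.iso V hV).symm
    · rw [map_zero, TensorProduct.tmul_zero, map_zero]

theorem res_coordFn {W : Opens M.space} (h : W ≤ V) (a : Fin p ⊕ Fin q) :
    M.res h (c.coordFn e hV hO a) =
      c.coordFn e (h.trans hV) ((M.imageOpen_mono c.isOpenEmbedding h).trans hO) a := by
  rcases a with j | b
  · refine (c.res_iso_symm hV h _).trans ?_
    rw [modelRes_tmul, comRes_comRes]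
    rfl
  · refine (c.res_iso_symm hV h _).trans ?_
    rw [modelRes_tmul, map_one]
    rfl

/-- The local coordinates of a chart. -/
noncomputable def coordinates : M.Coordinates V p q where
  x := c.coordFn e hV hO
  x_mem := c.coordFn_mem e hV hO
  partialD := c.coordPartial e hV hO
  partial_mem := c.coordPartial_mem e hV hO
  partial_self a := by rw [ev_coordPartial, if_pos rfl]
  partial_ne a b h := by rw [ev_coordPartial, if_neg h]
  span W h i X hX := by
    rw [← sub_eq_zero]
    -- The difference X − Σ X(x_a) ∂_a is a vector field that kills the coordinates, so
    -- `eq_zero_of_ev_coord` makes it zero on every open subset.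
    have hY : X - ∑ a, M.multOp W (M.ev X (M.res h (c.coordFn e hV hO a))) *
        M.endRes h (c.coordPartial e hV hO a) ∈ M.vecField W i := by
      refine sub_mem hX (sum_mem fun a _ => ?_)
      have := M.multOp_mul_mem (M.ev_mem hX (M.parity_res h (c.coordFn_mem e hV hO a)))
        (M.endRes_mem h (c.coordPartial_mem e hV hO a))
      rwa [Coordinates.parity_add_self] at this
    have hY0 : ∀ b, M.ev (X - ∑ a, M.multOp W (M.ev X (M.res h (c.coordFn e hV hO a))) *
        M.endRes h (c.coordPartial e hV hO a)) (M.res h (c.coordFn e hV hO b)) = 0 := fun b => by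
      have : ∀ f, M.ev (X - ∑ a, M.multOp W (M.ev X (M.res h (c.coordFn e hV hO a))) *
          M.endRes h (c.coordPartial e hV hO a)) f = M.ev X f -
            ∑ a, M.ev X (M.res h (c.coordFn e hV hO a)) *
              M.ev (M.endRes h (c.coordPartial e hV hO a)) f := fun f => by
        rw [ev_sub, ev_sum]
        simp only [ev_mul, ev_multOp]
      rw [this, sub_eq_zero]
      refine Eq.symm ((Finset.sum_eq_single b (fun a _ hab => ?_) (by simp)).trans ?_)
      · rw [← res_ev, ev_coordPartial, if_neg hab, map_zero, mul_zero]
      · rw [← res_ev, ev_coordPartial, if_pos rfl, map_one, mul_one]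
    refine M.app_ext fun W' f => ?_
    have hO' := (M.imageOpen_mono c.isOpenEmbedding (W'.2.trans h)).trans hO
    refine eq_zero_of_ev_coord (c := c) e ((W'.2.trans h).trans hV) hO' (M.endRes_mem W'.2 hY)
      (fun j => ?_) (fun b => ?_) f
    · refine Eq.trans ?_ ((congrArg (M.res W'.2) (hY0 (.inl j))).trans (map_zero _))
      rw [res_ev, res_res, res_coordFn]
      rfl
    · refine Eq.trans ?_ ((congrArg (M.res W'.2) (hY0 (.inr b))).trans (map_zero _))
      rw [res_ev, res_res, res_coordFn]
      rfl

end SplitChart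

end ChartCoordinates

end Superspace

/-! ### Hadamard's lemma -/

section Hadamard

variable {𝕜 : Type u} [RCLike 𝕜] {p : ℕ}

/-- The mean `∫₀¹ t ^ m g (y + t (x - y)) dt` of a function along the segment from `y` to `x`. -/
noncomputable def segmentMean (y : EuclideanSpace 𝕜 (Fin p)) (m : ℕ)
    (g : EuclideanSpace 𝕜 (Fin p) → 𝕜) (x : EuclideanSpace 𝕜 (Fin p)) : 𝕜 :=
  ∫ t in (0 : ℝ)..1, (t : 𝕜) ^ m * g (y + (t : 𝕜) • (x - y))

theorem segment_mem_closedBall {y x : EuclideanSpace 𝕜 (Fin p)} {r : ℝ}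
    (hx : x ∈ Metric.closedBall y r) {t : ℝ} (ht : t ∈ Set.Icc (0 : ℝ) 1) :
    y + (t : 𝕜) • (x - y) ∈ Metric.closedBall y r := by
  rw [Metric.mem_closedBall, dist_eq_norm] at *
  rw [add_sub_cancel_left, norm_smul, RCLike.norm_ofReal, abs_of_nonneg ht.1]
  exact (mul_le_of_le_one_left (norm_nonneg _) ht.2).trans hx

theorem segment_mem_ball {y x : EuclideanSpace 𝕜 (Fin p)} {r : ℝ}
    (hx : x ∈ Metric.ball y r) {t : ℝ} (ht : t ∈ Set.Icc (0 : ℝ) 1) :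
    y + (t : 𝕜) • (x - y) ∈ Metric.ball y r :=
  Metric.closedBall_subset_ball hx (segment_mem_closedBall (Metric.mem_closedBall.2 le_rfl) ht)

theorem continuousOn_pow_smul {F : Type*} [TopologicalSpace F] [SMul 𝕜 F] [ContinuousSMul 𝕜 F]
    {s : Set ℝ} {g : ℝ → F} (hg : ContinuousOn g s) (m : ℕ) :
    ContinuousOn (fun t : ℝ => (t : 𝕜) ^ m • g t) s := by
  have := RCLike.continuous_ofReal (K := 𝕜)
  fun_prop

theorem continuousOn_segment {F : Type*} [TopologicalSpace F] {y x : EuclideanSpace 𝕜 (Fin p)}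
    {r : ℝ} {g : EuclideanSpace 𝕜 (Fin p) → F} (hg : ContinuousOn g (Metric.ball y r))
    (hx : x ∈ Metric.ball y r) :
    ContinuousOn (fun t : ℝ => g (y + (t : 𝕜) • (x - y))) (Set.Icc 0 1) := by
  refine hg.comp (Continuous.continuousOn ?_) fun t ht => segment_mem_ball hx ht
  have := RCLike.continuous_ofReal (K := 𝕜)
  fun_prop

/-- Differentiation under the integral. The chain rule along y + t(x − y) contributes a factor t,
which explains the weight t^m in `segmentMean`. -/
theorem hasFDerivAt_segmentMean {y x₀ : EuclideanSpace 𝕜 (Fin p)} {r : ℝ}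
    {g : EuclideanSpace 𝕜 (Fin p) → 𝕜} (hg : ContDiffOn 𝕜 1 g (Metric.ball y r)) (m : ℕ)
    (hx₀ : x₀ ∈ Metric.ball y r) :
    HasFDerivAt (segmentMean y m g)
      (∫ t in (0 : ℝ)..1, (t : 𝕜) ^ (m + 1) • fderiv 𝕜 g (y + (t : 𝕜) • (x₀ - y))) x₀ := by
  -- On the compact ball of an intermediate radius the derivative of g is bounded, which gives the
  -- dominating constant.
  obtain ⟨r', h1, h2⟩ := exists_between (Metric.mem_ball.1 hx₀)
  have hd : ContinuousOn (fderiv 𝕜 g) (Metric.ball y r) :=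
    hg.continuousOn_fderiv_of_isOpen Metric.isOpen_ball le_rfl
  have hsub : Metric.closedBall y r' ⊆ Metric.ball y r := Metric.closedBall_subset_ball h2
  obtain ⟨C, hC⟩ := (isCompact_closedBall y r').exists_bound_of_continuousOn (hd.mono hsub)
  have hI : Set.uIoc (0 : ℝ) 1 ⊆ Set.Icc 0 1 := by
    rw [Set.uIoc_of_le zero_le_one]; exact Set.Ioc_subset_Icc_self
  have hc : ∀ (m : ℕ) x, x ∈ Metric.ball y r →
      ContinuousOn (fun t : ℝ => (t : 𝕜) ^ m * g (y + (t : 𝕜) • (x - y))) (Set.Icc 0 1) :=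
    fun m x hx => by
      simpa only [smul_eq_mul] using
        continuousOn_pow_smul (𝕜 := 𝕜) (continuousOn_segment hg.continuousOn hx) m
  have hc' : ContinuousOn (fun t : ℝ => (t : 𝕜) ^ (m + 1) •
      fderiv 𝕜 g (y + (t : 𝕜) • (x₀ - y))) (Set.Icc 0 1) :=
    continuousOn_pow_smul (continuousOn_segment hd hx₀) (m + 1)
  refine intervalIntegral.hasFDerivAt_integral_of_dominated_of_fderiv_le (𝕜 := 𝕜)
    (s := Metric.ball y r') (bound := fun _ => C)
    (F := fun x (t : ℝ) => (t : 𝕜) ^ m * g (y + (t : 𝕜) • (x - y)))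
    (F' := fun x (t : ℝ) => (t : 𝕜) ^ (m + 1) • fderiv 𝕜 g (y + (t : 𝕜) • (x - y)))
    (Metric.isOpen_ball.mem_nhds h1) ?_ ?_ ?_ ?_ (by simp) ?_
  · filter_upwards [Metric.isOpen_ball.mem_nhds hx₀] with x hx
    exact ((hc m x hx).mono hI).aestronglyMeasurable measurableSet_uIoc
  · exact ContinuousOn.intervalIntegrable (by rw [Set.uIcc_of_le zero_le_one]; exact hc m x₀ hx₀)
  · exact (hc'.mono hI).aestronglyMeasurable measurableSet_uIoc
  · refine Filter.Eventually.of_forall fun t ht x hx => ?_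
    rw [norm_smul, norm_pow, RCLike.norm_ofReal, abs_of_nonneg (hI ht).1]
    refine (mul_le_of_le_one_left (norm_nonneg _) (pow_le_one₀ (hI ht).1 (hI ht).2)).trans ?_
    exact hC _ (segment_mem_closedBall (Metric.ball_subset_closedBall hx) (hI ht))
  · refine Filter.Eventually.of_forall fun t ht x hx => ?_
    have hx' : x ∈ Metric.ball y r := hsub (Metric.ball_subset_closedBall hx)
    have e1 : HasFDerivAt g (fderiv 𝕜 g (y + (t : 𝕜) • (x - y))) (y + (t : 𝕜) • (x - y)) :=
      ((hg.differentiableOn one_ne_zero).differentiableAt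
        (Metric.isOpen_ball.mem_nhds (segment_mem_ball hx' (hI ht)))).hasFDerivAt
    have e2 : HasFDerivAt (fun x : EuclideanSpace 𝕜 (Fin p) => y + (t : 𝕜) • (x - y))
        ((t : 𝕜) • ContinuousLinearMap.id 𝕜 _) x :=
      (((hasFDerivAt_id x).sub_const y).const_smul (t : 𝕜)).const_add y
    refine ((e1.comp x e2).const_mul ((t : 𝕜) ^ m)).congr_fderiv ?_
    ext v
    simp only [smul_apply, ContinuousLinearMap.comp_apply, ContinuousLinearMap.id_apply, map_smul, smul_eq_mul]
    ring

/-- Induction on the order: a directional derivative of a segment mean is the segment mean of that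
derivative of g with m raised by one, so g and m have to vary. -/
theorem contDiffOn_segmentMean {y : EuclideanSpace 𝕜 (Fin p)} {r : ℝ}
    {g : EuclideanSpace 𝕜 (Fin p) → 𝕜} (hg : ContDiffOn 𝕜 ∞ g (Metric.ball y r)) (m : ℕ) :
    ContDiffOn 𝕜 ∞ (segmentMean y m g) (Metric.ball y r) := by
  rw [contDiffOn_infty]
  intro n
  induction n generalizing m g with
  | zero =>
    refine contDiffOn_zero.2 fun x hx => ?_
    exact (hasFDerivAt_segmentMean (hg.of_le (by exact_mod_cast le_top)) m hx).continuousAt.continuousWithinAt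
  | succ n ih =>
    have hg1 : ContDiffOn 𝕜 1 g (Metric.ball y r) := hg.of_le (by exact_mod_cast le_top)
    have hd : ContDiffOn 𝕜 ∞ (fderiv 𝕜 g) (Metric.ball y r) :=
      hg.fderiv_of_isOpen Metric.isOpen_ball (by simp)
    rw [Nat.cast_add, Nat.cast_one, contDiffOn_succ_iff_fderiv_of_isOpen Metric.isOpen_ball]
    refine ⟨fun x hx => (hasFDerivAt_segmentMean hg1 m hx).differentiableAt.differentiableWithinAt,
      by simp, ?_⟩
    rw [contDiffOn_clm_apply]
    intro v
    refine (ih (g := fun x => fderiv 𝕜 g x v) (hd.clm_apply contDiffOn_const) (m + 1)).congr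
      fun x hx => ?_
    rw [(hasFDerivAt_segmentMean hg1 m hx).fderiv, ContinuousLinearMap.intervalIntegral_apply]
    · rfl
    · refine ContinuousOn.intervalIntegrable ?_
      rw [Set.uIcc_of_le zero_le_one]
      exact continuousOn_pow_smul (continuousOn_segment hd.continuousOn hx) (m + 1)

/-- Hadamard's lemma. -/
theorem exists_hadamard {y : EuclideanSpace 𝕜 (Fin p)} {r : ℝ}
    {f : EuclideanSpace 𝕜 (Fin p) → 𝕜} (hf : ContDiffOn 𝕜 ∞ f (Metric.ball y r)) :
    ∃ g : Fin p → EuclideanSpace 𝕜 (Fin p) → 𝕜,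
      (∀ i, ContDiffOn 𝕜 ∞ (g i) (Metric.ball y r)) ∧
      ∀ x ∈ Metric.ball y r, f x = f y + ∑ i, (x i - y i) * g i x := by
  have hd : ContDiffOn 𝕜 ∞ (fderiv 𝕜 f) (Metric.ball y r) :=
    hf.fderiv_of_isOpen Metric.isOpen_ball (by simp)
  refine ⟨fun i => segmentMean y 0 fun x => fderiv 𝕜 f x (EuclideanSpace.single i 1),
    fun i => contDiffOn_segmentMean (hd.clm_apply contDiffOn_const) 0, fun x hx => ?_⟩
  have hi : ∀ v, ContinuousOn (fun t : ℝ => fderiv 𝕜 f (y + (t : 𝕜) • (x - y)) v)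
      (Set.uIcc 0 1) := fun v => by
    rw [Set.uIcc_of_le zero_le_one]
    exact (continuousOn_segment hd.continuousOn hx).clm_apply continuousOn_const
  -- The fundamental theorem of calculus along the segment, with a real parameter also when 𝕜 is
  -- complex.
  have h1 : ∫ t in (0 : ℝ)..1, fderiv 𝕜 f (y + (t : 𝕜) • (x - y)) (x - y) = f x - f y := by
    have := intervalIntegral.integral_eq_sub_of_hasDerivAt
      (f := fun t : ℝ => f (y + (t : 𝕜) • (x - y))) (a := 0) (b := 1)
      (f' := fun t : ℝ => fderiv 𝕜 f (y + (t : 𝕜) • (x - y)) (x - y)) (fun t ht => ?_)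
      (hi _).intervalIntegrable
    · simpa using this
    · rw [Set.uIcc_of_le zero_le_one] at ht
      have e1 : HasFDerivAt f (fderiv 𝕜 f (y + (t : 𝕜) • (x - y))) (y + (t : 𝕜) • (x - y)) :=
        ((hf.differentiableOn (by simp)).differentiableAt
          (Metric.isOpen_ball.mem_nhds (segment_mem_ball hx ht))).hasFDerivAt
      have e2 : HasDerivAt (fun s : 𝕜 => y + s • (x - y)) (x - y) (t : 𝕜) := by
        simpa using ((hasDerivAt_id (t : 𝕜)).smul_const (x - y)).const_add y
      have e3 : HasDerivAt (fun s : ℝ => (s : 𝕜)) 1 t := by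
        simpa using (RCLike.ofRealCLM (K := 𝕜)).hasDerivAt (x := t)
      exact ((e1.comp_hasDerivAt (t : 𝕜) e2).scomp t e3).congr_deriv (one_smul _ _)
  have h2 : x - y = ∑ i, (x i - y i) • EuclideanSpace.single i (1 : 𝕜) := by
    ext j
    simp [Finset.sum_apply, Pi.single_apply]
  rw [← sub_eq_iff_eq_add', ← h1]
  have h3 : ∀ t : ℝ, fderiv 𝕜 f (y + (t : 𝕜) • (x - y)) (x - y) =
      ∑ i, (x i - y i) * fderiv 𝕜 f (y + (t : 𝕜) • (x - y)) (EuclideanSpace.single i 1) := fun t => by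
    conv_lhs => rw [h2]
    rw [map_sum, ← h2]
    simp only [map_smul, smul_eq_mul]
  simp only [h3]
  rw [intervalIntegral.integral_finsetSum fun i _ => (hi _).intervalIntegrable.const_mul _]
  simp only [intervalIntegral.integral_const_mul, segmentMean, pow_zero, one_mul]

end Hadamard

namespace Superspace

/-! ### Coordinates for smooth and holomorphic functions -/

section SmoothCoordinates

variable {𝕜 : Type u} [RCLike 𝕜] {p : ℕ}

/-- The extension by zero of a smooth function on an open set. -/
noncomputable def smoothExt {V : Opens (EuclideanSpace 𝕜 (Fin p))}
    (f : (smoothFunctions 𝕜 p).obj (op V)) (y : EuclideanSpace 𝕜 (Fin p)) : 𝕜 :=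
  open Classical in if h : y ∈ V then f.1 ⟨y, h⟩ else 0

theorem smoothExt_of_mem {V : Opens (EuclideanSpace 𝕜 (Fin p))}
    (f : (smoothFunctions 𝕜 p).obj (op V)) {y : EuclideanSpace 𝕜 (Fin p)} (h : y ∈ V) :
    smoothExt f y = f.1 ⟨y, h⟩ := dif_pos h

/-- As V is open, the values outside V do not matter. The extension makes `fderiv` on the ambient
space available. -/
theorem contDiffOn_smoothExt {V : Opens (EuclideanSpace 𝕜 (Fin p))}
    (f : (smoothFunctions 𝕜 p).obj (op V)) : ContDiffOn 𝕜 ∞ (smoothExt f) V := by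
  intro y hy
  refine ContDiffAt.contDiffWithinAt ?_
  rw [← contMDiffAt_iff_contDiffAt]
  refine (contMDiffAt_subtype_iff (U := V) (x := ⟨y, hy⟩)).1 ?_
  refine (f.2 ⟨y, hy⟩).congr_of_eventuallyEq (Filter.Eventually.of_forall fun x => ?_)
  exact smoothExt_of_mem f x.2

/-- The section of the sheaf of smooth functions given by a function which is smooth on an open
set. -/
def smoothMk {V : Opens (EuclideanSpace 𝕜 (Fin p))} (g : EuclideanSpace 𝕜 (Fin p) → 𝕜)
    (hg : ContDiffOn 𝕜 ∞ g V) : (smoothFunctions 𝕜 p).obj (op V) :=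
  ⟨fun y => g y.1, fun y => (contMDiffAt_subtype_iff (x := y)).2
    (hg.contDiffAt (V.isOpen.mem_nhds y.2)).contMDiffAt⟩

theorem smooth_ext {V : Opens (EuclideanSpace 𝕜 (Fin p))} {f g : (smoothFunctions 𝕜 p).obj (op V)}
    (h : ∀ y ∈ V, smoothExt f y = smoothExt g y) : f = g := by
  refine Subtype.ext (funext fun y => ?_)
  have := h y.1 y.2
  rwa [smoothExt_of_mem f y.2, smoothExt_of_mem g y.2] at this

section

variable {V : Opens (EuclideanSpace 𝕜 (Fin p))} {y : EuclideanSpace 𝕜 (Fin p)}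

theorem smoothExt_mk (hy : y ∈ V) (g : EuclideanSpace 𝕜 (Fin p) → 𝕜) (hg : ContDiffOn 𝕜 ∞ g V) :
    smoothExt (smoothMk g hg) y = g y := dif_pos hy

theorem smoothExt_add (hy : y ∈ V) (f g : (smoothFunctions 𝕜 p).obj (op V)) :
    smoothExt (f + g) y = smoothExt f y + smoothExt g y := by
  simp only [smoothExt_of_mem _ hy]; rfl

theorem smoothExt_mul (hy : y ∈ V) (f g : (smoothFunctions 𝕜 p).obj (op V)) :
    smoothExt (f * g) y = smoothExt f y * smoothExt g y := by
  simp only [smoothExt_of_mem _ hy]; rfl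

theorem smoothExt_smul (hy : y ∈ V) (c : 𝕜) (f : (smoothFunctions 𝕜 p).obj (op V)) :
    smoothExt (c • f) y = c * smoothExt f y := by
  simp only [smoothExt_of_mem _ hy]; rfl

theorem differentiableAt_smoothExt (hy : y ∈ V) (f : (smoothFunctions 𝕜 p).obj (op V)) :
    DifferentiableAt 𝕜 (smoothExt f) y :=
  ((contDiffOn_smoothExt f).differentiableOn (by simp)).differentiableAt (V.isOpen.mem_nhds hy)

end

theorem smoothExt_comRes {V W : Opens (EuclideanSpace 𝕜 (Fin p))} (h : W ≤ V)
    {y : EuclideanSpace 𝕜 (Fin p)} (hy : y ∈ W) (f : (smoothFunctions 𝕜 p).obj (op V)) :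
    smoothExt (comRes (smoothFunctions 𝕜 p) h f) y = smoothExt f y := by
  rw [smoothExt_of_mem _ hy, smoothExt_of_mem _ (h hy)]
  rfl

/-- The partial derivatives of smooth functions. -/
noncomputable def smoothPartial (i : Fin p) (V : Opens (EuclideanSpace 𝕜 (Fin p))) :
    (smoothFunctions 𝕜 p).obj (op V) →ₗ[𝕜] (smoothFunctions 𝕜 p).obj (op V) where
  toFun f := smoothMk (fun y => fderiv 𝕜 (smoothExt f) y (EuclideanSpace.single i 1))
    (((contDiffOn_smoothExt f).fderiv_of_isOpen V.isOpen (by simp)).clm_apply contDiffOn_const)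
  map_add' f g := smooth_ext fun y hy => by
    have h : smoothExt (f + g) =ᶠ[nhds y] smoothExt f + smoothExt g := by
      filter_upwards [V.isOpen.mem_nhds hy] with x hx using smoothExt_add hx f g
    rw [smoothExt_add hy, smoothExt_mk hy, smoothExt_mk hy, smoothExt_mk hy, h.fderiv_eq,
      fderiv_add (differentiableAt_smoothExt hy f) (differentiableAt_smoothExt hy g)]
    rfl
  map_smul' c f := smooth_ext fun y hy => by
    have h : smoothExt (c • f) =ᶠ[nhds y] fun x => c * smoothExt f x := by
      filter_upwards [V.isOpen.mem_nhds hy] with x hx using smoothExt_smul hx c f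
    rw [RingHom.id_apply, smoothExt_smul hy, smoothExt_mk hy, smoothExt_mk hy, h.fderiv_eq,
      fderiv_const_mul (differentiableAt_smoothExt hy f)]
    rfl

theorem smoothExt_smoothPartial (i : Fin p) {V : Opens (EuclideanSpace 𝕜 (Fin p))}
    {y : EuclideanSpace 𝕜 (Fin p)} (hy : y ∈ V) (f : (smoothFunctions 𝕜 p).obj (op V)) :
    smoothExt (smoothPartial i V f) y =
      fderiv 𝕜 (smoothExt f) y (EuclideanSpace.single i 1) :=
  smoothExt_of_mem _ hy

theorem contDiff_coord (i : Fin p) : ContDiff 𝕜 ∞ fun y : EuclideanSpace 𝕜 (Fin p) => y i :=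
  (EuclideanSpace.proj (𝕜 := 𝕜) i).contDiff

theorem smoothPartial_coord (i j : Fin p) :
    smoothPartial i ⊤ (smoothMk (fun y => y j) (contDiff_coord (𝕜 := 𝕜) j).contDiffOn) =
      if i = j then 1 else 0 := by
  refine smooth_ext fun y hy => ?_
  have h : smoothExt (V := ⊤) (smoothMk (fun y => y j) (contDiff_coord (𝕜 := 𝕜) j).contDiffOn) =
      EuclideanSpace.proj (𝕜 := 𝕜) j := funext fun y => smoothExt_mk (V := ⊤) trivial _ _
  rw [smoothExt_smoothPartial i hy, h, ContinuousLinearMap.fderiv, smoothExt_of_mem _ hy]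
  have h1 : EuclideanSpace.proj (𝕜 := 𝕜) j (EuclideanSpace.single i (1 : 𝕜)) =
      if j = i then 1 else 0 := by simp
  rw [h1]
  rcases eq_or_ne i j with rfl | hij
  · rw [if_pos rfl, if_pos rfl]
    rfl
  · rw [if_neg hij.symm, if_neg hij]
    rfl

/-- Evaluation of smooth functions at a point. -/
def smoothEval {V : Opens (EuclideanSpace 𝕜 (Fin p))} {y : EuclideanSpace 𝕜 (Fin p)} (hy : y ∈ V) :
    (smoothFunctions 𝕜 p).obj (op V) →ₐ[𝕜] 𝕜 where
  toFun f := f.1 ⟨y, hy⟩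
  map_one' := rfl
  map_mul' _ _ := rfl
  map_zero' := rfl
  map_add' _ _ := rfl
  commutes' _ := rfl

/-- The coordinates of affine space, for the sheaf of smooth functions. -/
noncomputable def smoothCoordinates (𝕜 : Type u) [RCLike 𝕜] (p : ℕ) :
    EvenCoordinates (smoothFunctions 𝕜 p) ⊤ p where
  z i := smoothMk (fun y => y i) (contDiff_coord i).contDiffOn
  d i V _ := smoothPartial i V
  d_mul i V _ f g := smooth_ext fun y hy => by
    have h : smoothExt (f * g) =ᶠ[nhds y] smoothExt f * smoothExt g := by
      filter_upwards [V.isOpen.mem_nhds hy] with x hx using smoothExt_mul hx f g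
    rw [smoothExt_add hy, smoothExt_mul hy, smoothExt_mul hy, smoothExt_smoothPartial i hy,
      smoothExt_smoothPartial i hy, smoothExt_smoothPartial i hy, h.fderiv_eq,
      fderiv_mul (differentiableAt_smoothExt hy f) (differentiableAt_smoothExt hy g)]
    simp only [add_apply, smul_apply, smul_eq_mul]
    ring
  d_res i V _ W h f := smooth_ext fun y hy => by
    have h' : smoothExt (comRes (smoothFunctions 𝕜 p) h f) =ᶠ[nhds y] smoothExt f := by
      filter_upwards [W.isOpen.mem_nhds hy] with x hx using smoothExt_comRes h hx f
    rw [smoothExt_comRes h hy, smoothExt_smoothPartial i (h hy), smoothExt_smoothPartial i hy,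
      h'.fderiv_eq]
  d_self i := (smoothPartial_coord i i).trans (if_pos rfl)
  d_ne i j hij := (smoothPartial_coord i j).trans (if_neg hij)
  eq_zero V hV D D_mul D_res hD f := smooth_ext fun y hy => by
    -- Hadamard's lemma holds on a ball around y, to which D is moved by naturality. There f = f(y)
    -- + Σ (x_i − y_i) g_i; D kills constants and coordinates, and the factors x_i − y_i vanish at
    -- y.
    obtain ⟨r, hr, hrV⟩ := Metric.isOpen_iff.1 V.isOpen y hy
    let W : Opens (EuclideanSpace 𝕜 (Fin p)) := ⟨Metric.ball y r, Metric.isOpen_ball⟩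
    have hW : W ≤ V := hrV
    have hyW : y ∈ W := Metric.mem_ball_self hr
    obtain ⟨g, hg, hfg⟩ := exists_hadamard ((contDiffOn_smoothExt f).mono hrV)
    let c (i : Fin p) : (smoothFunctions 𝕜 p).obj (op V) :=
      comRes _ hV (smoothMk (fun y => y i) (contDiff_coord i).contDiffOn)
    have hDW : ∀ i, D W hW (comRes _ hW (c i)) = 0 := fun i => by
      rw [← D_res V le_rfl W hW, hD, map_zero]
    have hD1 : ∀ a : 𝕜, D W hW (algebraMap 𝕜 _ a) = 0 := fun a => by
      have h1 := D_mul W hW 1 1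
      rw [one_mul, mul_one, one_mul, left_eq_add] at h1
      rw [Algebra.algebraMap_eq_smul_one, map_smul, h1, smul_zero]
    have hf : comRes _ hW f = algebraMap 𝕜 _ (smoothExt f y) +
        ∑ i, (comRes _ hW (c i) - algebraMap 𝕜 _ (y i)) * smoothMk (V := W) (g i) (hg i) := by
      refine Subtype.ext (funext fun x => ?_)
      have h1 := hfg x.1 x.2
      rw [smoothExt_of_mem f (hW x.2)] at h1
      refine h1.trans ?_
      change _ = smoothEval x.2 (algebraMap 𝕜 _ (smoothExt f y) + ∑ i, (comRes _ hW (c i) -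
        algebraMap 𝕜 _ (y i)) * smoothMk (V := W) (g i) (hg i))
      rw [map_add, map_sum, AlgHom.commutes]
      refine congrArg _ (Finset.sum_congr rfl fun i _ => ?_)
      rw [map_mul, map_sub, AlgHom.commutes]
      rfl
    have h0 : smoothEval hyW (D W hW (comRes _ hW f)) = 0 := by
      rw [hf, map_add, hD1, zero_add, map_sum, map_sum]
      refine Finset.sum_eq_zero fun i _ => ?_
      have h2 : smoothEval hyW (comRes _ hW (c i)) = y i := rfl
      rw [D_mul, map_sub, hDW, hD1, sub_zero, zero_mul, zero_add, map_mul, map_sub, h2,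
        AlgHom.commutes, Algebra.algebraMap_self_apply, sub_self, zero_mul]
    rw [← D_res V le_rfl W hW] at h0
    rw [smoothExt_of_mem _ hy, smoothExt_of_mem _ hy]
    exact h0

end SmoothCoordinates

end Superspace

namespace Superspace

/-! ### Coordinates on smooth schemes -/

section EtaleCoordinates

variable {k : Type u} [Field k] {p : ℕ}

/-- Derivations out of an algebra which is formally étale over affine space are determined by their
values on the coordinates. -/
theorem eq_zero_of_formallyEtale {T B : Type u} [CommRing T] [Algebra k T] [CommRing B]
    [Algebra k B] (φ : MvPolynomial (Fin p) k →ₐ[k] T) (hφ : φ.toRingHom.FormallyEtale)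
    (ρ : T →ₐ[k] B) (δ : T →ₗ[k] B) (hδ : ∀ f g, δ (f * g) = δ f * ρ g + ρ f * δ g)
    (h : ∀ i, δ (φ (MvPolynomial.X i)) = 0) (t : T) : δ t = 0 := by
  let : Algebra (MvPolynomial (Fin p) k) T := φ.toRingHom.toAlgebra
  let : Algebra T B := ρ.toRingHom.toAlgebra
  let : Algebra (MvPolynomial (Fin p) k) B := (ρ.comp φ).toRingHom.toAlgebra
  have : IsScalarTower (MvPolynomial (Fin p) k) T B := IsScalarTower.of_algebraMap_eq' rfl
  have : Algebra.FormallyEtale (MvPolynomial (Fin p) k) T := hφ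
  have h1 : δ 1 = 0 := by
    simpa using hδ 1 1
  have hP : ∀ f, δ (φ f) = 0 := fun f => by
    induction f using MvPolynomial.induction_on with
    | C a =>
      rw [← MvPolynomial.algebraMap_eq, AlgHom.commutes, Algebra.algebraMap_eq_smul_one, map_smul,
        h1, smul_zero]
    | add f g hf hg => rw [map_add, map_add, hf, hg, add_zero]
    | mul_X f i hf => rw [map_mul, hδ, hf, h, zero_mul, mul_zero, add_zero]
  let D : Derivation (MvPolynomial (Fin p) k) T B := Derivation.mk'
    { toFun := δ
      map_add' := map_add δ
      map_smul' := fun f t => by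
        change δ (φ f * t) = ρ (φ f) * δ t
        rw [hδ, hP, zero_mul, zero_add] }
    (fun a b => by
      change δ (a * b) = ρ a * δ b + ρ b * δ a
      rw [hδ, add_comm, mul_comm (δ a)])
  change D t = 0
  -- The map δ is linear over the polynomial ring and so factors through relative differentials,
  -- which vanish for a formally étale algebra.
  rw [← Derivation.liftKaehlerDifferential_comp_D D t,
    Subsingleton.elim (KaehlerDifferential.D (MvPolynomial (Fin p) k) T t) 0, map_zero]

/-- The partial derivatives lift to algebras which are formally étale over affine space. -/
theorem exists_derivation_of_formallyEtale {T : Type u} [CommRing T] [Algebra k T]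
    (φ : MvPolynomial (Fin p) k →ₐ[k] T) (hφ : φ.toRingHom.FormallyEtale) (i : Fin p) :
    ∃ δ : T →ₗ[k] T, (∀ f g, δ (f * g) = δ f * g + f * δ g) ∧
      ∀ j, δ (φ (MvPolynomial.X j)) = if i = j then 1 else 0 := by
  let : Algebra (MvPolynomial (Fin p) k) T := φ.toRingHom.toAlgebra
  have : IsScalarTower k (MvPolynomial (Fin p) k) T :=
    IsScalarTower.of_algebraMap_eq fun a => (φ.commutes a).symm
  have : Algebra.FormallyEtale (MvPolynomial (Fin p) k) T := hφ
  let D₀ : Derivation k (MvPolynomial (Fin p) k) T :=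
    MvPolynomial.mkDerivation k fun j => if i = j then 1 else 0
  -- For T formally étale, the differentials of T over k are the base change of those of the
  -- polynomial ring, so the partial derivative extends to T.
  let L : Ω[T⁄k] →ₗ[T] T := D₀.liftKaehlerDifferential.liftBaseChange T ∘ₗ
    (KaehlerDifferential.tensorKaehlerEquivOfFormallyEtale k (MvPolynomial (Fin p) k) T).symm
  refine ⟨(L.compDer (KaehlerDifferential.D k T)).toLinearMap, fun f g => ?_, fun j => ?_⟩
  · refine ((L.compDer (KaehlerDifferential.D k T)).leibniz f g).trans ?_
    rw [add_comm, smul_eq_mul, smul_eq_mul, mul_comm g]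
    rfl
  · change D₀.liftKaehlerDifferential.liftBaseChange T
      ((KaehlerDifferential.tensorKaehlerEquivOfFormallyEtale k (MvPolynomial (Fin p) k) T).symm
        (KaehlerDifferential.D k T (algebraMap (MvPolynomial (Fin p) k) T (MvPolynomial.X j)))) = _
    rw [KaehlerDifferential.tensorKaehlerEquivOfFormallyEtale_symm_D_algebraMap,
      LinearMap.liftBaseChange_tmul, one_smul, Derivation.liftKaehlerDifferential_comp_D,
      MvPolynomial.mkDerivation_X]

/-- Coordinates on an open set with a basis of open subsets whose algebras are formally étale over
affine space. -/
theorem exists_evenCoordinates {Z : TopCat.{u}} (A : TopCat.Presheaf (CommAlgCat.{u} k) Z)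
    (O : Opens Z) (φ : MvPolynomial (Fin p) k →ₐ[k] A.obj (op O)) (ℬ : Set (Opens Z))
    (hℬ : ∀ V ≤ O, ∀ x ∈ V, ∃ W ∈ ℬ, x ∈ W ∧ W ≤ V)
    (het : ∀ W ∈ ℬ, ∀ h : W ≤ O, ((comRes A h).comp φ).toRingHom.FormallyEtale)
    (hglue : ∀ (V : Opens Z) (ι : Type u) (W : ι → Opens Z) (hW : ∀ i, W i ≤ V), V ≤ iSup W →
      ∀ s : ∀ i, A.obj (op (W i)),
        (∀ i j, comRes A (inf_le_left : W i ⊓ W j ≤ W i) (s i) =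
          comRes A (inf_le_right : W i ⊓ W j ≤ W j) (s j)) →
        ∃! t : A.obj (op V), ∀ i, comRes A (hW i) t = s i) :
    Nonempty (EvenCoordinates A O p) := by
  have hcover : ∀ V ≤ O, V ≤ ⨆ W : {W // W ∈ ℬ ∧ W ≤ V}, W.1 := fun V hV x hx => by
    obtain ⟨W, hW, hxW, hWV⟩ := hℬ V hV x hx
    exact Opens.mem_iSup.2 ⟨⟨W, hW, hWV⟩, hxW⟩
  have hsep : ∀ V ≤ O, ∀ s t : A.obj (op V),
      (∀ W ∈ ℬ, ∀ h : W ≤ V, comRes A h s = comRes A h t) → s = t := fun V hV s t hst => by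
    refine (hglue V _ (fun W : {W // W ∈ ℬ ∧ W ≤ V} => W.1) (fun W => W.2.2) (hcover V hV)
      (fun W => comRes A W.2.2 t) fun W W' => ?_).unique (fun W => hst _ W.2.1 W.2.2) fun W => rfl
    rw [comRes_comRes, comRes_comRes]
  have hex : ∀ (i : Fin p) (W : {W // W ∈ ℬ ∧ W ≤ O}), ∃ δ : A.obj (op W.1) →ₗ[k] A.obj (op W.1),
      (∀ f g, δ (f * g) = δ f * g + f * δ g) ∧
        ∀ j, δ (comRes A W.2.2 (φ (MvPolynomial.X j))) = if i = j then 1 else 0 := fun i W =>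
    exists_derivation_of_formallyEtale _ (het W.1 W.2.1 W.2.2) i
  choose δ δ_mul δ_X using hex
  -- Derivative followed by restriction and restriction followed by derivative are derivations along
  -- the restriction map with equal values on the coordinates, so they coincide.
  have δ_res : ∀ i W W' (h : W'.1 ≤ W.1) f,
      comRes A h (δ i W f) = δ i W' (comRes A h f) := fun i W W' h f => by
    rw [← sub_eq_zero]
    refine eq_zero_of_formallyEtale _ (het W.1 W.2.1 W.2.2) (comRes A h)
      ((comRes A h).toLinearMap ∘ₗ δ i W - δ i W' ∘ₗ (comRes A h).toLinearMap)
      (fun f g => ?_) (fun j => ?_) f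
    · change comRes A h (δ i W (f * g)) - δ i W' (comRes A h (f * g)) =
        (comRes A h (δ i W f) - δ i W' (comRes A h f)) * comRes A h g +
          comRes A h f * (comRes A h (δ i W g) - δ i W' (comRes A h g))
      rw [map_mul (comRes A h), δ_mul, δ_mul, map_add, map_mul, map_mul]
      ring
    · change comRes A h (δ i W (comRes A _ (φ _))) - δ i W' (comRes A h (comRes A _ (φ _))) = 0
      rw [comRes_comRes, δ_X, δ_X, apply_ite (comRes A h), map_one, map_zero, sub_self]
  -- The derivatives on members of ℬ inside V are glued. An overlap need not belong to ℬ, so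
  -- agreement there is checked on smaller members.
  have hd : ∀ (i : Fin p) (V : Opens Z) (hV : V ≤ O) (f : A.obj (op V)), ∃ t : A.obj (op V),
      ∀ (W : Opens Z) (hW : W ∈ ℬ) (h : W ≤ V),
        comRes A h t = δ i ⟨W, hW, h.trans hV⟩ (comRes A h f) := fun i V hV f => by
    obtain ⟨t, ht, -⟩ := hglue V _ (fun W : {W // W ∈ ℬ ∧ W ≤ V} => W.1) (fun W => W.2.2)
      (hcover V hV) (fun W => δ i ⟨W.1, W.2.1, W.2.2.trans hV⟩ (comRes A W.2.2 f)) fun W W' => by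
        refine hsep _ (inf_le_left.trans (W.2.2.trans hV)) _ _ fun W'' hW'' h => ?_
        have hO : W'' ≤ O := h.trans (inf_le_left.trans (W.2.2.trans hV))
        have h1 := δ_res i ⟨W.1, W.2.1, W.2.2.trans hV⟩ ⟨W'', hW'', hO⟩ (h.trans inf_le_left)
          (comRes A W.2.2 f)
        have h2 := δ_res i ⟨W'.1, W'.2.1, W'.2.2.trans hV⟩ ⟨W'', hW'', hO⟩ (h.trans inf_le_right)
          (comRes A W'.2.2 f)
        rw [comRes_comRes] at h1 h2
        rw [comRes_comRes, comRes_comRes]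
        exact h1.trans h2.symm
    exact ⟨t, fun W hW h => ht ⟨W, hW, h⟩⟩
  choose d hd using hd
  have d_X : ∀ i j, d i O le_rfl (φ (MvPolynomial.X j)) = if i = j then 1 else 0 := fun i j =>
    hsep O le_rfl _ _ fun W hW h => by
      rw [hd i O le_rfl _ W hW h, δ_X i ⟨W, hW, h⟩, apply_ite (comRes A h), map_one, map_zero]
  exact ⟨{
    z := fun j => φ (MvPolynomial.X j)
    d := fun i V hV =>
      { toFun := d i V hV
        map_add' := fun f g => hsep V hV _ _ fun W hW h => by
          rw [map_add, hd i V hV _ W hW h, hd i V hV _ W hW h, hd i V hV _ W hW h, map_add, map_add]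
        map_smul' := fun c f => hsep V hV _ _ fun W hW h => by
          rw [RingHom.id_apply, map_smul, hd i V hV _ W hW h, hd i V hV _ W hW h, map_smul,
            map_smul] }
    d_mul := fun i V hV f g => hsep V hV _ _ fun W hW h => by
      change comRes A h (d i V hV (f * g)) = comRes A h (d i V hV f * g + f * d i V hV g)
      rw [map_add, map_mul, map_mul, hd i V hV _ W hW h, hd i V hV _ W hW h, hd i V hV _ W hW h,
        map_mul, δ_mul]
    d_res := fun i V hV V' h f => hsep V' (h.trans hV) _ _ fun W hW h' => by
      change comRes A h' (comRes A h (d i V hV f)) = comRes A h' (d i V' _ (comRes A h f))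
      rw [comRes_comRes, hd i V hV _ W hW _, hd i V' _ _ W hW _, comRes_comRes]
    d_self := fun i => (d_X i i).trans (if_pos rfl)
    d_ne := fun i j hij => (d_X i j).trans (if_neg hij)
    eq_zero := fun V hV D D_mul D_res hD f => hsep V hV _ _ fun W hW h => by
      rw [D_res V le_rfl W h, map_zero]
      refine eq_zero_of_formallyEtale _ (het W hW (h.trans hV)) (AlgHom.id k _) (D W h)
        (D_mul W h) (fun j => ?_) _
      change D W h (comRes A _ (φ _)) = 0
      rw [← comRes_comRes A hV h, ← D_res V le_rfl W h, hD, map_zero] }⟩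

end EtaleCoordinates

end Superspace

namespace Superspace

/-! ### Coordinates on smooth schemes -/

section SmoothScheme

open AlgebraicGeometry

variable {k : Type u} [Field k] {Z : Scheme.{u}} (f : Z ⟶ Spec (CommRingCat.of k))

theorem regularFunctions_glue (V : Z.Opens) (ι : Type u) (W : ι → Z.Opens) (hW : ∀ i, W i ≤ V)
    (hV : V ≤ iSup W) (s : ∀ i, (regularFunctions f).obj (op (W i)))
    (hs : ∀ i j, comRes (regularFunctions f) (inf_le_left : W i ⊓ W j ≤ W i) (s i) =
      comRes (regularFunctions f) (inf_le_right : W i ⊓ W j ≤ W j) (s j)) :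
    ∃! t : (regularFunctions f).obj (op V), ∀ i, comRes (regularFunctions f) (hW i) t = s i :=
  TopCat.Sheaf.existsUnique_gluing' Z.sheaf W V (fun i => homOfLE (hW i)) hV
    (fun i => (show Γ(Z, W i) from s i)) fun i j => hs i j

/-- Restriction to a basic open subset of an affine open set is a localization, and localizations
are formally étale. -/
theorem formallyEtale_comRes_basicOpen {O : Z.Opens} (hO : IsAffineOpen O) (g : Γ(Z, O))
    (h : Z.basicOpen g ≤ O) :
    (comRes (regularFunctions f) h).toRingHom.FormallyEtale := by
  let : Algebra ((regularFunctions f).obj (op O)) ((regularFunctions f).obj (op (Z.basicOpen g))) :=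
    (comRes (regularFunctions f) h).toRingHom.toAlgebra
  have : IsLocalization.Away (R := (regularFunctions f).obj (op O)) g
      ((regularFunctions f).obj (op (Z.basicOpen g))) := hO.isLocalization_basicOpen g
  exact Algebra.FormallyEtale.of_isLocalization
    (Submonoid.powers (show (regularFunctions f).obj (op O) from g))

/-- Locally a smooth scheme is given by a standard smooth algebra, which is étale over a polynomial
ring in p variables. -/
theorem exists_etale_regularFunctions {p : ℕ} [SmoothOfRelativeDimension p f] (y : Z) :
    ∃ O : Z.Opens, IsAffineOpen O ∧ y ∈ O ∧
      ∃ φ : MvPolynomial (Fin p) k →ₐ[k] (regularFunctions f).obj (op O),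
        φ.toRingHom.FormallyEtale := by
  obtain ⟨U, hU, O, hO, hy, e, h⟩ :=
    SmoothOfRelativeDimension.exists_isStandardSmoothOfRelativeDimension (n := p) (f := f) y
  -- The spectrum of a field is a single point, so the open set of the base containing the image of
  -- y is everything.
  have hU' : U = ⊤ := by
    refine top_le_iff.1 fun x _ => ?_
    have : Subsingleton (PrimeSpectrum k) := inferInstance
    rw [show x = f y from Subsingleton.elim (α := PrimeSpectrum k) _ _]
    exact e hy
  subst hU'
  refine ⟨O, hO, hy, ?_⟩
  have h1 : (algebraMap k ((regularFunctions f).obj (op O))).IsStandardSmoothOfRelativeDimension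
      p :=
    RingHom.isStandardSmoothOfRelativeDimension_respectsIso.2 _
      (Scheme.ΓSpecIso (CommRingCat.of k)).symm.commRingCatIsoToRingEquiv h
  rw [RingHom.isStandardSmoothOfRelativeDimension_algebraMap] at h1
  obtain ⟨φ, hφ⟩ := Algebra.IsStandardSmoothOfRelativeDimension.exists_etale_mvPolynomial p k
    ((regularFunctions f).obj (op O))
  exact ⟨φ, hφ.formallyEtale⟩

/-- The basis ℬ consists of the basic open sets of O; their algebras are localizations of one that
is étale over affine space. -/
theorem exists_evenCoordinates_regularFunctions {p : ℕ} [SmoothOfRelativeDimension p f] (y : Z) :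
    ∃ O : Z.Opens, y ∈ O ∧ Nonempty (EvenCoordinates (regularFunctions f) O p) := by
  obtain ⟨O, hO, hy, φ, hφ⟩ := exists_etale_regularFunctions (p := p) f y
  refine ⟨O, hy, exists_evenCoordinates (regularFunctions f) O φ
    (Set.range fun g : Γ(Z, O) => Z.basicOpen g)
    (fun V hV x hx => ?_) ?_ (regularFunctions_glue f)⟩
  · obtain ⟨g, h1, h2⟩ := hO.exists_basicOpen_le ⟨x, hx⟩ (hV hx)
    exact ⟨_, ⟨g, rfl⟩, h2, h1⟩
  · rintro _ ⟨g, rfl⟩ h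
    exact RingHom.FormallyEtale.comp hφ (formallyEtale_comRes_basicOpen f hO g h)

end SmoothScheme

/-! ### Local coordinates on supermanifolds and the main theorem -/

theorem SplitChart.exists_coordinates {k : Type u} [Field k] {M : Superspace k} {U : Opens M.space}
    {Z : TopCat.{u}} {A : TopCat.Presheaf (CommAlgCat.{u} k) Z} {p q : ℕ} (c : M.SplitChart U Z A q)
    {y : M.space} (hy : y ∈ U) {O : Opens Z} (h : c.map ⟨y, hy⟩ ∈ O) (e : EvenCoordinates A O p) :
    ∃ V : Opens M.space, y ∈ V ∧ Nonempty (M.Coordinates V p q) :=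
  ⟨c.preim O, c.mem_preim hy h, ⟨c.coordinates e (c.preim_le O) (c.im_preim_le O)⟩⟩

/-- Supermanifolds have local coordinates. -/
theorem IsSupermanifold.exists_coordinates {k : Type u} [Field k] {M : Superspace k} {p q : ℕ}
    (hM : M.IsSupermanifold p q) : CharZero k ∧
      ∀ y : M.space, ∃ U : Opens M.space, y ∈ U ∧ Nonempty (M.Coordinates U p q) := by
  cases hM with
  | analytic _ _ _ h =>
    refine ⟨inferInstance, fun y => ?_⟩
    obtain ⟨U, hy, ⟨c⟩⟩ := h y
    exact c.exists_coordinates hy (O := ⊤) trivial (smoothCoordinates k p)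
  | algebraic _ _ _ h =>
    refine ⟨inferInstance, fun y => ?_⟩
    obtain ⟨U, hy, Z, f, hf, ⟨c⟩⟩ := h y
    obtain ⟨O, hO, ⟨e⟩⟩ := exists_evenCoordinates_regularFunctions (p := p) f (c.map ⟨y, hy⟩)
    exact c.exists_coordinates hy hO e

end Superspace

theorem mainTheorem6 {k : Type u} [Field k] (M : Superspace k) (p q : ℕ)
    (hM : M.IsSupermanifold p q) :
    (∃! δ : ∀ n, M.spencerSheaf (n + 1) ⟶ M.spencerSheaf n, M.IsSpencerDifferential p q δ) ∧
    ∀ δ : ∀ n, M.spencerSheaf (n + 1) ⟶ M.spencerSheaf n, M.IsSpencerDifferential p q δ →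
      ∃ hδ : ∀ n, δ (n + 1) ≫ δ n = 0,
        (∀ n, Limits.IsZero ((M.spencerComplex δ hδ).homology (n + 1))) ∧
        ∃ e : (M.spencerComplex δ hδ).homology 0 ≅ M.fnSheaf,
          (M.spencerComplex δ hδ).homologyπ 0 ≫ e.hom =
            (M.spencerComplex δ hδ).iCycles 0 ≫ M.augmentation := by
  -- The three kinds of supermanifold enter only through characteristic zero and the existence of
  -- local coordinates.
  obtain ⟨hk, hloc⟩ := hM.exists_coordinates
  refine ⟨Superspace.existsUnique_isSpencerDifferential hloc, fun δ hδ => ?_⟩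
  exact ⟨hδ.comp_eq_zero hloc, hδ.isZero_homology_succ hloc _,
    hδ.exists_homology_zero_iso hloc _⟩
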